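/- Let $\mathbb{S}^1=\mathbb{R}/\mathbb{Z}$, $\mathbf{e}_k(x)=e^{2\pi i k x}$ and $\hat u(k)=\int_{\mathbb{S}^1}u\,\mathbf{e}_{-k}\,dx$. For $\sigma\ge 0$ let $H^\sigma(\mathbb{S}^1)$ be the completion of $C^\infty(\mathbb{S}^1)$ (real-valued functions) for the norm $\|u\|_{H^\sigma}=\big(\sum_{k\in\mathbb{Z}}(1+k^2)^\sigma|\hat u(k)|^2\big)^{1/2}$. For $q>3/2$ let $\mathcal{D}^q(\mathbb{S}^1)$ be the set of orientation-preserving diffeomorphisms $\varphi$ of $\mathbb{S}^1$ such that $\varphi$ and $\varphi^{-1}$ are of class $H^q$; it is a Hilbert manifold modelled on $H^q(\mathbb{S}^1)$, with charts $u\mapsto\varphi_0+u \pmod 1$ defined for small $u\in H^q(\mathbb{S}^1)$ near each $\varphi_0\in\mathcal{D}^q(\mathbb{S}^1)$. Write $R_\varphi u=u\circ\varphi$, and for $s\in\mathbb{R}$ let $\Lambda^{2s}=\mathrm{op}\big((1+n^2)^s\big)$ be the Fourier multiplier $$\Lambda^{2s}u=\sum_{k\in\mathbb{Z}}(1+k^2)^s\,\hat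 u(k)\,\mathbf{e}_k .$$ **Corollary.** Let $s\in\mathbb{R}$ with $s\ge 1/2$ and let $q\in(\tfrac32+2s,\infty)$. Then for every $\varphi\in\mathcal{D}^q(\mathbb{S}^1)$ the operators $R_{\varphi^{-1}}\colon H^q\to H^q$, $\Lambda^{2s}\colon H^q\to H^{q-2s}$ and $R_\varphi\colon H^{q-2s}\to H^{q-2s}$ are well defined and bounded, and the map $$\varphi\mapsto R_\varphi\circ\Lambda^{2s}\circ R_{\varphi^{-1}},\qquad \mathcal{D}^q(\mathbb{S}^1)\to\mathcal{L}\big(H^q(\mathbb{S}^1),H^{q-2s}(\mathbb{S}^1)\big),$$ is smooth ($C^\infty$). -/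

import Mathlib

open scoped ContDiff

/-- The Fourier coefficient `û(k) = ∫ u(x) exp(-2πikx) dx` of a real-valued continuous function `u` on
the circle `ℝ/ℤ`. -/
noncomputable def circleCoeff (u : C(UnitAddCircle, ℝ)) (k : ℤ) : ℂ :=
  fourierCoeff (fun x : UnitAddCircle => ((u x : ℝ) : ℂ)) k

theorem circleCoeff_integrable (u : C(UnitAddCircle, ℝ)) :
    MeasureTheory.Integrable (fun x : UnitAddCircle => ((u x : ℝ) : ℂ))
      AddCircle.haarAddCircle :=
  (Complex.continuous_ofReal.comp u.continuous).integrable_of_hasCompactSupport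
    (HasCompactSupport.of_compactSpace _)

theorem circleCoeff_add (u v : C(UnitAddCircle, ℝ)) (k : ℤ) :
    circleCoeff (u + v) k = circleCoeff u k + circleCoeff v k := by
  have h := fourierCoeff.add (circleCoeff_integrable u) (circleCoeff_integrable v)
  have h' := congrFun h k
  simp only [Pi.add_apply] at h'
  rw [circleCoeff, circleCoeff, circleCoeff, ← h']
  congr 1
  funext x
  simp

theorem circleCoeff_smul (c : ℝ) (u : C(UnitAddCircle, ℝ)) (k : ℤ) :
    circleCoeff (c • u) k = (c : ℂ) * circleCoeff u k := by
  rw [circleCoeff, circleCoeff, ← fourierCoeff.const_mul]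
  congr 1
  funext x
  simp

theorem circleCoeff_injective {u : C(UnitAddCircle, ℝ)} (h : ∀ k, circleCoeff u k = 0) :
    u = 0 := by
  let g : C(UnitAddCircle, ℂ) := ⟨fun x => ((u x : ℝ) : ℂ),
    Complex.continuous_ofReal.comp u.continuous⟩
  have hg : fourierCoeff g = 0 := funext h
  have hs : Summable (fourierCoeff g) := by rw [hg]; exact summable_zero
  ext x
  have h1 := has_pointwise_sum_fourier_series_of_summable hs x
  have h2 : (g x : ℂ) = 0 := by
    refine h1.unique ?_
    rw [hg]
    simp
  exact Complex.ofReal_eq_zero.mp h2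

/-- The weighted coefficients `(1 + k²)^(σ/2) û(k)`, whose `ℓ²` norm is the `H^σ` norm of `u`. -/
noncomputable def weightedCoeff (σ : ℝ) (u : C(UnitAddCircle, ℝ)) (k : ℤ) : ℂ :=
  (((1 + (k : ℝ) ^ 2) ^ (σ / 2) : ℝ) : ℂ) * circleCoeff u k

theorem weightedCoeff_add (σ : ℝ) (u v : C(UnitAddCircle, ℝ)) :
    weightedCoeff σ (u + v) = weightedCoeff σ u + weightedCoeff σ v := by
  funext k
  simp only [weightedCoeff, circleCoeff_add, Pi.add_apply]
  ring

theorem weightedCoeff_smul (σ : ℝ) (c : ℝ) (u : C(UnitAddCircle, ℝ)) :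
    weightedCoeff σ (c • u) = c • weightedCoeff σ u := by
  funext k
  simp only [weightedCoeff, circleCoeff_smul, Pi.smul_apply, Complex.real_smul]
  ring

theorem norm_weightedCoeff_sq (σ : ℝ) (u : C(UnitAddCircle, ℝ)) (k : ℤ) :
    ‖weightedCoeff σ u k‖ ^ 2 = (1 + (k : ℝ) ^ 2) ^ σ * ‖circleCoeff u k‖ ^ 2 := by
  have h : (0 : ℝ) ≤ 1 + (k : ℝ) ^ 2 := by positivity
  rw [weightedCoeff, norm_mul, mul_pow, Complex.norm_real, Real.norm_of_nonneg (by positivity),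
    ← Real.rpow_natCast, ← Real.rpow_mul h]
  norm_num

theorem memℓp_weightedCoeff_iff (σ : ℝ) (u : C(UnitAddCircle, ℝ)) :
    Memℓp (weightedCoeff σ u) 2 ↔
      Summable fun k : ℤ => (1 + (k : ℝ) ^ 2) ^ σ * ‖circleCoeff u k‖ ^ 2 := by
  rw [memℓp_gen_iff (by norm_num)]
  simp only [← norm_weightedCoeff_sq]
  norm_num

/-- The real vector space of continuous functions `u : ℝ/ℤ → ℝ` with
`∑ₖ (1 + k²)^σ |û(k)|² < ∞`. -/
noncomputable def sobolevSubmodule (σ : ℝ) : Submodule ℝ C(UnitAddCircle, ℝ) where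
  carrier := {u | Summable fun k : ℤ => (1 + (k : ℝ) ^ 2) ^ σ * ‖circleCoeff u k‖ ^ 2}
  zero_mem' := by
    have h : ∀ k, circleCoeff 0 k = 0 := fun k => by
      simpa using circleCoeff_smul 0 0 k
    simp [h]
  add_mem' {u v} hu hv := by
    simp only [Set.mem_ofPred_eq, ← memℓp_weightedCoeff_iff] at hu hv ⊢
    rw [weightedCoeff_add]
    exact hu.add hv
  smul_mem' c u hu := by
    simp only [Set.mem_ofPred_eq, ← memℓp_weightedCoeff_iff] at hu ⊢
    rw [weightedCoeff_smul]
    exact hu.const_smul c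

/-- The Sobolev space `H^σ(ℝ/ℤ)` of real-valued functions, for `σ > 1/2`. In this range the completion
of `C^∞(ℝ/ℤ)` for the `H^σ` norm consists of the continuous functions with finite `H^σ` norm
(finiteness of the norm makes the Fourier series absolutely convergent), so its elements are
taken to be those continuous functions. -/
def SobolevCircle (σ : ℝ) : Type := sobolevSubmodule σ

namespace SobolevCircle

variable {σ : ℝ}

noncomputable instance : AddCommGroup (SobolevCircle σ) :=
  inferInstanceAs (AddCommGroup (sobolevSubmodule σ))

noncomputable instance : Module ℝ (SobolevCircle σ) :=
  inferInstanceAs (Module ℝ (sobolevSubmodule σ))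

/-- The continuous function underlying an element of `H^σ`. -/
def toCont (u : SobolevCircle σ) : C(UnitAddCircle, ℝ) := Subtype.val u

instance : CoeFun (SobolevCircle σ) (fun _ => UnitAddCircle → ℝ) := ⟨fun u => u.toCont⟩

/-- The linear map `u ↦ ((1 + k²)^(σ/2) û(k))ₖ` from `H^σ` to `ℓ²(ℤ)`. -/
noncomputable def toLp2 (σ : ℝ) : SobolevCircle σ →ₗ[ℝ] lp (fun _ : ℤ => ℂ) 2 where
  toFun u := ⟨weightedCoeff σ u.toCont, (memℓp_weightedCoeff_iff σ u.toCont).2 u.2⟩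
  map_add' u v := Subtype.ext (weightedCoeff_add σ u.toCont v.toCont)
  map_smul' c u := Subtype.ext (weightedCoeff_smul σ c u.toCont)

theorem toLp2_injective (σ : ℝ) : Function.Injective (toLp2 σ) := by
  rw [← LinearMap.ker_eq_bot, LinearMap.ker_eq_bot']
  intro u hu
  refine Subtype.ext (circleCoeff_injective fun k => ?_)
  have h : weightedCoeff σ u.toCont k = 0 := by
    exact congrArg (fun a : lp (fun _ : ℤ => ℂ) 2 => a k) hu
  have hk : (0 : ℝ) < (1 + (k : ℝ) ^ 2) ^ (σ / 2) := by positivity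
  rcases mul_eq_zero.mp h with h | h
  · exact absurd (Complex.ofReal_eq_zero.mp h) hk.ne'
  · exact h

noncomputable instance : NormedAddCommGroup (SobolevCircle σ) :=
  NormedAddCommGroup.induced _ _ (toLp2 σ) (toLp2_injective σ)

noncomputable instance : NormedSpace ℝ (SobolevCircle σ) :=
  NormedSpace.induced ℝ _ _ (toLp2 σ)

/-- The norm is `‖u‖ = (∑ₖ (1 + k²)^σ |û(k)|²)^(1/2)`. -/
theorem norm_eq (u : SobolevCircle σ) :
    ‖u‖ = Real.sqrt (∑' k : ℤ, (1 + (k : ℝ) ^ 2) ^ σ * ‖circleCoeff u.toCont k‖ ^ 2) := by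
  have h : ‖u‖ = ‖toLp2 σ u‖ := rfl
  rw [h, lp.norm_eq_tsum_rpow (by norm_num), Real.sqrt_eq_rpow]
  simp only [← norm_weightedCoeff_sq]
  norm_num
  rfl

end SobolevCircle

/-- A homeomorphism `φ` of `ℝ/ℤ` which is orientation preserving and of Sobolev class `H^q`:
`φ(x) = x + u(x) mod 1` for a (real-valued, periodic) displacement `u ∈ H^q`, that is, `φ` has a lift
`x ↦ x + u(x)` to the real line. -/
def IsSobolevMap (q : ℝ) (φ : UnitAddCircle ≃ₜ UnitAddCircle) : Prop :=
  ∃ u : SobolevCircle q, ∀ x, φ x = x + ((u x : ℝ) : UnitAddCircle)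

/-- For `q > 3/2`, the set `𝒟^q` of orientation preserving diffeomorphisms `φ` of `ℝ/ℤ` such that both
`φ` and `φ⁻¹` are of class `H^q` (both are then `C¹`, as `H^q ⊂ C¹`). -/
def SobolevDiff (q : ℝ) : Type :=
  {φ : UnitAddCircle ≃ₜ UnitAddCircle // IsSobolevMap q φ ∧ IsSobolevMap q φ.symm}

namespace SobolevDiff

variable {q : ℝ}

/-- The homeomorphism underlying an element of `𝒟^q`. -/
def toHomeo (φ : SobolevDiff q) : UnitAddCircle ≃ₜ UnitAddCircle := Subtype.val φ

instance : CoeFun (SobolevDiff q) (fun _ => UnitAddCircle → UnitAddCircle) := ⟨fun φ => φ.toHomeo⟩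

/-- The inverse diffeomorphism. -/
instance : Inv (SobolevDiff q) := ⟨fun φ => ⟨φ.toHomeo.symm, φ.2.2, φ.2.1⟩⟩

/-- Smoothness (`C^∞`, in the Fréchet sense) of a map from the Hilbert manifold `𝒟^q` to a normed
space. Around `φ₀`, the manifold `𝒟^q` is parametrized by small `u ∈ H^q` through the exponential chart
`u ↦ φ₀ + u mod 1` of the flat circle (two such charts differ by translations of `H^q`); the
definition asks that `φ₀ + u` lies in `𝒟^q` for all `u` in some ball of `H^q`, and that `F` read in
this chart is `C^∞` on that ball. -/
def IsSmooth {E : Type*} [NormedAddCommGroup E] [NormedSpace ℝ E] (F : SobolevDiff q → E) : Prop :=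
  ∀ φ₀ : SobolevDiff q, ∃ ε : ℝ, 0 < ε ∧ ∃ c : SobolevCircle q → SobolevDiff q,
    (∀ u ∈ Metric.ball (0 : SobolevCircle q) ε, ∀ x : UnitAddCircle,
      c u x = φ₀ x + ((u x : ℝ) : UnitAddCircle)) ∧
    ContDiffOn ℝ ∞ (fun u => F (c u)) (Metric.ball (0 : SobolevCircle q) ε)

end SobolevDiff

/-- `T` is right translation by `φ` on `H^σ`: `T u = u ∘ φ`. -/
def IsRightTranslation {q σ : ℝ} (φ : SobolevDiff q)
    (T : SobolevCircle σ →L[ℝ] SobolevCircle σ) : Prop :=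
  ∀ (u : SobolevCircle σ) (x : UnitAddCircle), T u x = u (φ x)

/-- `P : H^σ → H^τ` is the Fourier multiplier `op(p)` with symbol `p`:
`(P u)(x) = ∑ₖ p(k) û(k) exp(2πikx)`. -/
def IsFourierMultiplier {σ τ : ℝ} (p : ℤ → ℂ)
    (P : SobolevCircle σ →L[ℝ] SobolevCircle τ) : Prop :=
  ∀ (u : SobolevCircle σ) (x : UnitAddCircle),
    HasSum (fun k : ℤ => p k * circleCoeff u.toCont k * fourier k x) ((P u x : ℝ) : ℂ)

/-! Near the identity let φ = id + u, g = f ∘ φ⁻¹ and p(ξ) = (1 + ξ²)^s, a symbol of order r = 2s ≥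
1. At x, the conjugated operator applied to f is ∑ p(ξ) ĝ(ξ) e_ξ(φ(x)). A change of variables and an
integration by parts turn ĝ(ξ) e_ξ(φ(x)) into f̂(ξ) e_ξ(x) plus e_ξ(x) times the ξ-th Fourier
coefficient, in y, of f'(y) (exp(c(u(x) - u(y))) - 1)/c with c = 2πiξ
(`fourierCoeff_mul_fourier_lift`). Expanding the exponential gives a power series in u. A factor
e_k(x) - e_k(y) acts on symbols as a finite difference with step k
(`hasSum_mul_fourierCoeff_prod_sub`), so the Taylor coefficient of order n + 1 is a multilinear
Fourier multiplier whose symbol is m (2πi)^(n+1)/(n+1)! times an (n+1)-fold difference of ξ^n p(ξ)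
at m, the frequency of f (`conjSymbol`).

The differences cancel the derivatives that R_φ and R_φ⁻¹ would lose separately. Cauchy estimates
for the holomorphic extension of p bound the (n+1)-st derivative of ξ^n p(ξ) by (n+1)! Cⁿ⁺¹
(1+|ξ|)^(r-1). Hence the symbol is at most geometric in n, up to a power of n + 1, times the product
of the weights 1 + |κ_j|, the largest one raised to the power r (`SymbolBound.norm_conjSymbol_le`).
Young's inequality ℓ² * ℓ¹ * ⋯ * ℓ¹ ⊂ ℓ², with H^q ⊂ {∑ (1+|k|)|û(k)| < ∞} for q > 3/2, makes the
Taylor coefficients bounded from H^q to H^(q-r), and the series converges on a ball.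

The expansion converges absolutely for symbols decaying faster than every exponential. It is
therefore proved for p(ξ) exp(-εξ²), whose symbol bounds are uniform in ε, and then ε tends to 0.

Boundedness of right translations comes from the same expansion with order σ and target ℓ²: it
bounds (op(p_ε) g) ∘ φ in L², hence g in H^σ, when u is small (`exists_comp_bound`). A general
diffeomorphism is joined to the identity by the segment id + tv, cut into small steps. The
increments are controlled uniformly through second derivatives, which is where q > 5/2 enters.

At a general φ₀ one has φ₀ + u = (id + u ∘ φ₀⁻¹) ∘ φ₀. The map in the chart is thus the analytic
family at the identity, evaluated at the bounded linear image u ∘ φ₀⁻¹ and composed with two fixed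
bounded operators. -/

open scoped ENNReal

/-! ### Frequency weights -/

/-- The weight `1 + |k|` of a frequency. -/
noncomputable def freqWeight (k : ℤ) : ℝ := 1 + |(k : ℝ)|

theorem one_le_freqWeight (k : ℤ) : 1 ≤ freqWeight k := by
  unfold freqWeight; linarith [abs_nonneg (k : ℝ)]

theorem freqWeight_pos (k : ℤ) : 0 < freqWeight k := one_pos.trans_le (one_le_freqWeight k)

theorem abs_le_freqWeight (k : ℤ) : |(k : ℝ)| ≤ freqWeight k := by
  unfold freqWeight; linarith

theorem one_add_sq_rpow_le {σ : ℝ} (hσ : 0 ≤ σ) (k : ℤ) :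
    (1 + (k : ℝ) ^ 2) ^ σ ≤ (freqWeight k ^ σ) ^ 2 := by
  have h : (freqWeight k ^ σ) ^ 2 = (freqWeight k ^ 2) ^ σ := by
    rw [← Real.rpow_natCast, ← Real.rpow_natCast, ← Real.rpow_mul (freqWeight_pos k).le,
      ← Real.rpow_mul (freqWeight_pos k).le, mul_comm]
  rw [h]
  refine Real.rpow_le_rpow (by positivity) ?_ hσ
  unfold freqWeight
  nlinarith [abs_nonneg (k : ℝ), sq_abs (k : ℝ)]

theorem freqWeight_rpow_sq_le {σ : ℝ} (hσ : 0 ≤ σ) (k : ℤ) :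
    (freqWeight k ^ σ) ^ 2 ≤ 2 ^ σ * (1 + (k : ℝ) ^ 2) ^ σ := by
  have h : (freqWeight k ^ σ) ^ 2 = (freqWeight k ^ 2) ^ σ := by
    rw [← Real.rpow_natCast, ← Real.rpow_natCast, ← Real.rpow_mul (freqWeight_pos k).le,
      ← Real.rpow_mul (freqWeight_pos k).le, mul_comm]
  rw [h, ← Real.mul_rpow (by norm_num) (by positivity)]
  refine Real.rpow_le_rpow (by have := freqWeight_pos k; positivity) ?_ hσ
  unfold freqWeight
  nlinarith [sq_nonneg (1 - |(k : ℝ)|), sq_abs (k : ℝ)]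

theorem summable_freqWeight_rpow {p : ℝ} (hp : p < -1) :
    Summable fun k : ℤ => freqWeight k ^ p := by
  have h0 : Summable fun n : ℕ => ((n : ℝ) + 1) ^ p := by
    have := (summable_nat_add_iff 1).2 (Real.summable_nat_rpow.2 hp)
    simpa using this
  refine Summable.of_nat_of_neg ?_ ?_ <;>
  · refine h0.congr fun n => ?_
    simp [freqWeight, add_comm]

/-! ### Absolutely convergent Fourier series -/

/-- The sum of the Fourier series with coefficients `a`. -/
noncomputable def trigSeries (a : ℤ → ℂ) (x : UnitAddCircle) : ℂ := ∑' k, a k * fourier k x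

theorem norm_fourier_apply (k : ℤ) (x : UnitAddCircle) : ‖(fourier k x : ℂ)‖ = 1 :=
  Circle.norm_coe _

theorem summable_mul_fourier {a : ℤ → ℂ} (ha : Summable fun k => ‖a k‖) (x : UnitAddCircle) :
    Summable fun k => a k * fourier k x :=
  Summable.of_norm (by simpa only [norm_mul, norm_fourier_apply, mul_one] using ha)

theorem continuous_trigSeries {a : ℤ → ℂ} (ha : Summable fun k => ‖a k‖) :
    Continuous (trigSeries a) :=
  continuous_tsum (fun k => continuous_const.mul (fourier k).continuous) ha
    fun k x => by rw [norm_mul, norm_fourier_apply, mul_one]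

theorem integrable_of_continuous_circle {f : UnitAddCircle → ℂ} (hf : Continuous f) :
    MeasureTheory.Integrable f AddCircle.haarAddCircle :=
  hf.integrable_of_hasCompactSupport (HasCompactSupport.of_compactSpace _)

theorem fourierCoeff_trigSeries {a : ℤ → ℂ} (ha : Summable fun k => ‖a k‖) (n : ℤ) :
    fourierCoeff (trigSeries a) n = a n := by
  have h1 : HasSum (fun k => ∫ x : UnitAddCircle, fourier (-n) x • (a k * fourier k x)
      ∂AddCircle.haarAddCircle) (fourierCoeff (trigSeries a) n) := by
    have h := MeasureTheory.hasSum_integral_of_summable_integral_norm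
      (μ := (AddCircle.haarAddCircle : MeasureTheory.Measure UnitAddCircle))
      (F := fun (k : ℤ) (x : UnitAddCircle) => (fourier (-n) x • (a k * fourier k x) : ℂ))
      (fun k => integrable_of_continuous_circle
        ((fourier (-n)).continuous.smul (continuous_const.mul (fourier k).continuous))) (by
        simpa only [norm_smul, norm_mul, norm_fourier_apply, mul_one, one_mul,
          MeasureTheory.integral_const, MeasureTheory.probReal_univ, one_smul] using ha)
    have e : fourierCoeff (trigSeries a) n = ∫ x : UnitAddCircle,
        ∑' k, (fourier (-n) x • (a k * fourier k x) : ℂ) ∂AddCircle.haarAddCircle := by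
      simp only [fourierCoeff, trigSeries, smul_eq_mul, tsum_mul_left]
    rw [e]
    exact h
  refine h1.unique ?_
  have h2 : ∀ k, ∫ x : UnitAddCircle, fourier (-n) x • (a k * fourier k x)
      ∂AddCircle.haarAddCircle = if k = n then a n else 0 := by
    intro k
    have h4 := fourierCoeff.const_mul (T := 1) (fun x => fourier k x) (a k) n
    unfold fourierCoeff at h4
    rw [h4]
    have h5 := congrFun (fourierCoeff_fourier (T := 1) k) n
    unfold fourierCoeff at h5
    rw [h5]
    by_cases hk : k = n
    · subst hk; simp
    · simp [hk, Ne.symm hk]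
  simp_rw [h2]
  exact hasSum_ite_eq n (a n)

theorem hasSum_fourierCoeff {f : UnitAddCircle → ℂ} (hf : Continuous f)
    (hs : Summable fun k => ‖fourierCoeff f k‖) (x : UnitAddCircle) :
    HasSum (fun k => fourierCoeff f k * fourier k x) (f x) := by
  simpa using has_pointwise_sum_fourier_series_of_summable (f := ⟨f, hf⟩) hs.of_norm x

theorem fourierCoeff_conj (f : UnitAddCircle → ℂ) (n : ℤ) :
    fourierCoeff (fun x => (starRingEnd ℂ) (f x)) n =
      (starRingEnd ℂ) (fourierCoeff f (-n)) := by
  unfold fourierCoeff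
  rw [← integral_conj]
  congr 1
  funext x
  simp only [smul_eq_mul, map_mul, neg_neg]
  rw [fourier_neg]

theorem circleCoeff_re {f : UnitAddCircle → ℂ} (hf : Continuous f) (n : ℤ) :
    circleCoeff ⟨fun x => (f x).re, Complex.continuous_re.comp hf⟩ n =
      (fourierCoeff f n + (starRingEnd ℂ) (fourierCoeff f (-n))) / 2 := by
  have h := congrFun (fourierCoeff.add (integrable_of_continuous_circle hf)
    (integrable_of_continuous_circle (Complex.continuous_conj.comp hf))) n
  have h2 := fourierCoeff.const_mul (T := 1) (f + (fun z => (starRingEnd ℂ) z) ∘ f) (1 / 2) n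
  simp only [Pi.add_apply] at h h2
  have h3 := fourierCoeff_conj f n
  rw [circleCoeff]
  have : (fun x : UnitAddCircle => (((f x).re : ℝ) : ℂ)) =
      fun x => 1 / 2 * (f x + (starRingEnd ℂ) (f x)) := by
    funext x
    rw [Complex.add_conj]
    push_cast
    ring
  simp only [ContinuousMap.coe_mk]
  rw [this, ← h3]
  simp only [Function.comp_def] at h h2
  rw [h2]
  have h4 : fourierCoeff (f + fun x => (starRingEnd ℂ) (f x)) n = _ := h
  rw [h4]
  ring

theorem circleCoeff_neg_eq_conj (u : C(UnitAddCircle, ℝ)) (n : ℤ) :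
    circleCoeff u (-n) = (starRingEnd ℂ) (circleCoeff u n) := by
  have h := fourierCoeff_conj (fun x => ((u x : ℝ) : ℂ)) (-n)
  simp only [Complex.conj_ofReal, neg_neg] at h
  exact h

/-! ### Absolute summability of the coefficients of Sobolev functions -/

/-- Write the weight to the power a as the powers a - σ and σ, and use xy ≤ x² + y². The squares of
the first factor are summable because 2(a - σ) < -1. -/
theorem summable_rpow_mul_of_summable_sq {σ a : ℝ} (h0 : 0 ≤ σ) (h : a + 1 / 2 < σ) {b : ℤ → ℂ}
    (hb : Summable fun k : ℤ => (1 + (k : ℝ) ^ 2) ^ σ * ‖b k‖ ^ 2) :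
    Summable fun k => freqWeight k ^ a * ‖b k‖ := by
  have h1 := summable_freqWeight_rpow (p := 2 * (a - σ)) (by linarith)
  have h2 := hb.mul_left (2 ^ σ)
  refine Summable.of_nonneg_of_le (fun k => by have := freqWeight_pos k; positivity)
    (fun k => ?_) (h1.add h2)
  have hw := freqWeight_pos k
  have h3 : freqWeight k ^ a * ‖b k‖ =
      freqWeight k ^ (a - σ) * (freqWeight k ^ σ * ‖b k‖) := by
    rw [← mul_assoc, ← Real.rpow_add hw]; congr 2; ring
  have h4 : freqWeight k ^ (2 * (a - σ)) = (freqWeight k ^ (a - σ)) ^ 2 := by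
    rw [← Real.rpow_natCast, ← Real.rpow_mul hw.le]; congr 1; push_cast; ring
  have h5 := mul_le_mul_of_nonneg_right (freqWeight_rpow_sq_le h0 k) (sq_nonneg ‖b k‖)
  rw [h3, h4]
  have e : (freqWeight k ^ σ) ^ 2 * ‖b k‖ ^ 2 = (freqWeight k ^ σ * ‖b k‖) ^ 2 := by ring
  rw [e] at h5
  nlinarith [sq_nonneg (freqWeight k ^ (a - σ) - freqWeight k ^ σ * ‖b k‖),
    sq_nonneg (freqWeight k ^ (a - σ)), sq_nonneg (freqWeight k ^ σ * ‖b k‖)]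

theorem summable_of_summable_sq {σ : ℝ} (h : 1 / 2 < σ) {b : ℤ → ℂ}
    (hb : Summable fun k : ℤ => (1 + (k : ℝ) ^ 2) ^ σ * ‖b k‖ ^ 2) :
    Summable fun k => ‖b k‖ := by
  simpa using summable_rpow_mul_of_summable_sq (a := 0) (by linarith) (by linarith) hb

namespace SobolevCircle

variable {σ : ℝ}

theorem summable_sq (u : SobolevCircle σ) :
    Summable fun k : ℤ => (1 + (k : ℝ) ^ 2) ^ σ * ‖circleCoeff u.toCont k‖ ^ 2 := u.2

theorem summable_coeff (hσ : 1 / 2 < σ) (u : SobolevCircle σ) :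
    Summable fun k => ‖circleCoeff u.toCont k‖ := summable_of_summable_sq hσ u.summable_sq

theorem hasSum_coeff (hσ : 1 / 2 < σ) (u : SobolevCircle σ) (x : UnitAddCircle) :
    HasSum (fun k => circleCoeff u.toCont k * fourier k x) ((u x : ℝ) : ℂ) :=
  hasSum_fourierCoeff (Complex.continuous_ofReal.comp u.toCont.continuous) (u.summable_coeff hσ) x

theorem ext_apply {u v : SobolevCircle σ} (h : ∀ x, u x = v x) : u = v :=
  Subtype.ext (ContinuousMap.ext h)

theorem norm_sq_eq (u : SobolevCircle σ) :
    ‖u‖ ^ 2 = ∑' k : ℤ, (1 + (k : ℝ) ^ 2) ^ σ * ‖circleCoeff u.toCont k‖ ^ 2 := by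
  rw [norm_eq, Real.sq_sqrt (tsum_nonneg fun k => by positivity)]

@[simp] theorem toCont_add (u v : SobolevCircle σ) : (u + v).toCont = u.toCont + v.toCont := rfl
@[simp] theorem toCont_smul (c : ℝ) (u : SobolevCircle σ) : (c • u).toCont = c • u.toCont := rfl
@[simp] theorem toCont_zero : (0 : SobolevCircle σ).toCont = 0 := rfl

/-- A continuous function with finite `H^σ` norm, as an element of `H^σ`. -/
def mk (u : C(UnitAddCircle, ℝ))
    (hu : Summable fun k : ℤ => (1 + (k : ℝ) ^ 2) ^ σ * ‖circleCoeff u k‖ ^ 2) :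
    SobolevCircle σ := ⟨u, hu⟩

theorem re_coeff_sq_le (b : ℤ → ℂ) (k : ℤ) :
    ‖(b k + (starRingEnd ℂ) (b (-k))) / 2‖ ^ 2 ≤ (‖b k‖ ^ 2 + ‖b (-k)‖ ^ 2) / 2 := by
  have h1 : ‖(b k + (starRingEnd ℂ) (b (-k))) / 2‖ ≤ (‖b k‖ + ‖b (-k)‖) / 2 := by
    rw [norm_div]
    have := norm_add_le (b k) ((starRingEnd ℂ) (b (-k)))
    rw [RCLike.norm_conj] at this
    simpa using div_le_div_of_nonneg_right this (by norm_num : (0:ℝ) ≤ 2)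
  have h2 := norm_nonneg ((b k + (starRingEnd ℂ) (b (-k))) / 2)
  nlinarith [sq_nonneg (‖b k‖ - ‖b (-k)‖)]

/-- Taking the real part averages b(k) with the conjugate of b(-k). The weight is even, so convexity
of the square shows that the norm does not increase. -/
theorem re_coeff_summable {b : ℤ → ℂ}
    (hb : Summable fun k : ℤ => (1 + (k : ℝ) ^ 2) ^ σ * ‖b k‖ ^ 2) :
    Summable (fun k : ℤ => (1 + (k : ℝ) ^ 2) ^ σ *
      ‖(b k + (starRingEnd ℂ) (b (-k))) / 2‖ ^ 2) ∧
    ∑' k : ℤ, (1 + (k : ℝ) ^ 2) ^ σ * ‖(b k + (starRingEnd ℂ) (b (-k))) / 2‖ ^ 2 ≤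
      ∑' k : ℤ, (1 + (k : ℝ) ^ 2) ^ σ * ‖b k‖ ^ 2 := by
  have hb' : HasSum (fun k : ℤ => (1 + (k : ℝ) ^ 2) ^ σ * ‖b (-k)‖ ^ 2)
      (∑' k : ℤ, (1 + (k : ℝ) ^ 2) ^ σ * ‖b k‖ ^ 2) := by
    have := (Equiv.neg ℤ).hasSum_iff.2 hb.hasSum
    simpa [Function.comp_def] using this
  have h := ((hb.hasSum.add hb').div_const 2)
  rw [add_self_div_two] at h
  have hle : ∀ k : ℤ, (1 + (k : ℝ) ^ 2) ^ σ * ‖(b k + (starRingEnd ℂ) (b (-k))) / 2‖ ^ 2 ≤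
      ((1 + (k : ℝ) ^ 2) ^ σ * ‖b k‖ ^ 2 + (1 + (k : ℝ) ^ 2) ^ σ * ‖b (-k)‖ ^ 2) / 2 := by
    intro k
    have := mul_le_mul_of_nonneg_left (re_coeff_sq_le b k)
      (by positivity : (0:ℝ) ≤ (1 + (k : ℝ) ^ 2) ^ σ)
    linarith
  have hs := Summable.of_nonneg_of_le (fun k => by positivity) hle h.summable
  exact ⟨hs, hasSum_le hle hs.hasSum h⟩

theorem circleCoeff_re_trigSeries {b : ℤ → ℂ} (hb : Summable fun k => ‖b k‖) (k : ℤ) :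
    circleCoeff ⟨fun x => (trigSeries b x).re,
      Complex.continuous_re.comp (continuous_trigSeries hb)⟩ k =
        (b k + (starRingEnd ℂ) (b (-k))) / 2 := by
  rw [circleCoeff_re (continuous_trigSeries hb), fourierCoeff_trigSeries hb,
    fourierCoeff_trigSeries hb]

/-- The real part of the Fourier series with coefficients `b`, as an element of `H^σ`. -/
noncomputable def ofCoeff (hσ : 1 / 2 < σ) (b : ℤ → ℂ)
    (hb : Summable fun k : ℤ => (1 + (k : ℝ) ^ 2) ^ σ * ‖b k‖ ^ 2) : SobolevCircle σ :=
  mk ⟨fun x => (trigSeries b x).re,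
      Complex.continuous_re.comp (continuous_trigSeries (summable_of_summable_sq hσ hb))⟩ (by
    simp_rw [circleCoeff_re_trigSeries (summable_of_summable_sq hσ hb)]
    exact (re_coeff_summable hb).1)

theorem ofCoeff_apply (hσ : 1 / 2 < σ) (b : ℤ → ℂ)
    (hb : Summable fun k : ℤ => (1 + (k : ℝ) ^ 2) ^ σ * ‖b k‖ ^ 2) (x : UnitAddCircle) :
    ofCoeff hσ b hb x = (trigSeries b x).re := rfl

theorem norm_ofCoeff_sq_le (hσ : 1 / 2 < σ) (b : ℤ → ℂ)
    (hb : Summable fun k : ℤ => (1 + (k : ℝ) ^ 2) ^ σ * ‖b k‖ ^ 2) :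
    ‖ofCoeff hσ b hb‖ ^ 2 ≤ ∑' k : ℤ, (1 + (k : ℝ) ^ 2) ^ σ * ‖b k‖ ^ 2 := by
  rw [norm_sq_eq]
  refine le_trans (le_of_eq ?_) (re_coeff_summable hb).2
  congr 1
  funext k
  rw [← circleCoeff_re_trigSeries (summable_of_summable_sq hσ hb)]
  rfl

theorem weight_mul_unweight_sq (σ : ℝ) (k : ℤ) (z : ℂ) :
    (1 + (k : ℝ) ^ 2) ^ σ * ‖(((1 + (k : ℝ) ^ 2) ^ (-(σ / 2)) : ℝ) : ℂ) * z‖ ^ 2 = ‖z‖ ^ 2 := by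
  have h : (0 : ℝ) < 1 + (k : ℝ) ^ 2 := by positivity
  rw [norm_mul, mul_pow, Complex.norm_real, Real.norm_of_nonneg (by positivity),
    ← Real.rpow_natCast (_ ^ _), ← Real.rpow_mul h.le, ← mul_assoc, ← Real.rpow_add h]
  norm_num

theorem summable_unweighted (σ : ℝ) (a : lp (fun _ : ℤ => ℂ) 2) :
    Summable fun k : ℤ => (1 + (k : ℝ) ^ 2) ^ σ *
      ‖(((1 + (k : ℝ) ^ 2) ^ (-(σ / 2)) : ℝ) : ℂ) * a k‖ ^ 2 := by
  simp_rw [weight_mul_unweight_sq]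
  have := (memℓp_gen_iff (by norm_num)).1 (lp.memℓp a)
  simpa using this

theorem lp_two_norm_sq (a : lp (fun _ : ℤ => ℂ) 2) : ‖a‖ ^ 2 = ∑' k, ‖a k‖ ^ 2 := by
  have := lp.norm_rpow_eq_tsum (p := 2) (by norm_num) a
  simpa using this

/-- The map from weighted coefficients back to functions, a left inverse of `toLp2`. -/
noncomputable def ofLp2 (hσ : 1 / 2 < σ) : lp (fun _ : ℤ => ℂ) 2 →L[ℝ] SobolevCircle σ :=
  LinearMap.mkContinuous
    { toFun := fun a => ofCoeff hσ _ (summable_unweighted σ a)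
      map_add' := fun a b => ext_apply fun x => by
        have ha := summable_of_summable_sq hσ (summable_unweighted σ a)
        have hb := summable_of_summable_sq hσ (summable_unweighted σ b)
        rw [toCont_add, ContinuousMap.add_apply]
        simp only [ofCoeff_apply]
        rw [← Complex.add_re]
        congr 1
        unfold trigSeries
        rw [← (summable_mul_fourier ha x).tsum_add (summable_mul_fourier hb x)]
        congr 1
        funext k
        change _ * (a k + b k) * _ = _
        ring
      map_smul' := fun c a => ext_apply fun x => by
        have ha := summable_of_summable_sq hσ (summable_unweighted σ a)
        rw [toCont_smul, ContinuousMap.smul_apply]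
        simp only [ofCoeff_apply, RingHom.id_apply]
        rw [← Complex.smul_re]
        congr 1
        unfold trigSeries
        rw [← tsum_const_smul'']
        congr 1
        funext k
        change _ * ((c : ℂ) * a k) * _ = (c : ℂ) * (_ * a k * _)
        ring } 1 (fun a => by
    rw [one_mul]
    refine le_of_sq_le_sq ?_ (norm_nonneg _)
    rw [lp_two_norm_sq]
    refine (norm_ofCoeff_sq_le hσ _ (summable_unweighted σ a)).trans (le_of_eq ?_)
    simp_rw [weight_mul_unweight_sq])

theorem ofLp2_apply (hσ : 1 / 2 < σ) (a : lp (fun _ : ℤ => ℂ) 2) (x : UnitAddCircle) :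
    ofLp2 hσ a x =
      (trigSeries (fun k => (((1 + (k : ℝ) ^ 2) ^ (-(σ / 2)) : ℝ) : ℂ) * a k) x).re := rfl

theorem unweight_weightedCoeff (u : C(UnitAddCircle, ℝ)) (k : ℤ) :
    (((1 + (k : ℝ) ^ 2) ^ (-(σ / 2)) : ℝ) : ℂ) * weightedCoeff σ u k = circleCoeff u k := by
  have h : (0 : ℝ) < 1 + (k : ℝ) ^ 2 := by positivity
  rw [weightedCoeff, ← mul_assoc, ← Complex.ofReal_mul, ← Real.rpow_add h]
  simp

theorem ofLp2_toLp2 (hσ : 1 / 2 < σ) (u : SobolevCircle σ) : ofLp2 hσ (toLp2 σ u) = u := by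
  refine ext_apply fun x => ?_
  rw [ofLp2_apply]
  have h : ∀ k : ℤ, (((1 + (k : ℝ) ^ 2) ^ (-(σ / 2)) : ℝ) : ℂ) * (toLp2 σ u) k =
      circleCoeff u.toCont k := fun k => unweight_weightedCoeff _ _
  simp_rw [h]
  rw [trigSeries, (u.hasSum_coeff hσ x).tsum_eq, Complex.ofReal_re]

/-- A Cauchy sequence is sent isometrically into ℓ², and its limit there is brought back by the
continuous left inverse `ofLp2`. Completeness of the target is needed to sum the Taylor series of
operators. -/
theorem completeSpace (hσ : 1 / 2 < σ) : CompleteSpace (SobolevCircle σ) := by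
  have hiso : Isometry (toLp2 σ) := AddMonoidHomClass.isometry_of_norm _ fun u => rfl
  refine Metric.complete_of_cauchySeq_tendsto fun u hu => ?_
  obtain ⟨a, ha⟩ := cauchySeq_tendsto_of_complete (hiso.uniformContinuous.comp_cauchySeq hu)
  refine ⟨ofLp2 hσ a, ?_⟩
  have := ((ofLp2 hσ).continuous.tendsto a).comp ha
  exact this.congr fun n => ofLp2_toLp2 hσ (u n)

end SobolevCircle

/-! ### Sums over multi-indices -/

theorem ENNReal.tsum_pi_prod {ι : Type*} : ∀ (n : ℕ) (a : Fin n → ι → ℝ≥0∞),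
    ∑' κ : Fin n → ι, ∏ j, a j (κ j) = ∏ j, ∑' k, a j k
  | 0, a => by simp
  | n + 1, a => by
    rw [← (Fin.consEquiv fun _ => ι).tsum_eq, ENNReal.tsum_prod', Fin.prod_univ_succ,
      ← ENNReal.tsum_pi_prod n fun j => a j.succ]
    simp [Fin.consEquiv, Fin.prod_univ_succ, ENNReal.tsum_mul_left, ENNReal.tsum_mul_right]

theorem summable_norm_and_tsum_pi_prod {ι : Type*} : ∀ (n : ℕ) (f : Fin n → ι → ℂ),
    (∀ j, Summable fun k => ‖f j k‖) →
    (Summable fun κ : Fin n → ι => ‖∏ j, f j (κ j)‖) ∧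
      ∑' κ : Fin n → ι, ∏ j, f j (κ j) = ∏ j, ∑' k, f j k
  | 0, f, _ => ⟨Summable.of_finite, by simp⟩
  | n + 1, f, hf => by
    obtain ⟨h1, h2⟩ := summable_norm_and_tsum_pi_prod n (fun j => f j.succ) fun j => hf j.succ
    have h3 := (hf 0).mul_norm h1
    constructor
    · rw [← (Fin.consEquiv fun _ => ι).summable_iff]
      refine h3.congr fun p => ?_
      simp [Fin.consEquiv, Fin.prod_univ_succ]
    · rw [← (Fin.consEquiv fun _ => ι).tsum_eq, Fin.prod_univ_succ, ← h2,
        tsum_mul_tsum_of_summable_norm (hf 0) h1]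
      refine tsum_congr fun p => ?_
      simp [Fin.consEquiv, Fin.prod_univ_succ]

theorem hasSum_pi_prod {ι : Type*} {n : ℕ} {f : Fin n → ι → ℂ} {g : Fin n → ℂ}
    (hf : ∀ j, Summable fun k => ‖f j k‖) (hg : ∀ j, HasSum (f j) (g j)) :
    HasSum (fun κ : Fin n → ι => ∏ j, f j (κ j)) (∏ j, g j) := by
  obtain ⟨h1, h2⟩ := summable_norm_and_tsum_pi_prod n f hf
  have h3 := h1.of_norm.hasSum
  rw [h2] at h3
  simpa only [(hg _).tsum_eq] using h3

/-- Cauchy–Schwarz for √A · (√A b), the sums being integrals for the counting measure. -/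
theorem ENNReal.tsum_mul_sq_le {ι : Type*} (A b : ι → ℝ≥0∞) :
    (∑' i, A i * b i) ^ 2 ≤ (∑' i, A i) * ∑' i, A i * b i ^ 2 := by
  let _ : MeasurableSpace ι := ⊤
  have h := ENNReal.lintegral_mul_le_Lp_mul_Lq (MeasureTheory.Measure.count : MeasureTheory.Measure ι)
    (p := 2) (q := 2) (by constructor <;> norm_num)
    (f := fun i => A i ^ (1 / 2 : ℝ)) (g := fun i => A i ^ (1 / 2 : ℝ) * b i)
    measurable_from_top.aemeasurable measurable_from_top.aemeasurable
  rw [MeasureTheory.lintegral_count, MeasureTheory.lintegral_count,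
    MeasureTheory.lintegral_count] at h
  simp only [Pi.mul_apply] at h
  have e1 : ∀ x : ℝ≥0∞, x ^ (1 / 2 : ℝ) * x ^ (1 / 2 : ℝ) = x := fun x => by
    rw [← ENNReal.rpow_add_of_nonneg _ _ (by norm_num) (by norm_num)]; norm_num
  have e2 : ∀ x : ℝ≥0∞, (x ^ (1 / 2 : ℝ)) ^ (2 : ℝ) = x := fun x => by
    rw [← ENNReal.rpow_mul]; norm_num
  simp_rw [ENNReal.mul_rpow_of_nonneg _ _ (by norm_num : (0:ℝ) ≤ 2), e2, ← mul_assoc, e1] at h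
  calc (∑' i, A i * b i) ^ 2 ≤ _ ^ 2 := pow_le_pow_left' h 2
    _ = _ := by
      rw [mul_pow, ← ENNReal.rpow_natCast, ← ENNReal.rpow_natCast, ← ENNReal.rpow_mul,
        ← ENNReal.rpow_mul]
      norm_num

/-- Young's inequality `ℓ² * ℓ¹ * ⋯ * ℓ¹ ⊂ ℓ²` for sums over multi-indices. -/
theorem ENNReal.tsum_multiindex_sq_le {n : ℕ} (i : Fin (n + 1)) (b : ℤ → ℝ≥0∞)
    (a : Fin n → ℤ → ℝ≥0∞) :
    ∑' l : ℤ, (∑' κ : Fin (n + 1) → ℤ,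
      if ∑ j, κ j = l then b (κ i) * ∏ j, a j (κ (i.succAbove j)) else 0) ^ 2 ≤
      (∏ j, ∑' k, a j k) ^ 2 * ∑' k, b k ^ 2 := by
  have h1 : ∀ l : ℤ, (∑' κ : Fin (n + 1) → ℤ,
      if ∑ j, κ j = l then b (κ i) * ∏ j, a j (κ (i.succAbove j)) else 0) =
      ∑' κ : Fin n → ℤ, (∏ j, a j (κ j)) * b (l - ∑ j, κ j) := by
    intro l
    -- The constraint on the total frequency determines the entry `i` from the others, which leaves
    -- a free sum over the remaining `n` indices.
    rw [← (Fin.insertNthEquiv (fun _ => ℤ) i).tsum_eq, ENNReal.tsum_prod',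
      ENNReal.tsum_comm]
    refine tsum_congr fun κ => ?_
    simp only [Fin.insertNthEquiv_apply, Fin.sum_univ_succAbove _ i, Fin.insertNth_apply_same,
      Fin.insertNth_apply_succAbove, ← eq_sub_iff_add_eq]
    rw [tsum_ite_eq, mul_comm]
  simp_rw [h1]
  calc _ ≤ ∑' l : ℤ, (∑' κ : Fin n → ℤ, ∏ j, a j (κ j)) *
        ∑' κ : Fin n → ℤ, (∏ j, a j (κ j)) * b (l - ∑ j, κ j) ^ 2 :=
        ENNReal.tsum_le_tsum fun l => ENNReal.tsum_mul_sq_le _ _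
    _ = _ := by
      rw [ENNReal.tsum_mul_left, ENNReal.tsum_comm]
      simp_rw [ENNReal.tsum_mul_left]
      have h2 : ∀ c : ℤ, ∑' l : ℤ, b (l - c) ^ 2 = ∑' k, b k ^ 2 := fun c =>
        (Equiv.subRight c).tsum_eq fun k => b k ^ 2
      simp_rw [h2, ENNReal.tsum_mul_right, ENNReal.tsum_pi_prod]
      ring

theorem ENNReal.sum_sq_le {n : ℕ} (y : Fin n → ℝ≥0∞) :
    (∑ i, y i) ^ 2 ≤ n * ∑ i, y i ^ 2 := by
  have := ENNReal.tsum_mul_sq_le (fun _ : Fin n => 1) y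
  simpa [tsum_fintype] using this

/-- Here `α i` bounds a weak ℓ¹ norm and `L * α i` a strong ℓ² norm of the same function. In each
summand only one factor carries the strong norm, so `L` occurs once whatever the number of factors.
The weak norm alone then governs the convergence in `n`. -/
theorem ENNReal.tsum_multiindex_sum_sq_le {n : ℕ} (a b : Fin (n + 1) → ℤ → ℝ≥0∞)
    (α : Fin (n + 1) → ℝ≥0∞) (L : ℝ≥0∞) (ha : ∀ i, ∑' k, a i k ≤ α i)
    (hb : ∀ i, ∑' k, b i k ^ 2 ≤ (L * α i) ^ 2) :
    ∑' l : ℤ, (∑' κ : Fin (n + 1) → ℤ, if ∑ j, κ j = l then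
      ∑ i, b i (κ i) * ∏ j, a (i.succAbove j) (κ (i.succAbove j)) else 0) ^ 2 ≤
      ((n + 1 : ℕ) * (L * ∏ i, α i)) ^ 2 := by
  have h1 : ∀ l : ℤ, (∑' κ : Fin (n + 1) → ℤ, if ∑ j, κ j = l then
      ∑ i, b i (κ i) * ∏ j, a (i.succAbove j) (κ (i.succAbove j)) else 0) =
      ∑ i, ∑' κ : Fin (n + 1) → ℤ, if ∑ j, κ j = l then
        b i (κ i) * ∏ j, a (i.succAbove j) (κ (i.succAbove j)) else 0 := by
    intro l
    rw [← Summable.tsum_finsetSum fun _ _ => ENNReal.summable]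
    refine tsum_congr fun κ => ?_
    split_ifs <;> simp
  simp_rw [h1]
  calc _ ≤ ∑' l : ℤ, (n + 1 : ℕ) * ∑ i, (∑' κ : Fin (n + 1) → ℤ, if ∑ j, κ j = l then
        b i (κ i) * ∏ j, a (i.succAbove j) (κ (i.succAbove j)) else 0) ^ 2 :=
        ENNReal.tsum_le_tsum fun l => ENNReal.sum_sq_le _
    _ = (n + 1 : ℕ) * ∑ i, ∑' l : ℤ, (∑' κ : Fin (n + 1) → ℤ, if ∑ j, κ j = l then
        b i (κ i) * ∏ j, a (i.succAbove j) (κ (i.succAbove j)) else 0) ^ 2 := by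
      rw [ENNReal.tsum_mul_left, Summable.tsum_finsetSum fun _ _ => ENNReal.summable]
    _ ≤ (n + 1 : ℕ) * ∑ i : Fin (n + 1), (L * ∏ i, α i) ^ 2 := by
      gcongr with i
      refine (ENNReal.tsum_multiindex_sq_le i (b i) fun j => a (i.succAbove j)).trans ?_
      calc _ ≤ (∏ j, α (i.succAbove j)) ^ 2 * (L * α i) ^ 2 := by
            gcongr
            · exact ha _
            · exact hb i
        _ = _ := by rw [Fin.prod_univ_succAbove _ i]; ring
    _ = _ := by simp; ring

/-- The ℓ¹ counterpart, again with a single factor `L`; it provides the absolute convergence of the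
expansion at each point. -/
theorem ENNReal.tsum_multiindex_sum_le {n : ℕ} (a b : Fin (n + 1) → ℤ → ℝ≥0∞)
    (α : Fin (n + 1) → ℝ≥0∞) (L : ℝ≥0∞) (ha : ∀ i, ∑' k, a i k ≤ α i)
    (hb : ∀ i, ∑' k, b i k ≤ L * α i) :
    ∑' κ : Fin (n + 1) → ℤ,
      ∑ i, b i (κ i) * ∏ j, a (i.succAbove j) (κ (i.succAbove j)) ≤
      (n + 1 : ℕ) * (L * ∏ i, α i) := by
  rw [Summable.tsum_finsetSum fun _ _ => ENNReal.summable]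
  calc _ ≤ ∑ i : Fin (n + 1), (L * ∏ i, α i) := by
        refine Finset.sum_le_sum fun i _ => ?_
        rw [← (Fin.insertNthEquiv (fun _ => ℤ) i).tsum_eq, ENNReal.tsum_prod']
        simp only [Fin.insertNthEquiv_apply, Fin.insertNth_apply_same,
          Fin.insertNth_apply_succAbove, ENNReal.tsum_mul_left, ENNReal.tsum_mul_right]
        rw [ENNReal.tsum_pi_prod n fun j => a (i.succAbove j), Fin.prod_univ_succAbove α i,
          ← mul_assoc]
        gcongr
        · exact hb i
        · exact ha _
    _ = _ := by simp

/-! ### Iterated finite differences -/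

/-- The iterated difference of `Q` at `a` with steps `k 0, …, k (n - 1)`, with the sign for which one
step is `Q a - Q (a + k)`. -/
def finDiff {G : Type*} [Add G] (Q : G → ℂ) : (n : ℕ) → (Fin n → G) → G → ℂ
  | 0, _, a => Q a
  | n + 1, k, a => finDiff Q n (Fin.tail k) a - finDiff Q n (Fin.tail k) (a + k 0)

theorem finDiff_intCast (Q : ℝ → ℂ) : ∀ (n : ℕ) (k : Fin n → ℤ) (a : ℤ),
    finDiff (fun m : ℤ => Q m) n k a = finDiff Q n (fun j => (k j : ℝ)) a
  | 0, k, a => rfl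
  | n + 1, k, a => by
    simp only [finDiff, finDiff_intCast Q n]
    push_cast
    rfl

theorem hasDerivAt_finDiff {F F' : ℝ → ℂ} (hF : ∀ x, HasDerivAt F (F' x) x) :
    ∀ (n : ℕ) (k : Fin n → ℝ) (a : ℝ), HasDerivAt (finDiff F n k) (finDiff F' n k a) a
  | 0, k, a => hF a
  | n + 1, k, a => by
    have h1 := hasDerivAt_finDiff hF n (Fin.tail k) a
    have h2 := (hasDerivAt_finDiff hF n (Fin.tail k) (a + k 0)).comp_add_const a (k 0)
    exact h1.sub h2

theorem norm_sub_add_le_of_hasDerivAt {G G' : ℝ → ℂ} (hG : ∀ x, HasDerivAt G (G' x) x)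
    {a k C : ℝ} (hC : ∀ y, |y| ≤ |a| + |k| → ‖G' y‖ ≤ C) : ‖G a - G (a + k)‖ ≤ |k| * C := by
  have h := (convex_segment a (a + k)).norm_image_sub_le_of_norm_hasDerivWithin_le
    (f := G) (f' := G') (C := C)
    (fun x _ => (hG x).hasDerivWithinAt) (fun x hx => hC x ?_)
    (left_mem_segment ℝ a (a + k)) (right_mem_segment ℝ a (a + k))
  · rw [norm_sub_rev]
    simpa [mul_comm] using h
  · rw [segment_eq_image'] at hx
    obtain ⟨t, ⟨ht0, ht1⟩, rfl⟩ := hx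
    simp only [add_sub_cancel_left, smul_eq_mul]
    refine (abs_add_le _ _).trans ?_
    rw [abs_mul, abs_of_nonneg ht0]
    nlinarith [abs_nonneg k]

/-- By the mean value inequality each step trades a factor |k j| for one derivative, along a
sequence `F` in which each function is the derivative of the previous one. All points met on the way
stay in the interval of radius `ρ`. -/
theorem norm_finDiff_le {B ρ : ℝ} : ∀ (n : ℕ) (F : ℕ → ℝ → ℂ)
    (_ : ∀ j x, HasDerivAt (F j) (F (j + 1) x) x) (k : Fin n → ℝ) (a : ℝ)
    (_ : ∀ y, |y| ≤ ρ → ‖F n y‖ ≤ B) (_ : |a| + ∑ j, |k j| ≤ ρ),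
    ‖finDiff (F 0) n k a‖ ≤ (∏ j, |k j|) * B
  | 0, F, hF, k, a, hB, hρ => by
    simpa [finDiff] using hB a (by simpa using hρ)
  | n + 1, F, hF, k, a, hB, hρ => by
    rw [Fin.prod_univ_succ, mul_assoc]
    rw [Fin.sum_univ_succ] at hρ
    refine norm_sub_add_le_of_hasDerivAt (hasDerivAt_finDiff (hF 0) n (Fin.tail k))
      fun y hy => ?_
    refine norm_finDiff_le n (fun j => F (j + 1)) (fun j => hF (j + 1)) (Fin.tail k) y hB ?_
    simp only [Fin.tail]
    linarith

/-- Like `norm_finDiff_le`, with the step of index `i` estimated trivially, by twice a supremum. -/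
theorem norm_finDiff_le_drop {B ρ : ℝ} : ∀ (n : ℕ) (F : ℕ → ℝ → ℂ)
    (_ : ∀ j x, HasDerivAt (F j) (F (j + 1) x) x) (k : Fin (n + 1) → ℝ) (a : ℝ)
    (_ : ∀ y, |y| ≤ ρ → ‖F n y‖ ≤ B) (_ : |a| + ∑ j, |k j| ≤ ρ) (i : Fin (n + 1)),
    ‖finDiff (F 0) (n + 1) k a‖ ≤ (∏ j, if j = i then 1 else |k j|) * (2 * B) := by
  intro n
  induction n with
  | zero =>
    intro F hF k a hB hρ i
    have hi : i = 0 := Fin.fin_one_eq_zero i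
    subst hi
    rw [Fin.prod_univ_succ, if_pos rfl, Fin.prod_univ_zero, one_mul, one_mul]
    simp only [finDiff]
    have h1 := hB a (by simp at hρ; linarith [abs_nonneg (k 0)])
    have h2 := hB (a + k 0) (by simp at hρ; linarith [abs_add_le a (k 0)])
    linarith [norm_sub_le (F 0 a) (F 0 (a + k 0))]
  | succ n ih =>
    intro F hF k a hB hρ i
    rw [Fin.sum_univ_succ] at hρ
    refine Fin.cases ?_ (fun i => ?_) i
    -- The dropped step is the outermost one: both of its terms are (n+1)-fold differences, and the
    -- full estimate applies to each.
    · rw [Fin.prod_univ_succ]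
      simp only [if_true, one_mul, Fin.succ_ne_zero, if_false]
      have h1 := norm_finDiff_le (ρ := ρ) (n + 1) F hF (Fin.tail k) a hB
        (by simp only [Fin.tail]; linarith [abs_nonneg (k 0)])
      have h2 := norm_finDiff_le (ρ := ρ) (n + 1) F hF (Fin.tail k) (a + k 0) hB
        (by simp only [Fin.tail]; linarith [abs_add_le a (k 0)])
      simp only [Fin.tail] at h1 h2
      refine (norm_sub_le _ _).trans ((add_le_add h1 h2).trans (le_of_eq ?_))
      ring
    · rw [Fin.prod_univ_succ, if_neg (Fin.succ_ne_zero i).symm, mul_assoc]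
      simp only [Fin.succ_inj]
      refine norm_sub_add_le_of_hasDerivAt (hasDerivAt_finDiff (hF 0) (n + 1) (Fin.tail k))
        fun y hy => ?_
      refine ih (fun j => F (j + 1)) (fun j => hF (j + 1)) (Fin.tail k) y hB ?_ i
      simp only [Fin.tail]
      linarith

/-! ### Holomorphic symbols -/

/-- `p` is holomorphic where `Re (1 + z²) > 0`, and it is bounded by `B (1 + |ξ|)^r` on the disc with
centre `ξ ∈ ℝ` and radius `(1 + |ξ|) / 4`. -/
structure SymbolBound (p : ℂ → ℂ) (B r : ℝ) : Prop where
  diff : DifferentiableOn ℂ p {z | 0 < (1 + z ^ 2).re}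
  bound : ∀ (ξ : ℝ) (z : ℂ), ‖z - ξ‖ ≤ (1 + |ξ|) / 4 → ‖p z‖ ≤ B * (1 + |ξ|) ^ r

/-- On these discs Re z² is at least about ξ²/2. This keeps 1 + z² in the right half plane, where
its powers are holomorphic, and makes exp(-εz²) decay like a Gaussian in ξ. -/
theorem re_sq_ge {ξ : ℝ} {z : ℂ} (hz : ‖z - ξ‖ ≤ (1 + |ξ|) / 4) :
    (ξ ^ 2 - |ξ|) / 2 - 1 / 2 ≤ (z ^ 2).re := by
  have h1 : |z.re - ξ| ≤ (1 + |ξ|) / 4 := by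
    simpa using (Complex.abs_re_le_norm (z - ξ)).trans hz
  have h2 : |z.im| ≤ (1 + |ξ|) / 4 := by
    simpa using (Complex.abs_im_le_norm (z - ξ)).trans hz
  have h3 : (z ^ 2).re = z.re ^ 2 - z.im ^ 2 := by rw [sq, Complex.mul_re]; ring
  have h4 : z.im ^ 2 ≤ ((1 + |ξ|) / 4) ^ 2 := sq_le_sq' (by linarith [abs_le.1 h2]) (abs_le.1 h2).2
  have h5 : |ξ| - (1 + |ξ|) / 4 ≤ |z.re| := by
    have := abs_sub_abs_le_abs_sub ξ z.re
    rw [abs_sub_comm] at this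
    linarith
  have h6 := sq_abs z.re
  have h7 := sq_abs ξ
  have h8 := abs_nonneg ξ
  rw [h3]
  by_cases h : 1 ≤ |ξ|
  · have : (|ξ| - (1 + |ξ|) / 4) ^ 2 ≤ |z.re| ^ 2 := by
      apply pow_le_pow_left₀ _ h5
      linarith
    nlinarith
  · push Not at h
    nlinarith [sq_nonneg z.re]

theorem mem_domain_of_near {ξ : ℝ} {z : ℂ} (hz : ‖z - ξ‖ ≤ (1 + |ξ|) / 4) :
    0 < (1 + z ^ 2).re := by
  have h := re_sq_ge hz
  rw [Complex.add_re, Complex.one_re]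
  nlinarith [sq_abs ξ, sq_nonneg (|ξ| - 1 / 2)]

theorem isOpen_symbolDomain : IsOpen {z : ℂ | 0 < (1 + z ^ 2).re} :=
  isOpen_lt continuous_const (by fun_prop)

theorem norm_le_of_near {ξ : ℝ} {z : ℂ} (hz : ‖z - ξ‖ ≤ (1 + |ξ|) / 4) :
    ‖z‖ ≤ 2 * (1 + |ξ|) := by
  have : ‖z‖ ≤ ‖z - ξ‖ + ‖(ξ : ℂ)‖ := by simpa using norm_add_le (z - ξ) (ξ : ℂ)
  rw [Complex.norm_real, Real.norm_eq_abs] at this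
  linarith [abs_nonneg ξ]

namespace SymbolBound

variable {p : ℂ → ℂ} {B r : ℝ}

theorem nonneg (hp : SymbolBound p B r) : 0 ≤ B := by
  have := (norm_nonneg _).trans (hp.bound 0 0 (by simp))
  simpa using this

theorem norm_intCast_le (hp : SymbolBound p B r) (k : ℤ) :
    ‖p k‖ ≤ B * freqWeight k ^ r := by
  have := hp.bound k k (by
    simp only [Complex.ofReal_intCast, sub_self, norm_zero]; positivity)
  simpa [freqWeight] using this

theorem differentiableOn_mul (hp : SymbolBound p B r) (n : ℕ) :
    DifferentiableOn ℂ (fun z => z ^ n * p z) {z | 0 < (1 + z ^ 2).re} :=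
  DifferentiableOn.mul (by fun_prop) hp.diff

/-- Cauchy's estimate on the circle of radius (1 + |ξ|)/4. Since the radius is proportional to 1 +
|ξ|, each derivative lowers the order by one, and the constants grow only like j! 4^j. -/
theorem norm_iteratedDeriv_le (hp : SymbolBound p B r) (n j : ℕ) (ξ : ℝ) :
    ‖iteratedDeriv j (fun z => z ^ n * p z) ξ‖ ≤
      j.factorial * ((2 * (1 + |ξ|)) ^ n * (B * (1 + |ξ|) ^ r)) / ((1 + |ξ|) / 4) ^ j := by
  have h0 := abs_nonneg ξ
  refine Complex.norm_iteratedDeriv_le_of_forall_mem_sphere_norm_le j (by positivity) ?_ ?_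
  · refine DifferentiableOn.diffContOnCl ((hp.differentiableOn_mul n).mono fun z hz => ?_)
    rw [closure_ball _ (by positivity), mem_closedBall_iff_norm] at hz
    exact mem_domain_of_near hz
  · intro z hz
    have hz' : ‖z - ξ‖ ≤ (1 + |ξ|) / 4 := (mem_sphere_iff_norm.1 hz).le
    rw [norm_mul, norm_pow]
    gcongr
    · exact norm_le_of_near hz'
    · exact hp.bound ξ z hz'

theorem hasDerivAt_iteratedDeriv (hp : SymbolBound p B r) (n j : ℕ) (ξ : ℝ) :
    HasDerivAt (fun x : ℝ => iteratedDeriv j (fun z => z ^ n * p z) (x : ℂ))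
      (iteratedDeriv (j + 1) (fun z => z ^ n * p z) (ξ : ℂ)) ξ := by
  have hmem : 0 < (1 + (ξ : ℂ) ^ 2).re :=
    mem_domain_of_near (ξ := ξ) (by simp only [sub_self, norm_zero]; positivity)
  have h1 : AnalyticAt ℂ (fun z => z ^ n * p z) (ξ : ℂ) :=
    (hp.differentiableOn_mul n).analyticAt (isOpen_symbolDomain.mem_nhds hmem)
  have h2 := (h1.iterated_deriv j).differentiableAt.hasDerivAt
  rw [← iteratedDeriv_eq_iterate, ← iteratedDeriv_succ] at h2
  exact h2.comp_ofReal

end SymbolBound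

/-! ### Symbols of the Taylor coefficients of a conjugated multiplier -/

/-- The symbol of the `n`-th Taylor coefficient at the identity of `φ ↦ R_φ op(p) R_φ⁻¹`; the last
entry of `κ` is the frequency of the function to which the operator is applied. -/
noncomputable def conjSymbol (p : ℂ → ℂ) : (n : ℕ) → (Fin (n + 1) → ℤ) → ℂ
  | 0, κ => p (κ 0)
  | n + 1, κ => (2 * Real.pi * Complex.I) ^ (n + 1) / (n + 1).factorial * κ (Fin.last (n + 1)) *
      finDiff (fun ξ : ℤ => (ξ : ℂ) ^ n * p ξ) (n + 1) (Fin.init κ) (κ (Fin.last (n + 1)))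

/-- Every point y reached by the finite differences satisfies |y| ≤ ∑ |κ j|, hence 1 + |y| is at
most n + 1 times the largest weight. The summand 1 on the left is there for this use. -/
theorem freqWeight_sum_le {n : ℕ} (κ : Fin (n + 1) → ℤ) (i : Fin (n + 1))
    (hi : ∀ j, freqWeight (κ j) ≤ freqWeight (κ i)) :
    1 + ∑ j, |(κ j : ℝ)| ≤ (n + 1 : ℕ) * freqWeight (κ i) := by
  have h : ∑ j, freqWeight (κ j) ≤ (n + 1 : ℕ) * freqWeight (κ i) := by
    simpa using Finset.sum_le_card_nsmul Finset.univ (fun j => freqWeight (κ j)) _ fun j _ => hi j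
  simp only [freqWeight, Finset.sum_add_distrib] at h ⊢
  simp only [Finset.sum_const, Finset.card_univ, Fintype.card_fin, nsmul_eq_mul, mul_one] at h
  push_cast at h ⊢
  linarith [(Nat.cast_nonneg n : (0:ℝ) ≤ n)]

theorem freqWeight_intSum_le {n : ℕ} (κ : Fin (n + 1) → ℤ) (i : Fin (n + 1))
    (hi : ∀ j, freqWeight (κ j) ≤ freqWeight (κ i)) :
    freqWeight (∑ j, κ j) ≤ (n + 1 : ℕ) * freqWeight (κ i) := by
  refine le_trans ?_ (freqWeight_sum_le κ i hi)
  unfold freqWeight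
  push_cast
  linarith [Finset.abs_sum_le_sum_abs (fun j => (κ j : ℝ)) Finset.univ]

theorem two_pi_pow_mul_le (n : ℕ) : (2 * Real.pi) ^ n * 8 ^ n ≤ 64 ^ n := by
  rw [← mul_pow]
  refine pow_le_pow_left₀ (by positivity) ?_ n
  linarith [Real.pi_lt_d2]

/-- The factorial produced by Cauchy's estimate cancels the one in the denominator of the Taylor
coefficient. What remains is geometric, since 2π · 8 ≤ 64. -/
theorem norm_conjSymbol_succ_le {p : ℂ → ℂ} (n : ℕ) (κ : Fin (n + 2) → ℤ) {X : ℝ}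
    (hX : ‖finDiff (fun ξ : ℝ => (ξ : ℂ) ^ n * p ξ) (n + 1) (fun j => ((Fin.init κ j : ℤ) : ℝ))
      (κ (Fin.last (n + 1)) : ℝ)‖ ≤ (n + 1).factorial * 8 ^ (n + 1) * X) :
    ‖conjSymbol p (n + 1) κ‖ ≤ 64 ^ (n + 1) * (|(κ (Fin.last (n + 1)) : ℝ)| * X) := by
  have hf : (0:ℝ) < (n + 1).factorial := by positivity
  have h1 := finDiff_intCast (fun ξ : ℝ => (ξ : ℂ) ^ n * p ξ) (n + 1) (Fin.init κ)
    (κ (Fin.last (n + 1)))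
  simp only [Complex.ofReal_intCast] at h1
  have hX0 : 0 ≤ X := by
    have := (norm_nonneg _).trans hX
    by_contra h
    have : (n + 1).factorial * 8 ^ (n + 1) * X < 0 :=
      mul_neg_of_pos_of_neg (by positivity) (not_le.1 h)
    linarith
  rw [conjSymbol, h1, norm_mul, norm_mul, norm_div, norm_pow, norm_mul, norm_mul]
  simp only [Complex.norm_I, Complex.norm_real, Complex.norm_natCast, Complex.norm_intCast,
    Complex.norm_ofNat, mul_one, Real.norm_eq_abs, abs_of_pos Real.pi_pos]
  calc _ ≤ (2 * Real.pi) ^ (n + 1) / (n + 1).factorial * |(κ (Fin.last (n + 1)) : ℝ)| *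
        ((n + 1).factorial * 8 ^ (n + 1) * X) := by gcongr
    _ = (2 * Real.pi) ^ (n + 1) * 8 ^ (n + 1) * (|(κ (Fin.last (n + 1)) : ℝ)| * X) := by
      field_simp
    _ ≤ _ := by gcongr; exact two_pi_pow_mul_le _

/-- One more derivative than the power of z in front leaves a symbol of order r - 1; with equally
many, as in the next lemma, the order is r. The constant 8 is the factor 2 of |z| ≤ 2(1 + |ξ|) times
the 4 of the Cauchy radius. -/
theorem SymbolBound.norm_iteratedDeriv_succ_le {p : ℂ → ℂ} {B r : ℝ} (hp : SymbolBound p B r)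
    (n : ℕ) (y : ℝ) : ‖iteratedDeriv (n + 1) (fun z => z ^ n * p z) (y : ℂ)‖ ≤
      (n + 1).factorial * 8 ^ (n + 1) * (B * (1 + |y|) ^ (r - 1)) := by
  have hB := hp.nonneg
  refine (hp.norm_iteratedDeriv_le n (n + 1) y).trans ?_
  have hy0 : 0 < 1 + |y| := by positivity
  have e : (n + 1).factorial * ((2 * (1 + |y|)) ^ n * (B * (1 + |y|) ^ r)) /
      ((1 + |y|) / 4) ^ (n + 1) =
      (n + 1).factorial * (2 ^ n * 4 ^ (n + 1)) * (B * (1 + |y|) ^ (r - 1)) := by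
    rw [Real.rpow_sub_one hy0.ne', div_pow, mul_pow, pow_succ (1 + |y|)]
    field_simp
  rw [e]
  have h8 : (2:ℝ) ^ n * 4 ^ (n + 1) ≤ 8 ^ (n + 1) := by
    calc (2:ℝ) ^ n * 4 ^ (n + 1) ≤ 2 ^ (n + 1) * 4 ^ (n + 1) := by
          gcongr
          · norm_num
          · omega
      _ = 8 ^ (n + 1) := by rw [← mul_pow]; norm_num
  gcongr

theorem SymbolBound.norm_iteratedDeriv_self_le {p : ℂ → ℂ} {B r : ℝ} (hp : SymbolBound p B r)
    (n : ℕ) (y : ℝ) : ‖iteratedDeriv n (fun z => z ^ n * p z) (y : ℂ)‖ ≤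
      (n + 1).factorial * 8 ^ (n + 1) * (B * (1 + |y|) ^ r) := by
  have hB := hp.nonneg
  refine (hp.norm_iteratedDeriv_le n n y).trans ?_
  have hy0 : 0 < 1 + |y| := by positivity
  have e : n.factorial * ((2 * (1 + |y|)) ^ n * (B * (1 + |y|) ^ r)) /
      ((1 + |y|) / 4) ^ n = n.factorial * 8 ^ n * (B * (1 + |y|) ^ r) := by
    rw [show (8:ℝ) = 2 * 4 by norm_num, div_pow, mul_pow, mul_pow]
    field_simp
  have hfac : ((n.factorial : ℕ) : ℝ) ≤ (n + 1).factorial := by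
    exact_mod_cast Nat.factorial_le (Nat.le_succ n)
  rw [e]
  gcongr
  · norm_num
  · omega

theorem abs_last_mul_prod_le {n : ℕ} (κ : Fin (n + 2) → ℤ) (i : Fin (n + 1)) :
    |(κ (Fin.last (n + 1)) : ℝ)| *
      (∏ j, if j = i then 1 else |((Fin.init κ j : ℤ) : ℝ)|) ≤
      ∏ j, freqWeight (κ (i.castSucc.succAbove j)) := by
  -- Both sides are the product of all weights; the positive weight of the entry `i` is then
  -- cancelled.
  have e1 : freqWeight (κ i.castSucc) * ∏ j, freqWeight (κ (i.castSucc.succAbove j)) =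
      freqWeight (κ i.castSucc) * (freqWeight (κ (Fin.last (n + 1))) *
        ∏ j, if j = i then 1 else freqWeight (κ (Fin.castSucc j))) := by
    rw [← Fin.prod_univ_succAbove (fun j => freqWeight (κ j)) i.castSucc,
      Fin.prod_univ_castSucc, mul_left_comm, mul_comm]
    congr 1
    rw [← Finset.mul_prod_erase Finset.univ _ (Finset.mem_univ i)]
    congr 1
    rw [← Finset.mul_prod_erase Finset.univ
      (fun j => if j = i then (1:ℝ) else freqWeight (κ (Fin.castSucc j))) (Finset.mem_univ i)]
    rw [if_pos rfl, one_mul]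
    refine Finset.prod_congr rfl fun j hj => ?_
    rw [if_neg (Finset.ne_of_mem_erase hj)]
  rw [mul_left_cancel₀ (freqWeight_pos _).ne' e1]
  refine mul_le_mul (abs_le_freqWeight _) ?_ ?_ (freqWeight_pos _).le
  · refine Finset.prod_le_prod (fun j _ => ?_) fun j _ => ?_
    · split_ifs <;> positivity
    · split_ifs
      · exact le_rfl
      · exact abs_le_freqWeight _
  · exact Finset.prod_nonneg fun j _ => by split_ifs <;> positivity

/-- When the frequency M of f dominates, all n + 1 differences are used as derivatives. They give
M^(r-1), and the factor |m| from f' completes it to M^r. Monotonicity of t ↦ t^(r-1) requires r ≥ 1,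
that is s ≥ 1/2. -/
theorem SymbolBound.norm_conjSymbol_le_last {p : ℂ → ℂ} {B r : ℝ} (hp : SymbolBound p B r)
    (hr : 1 ≤ r) (n : ℕ) (κ : Fin (n + 2) → ℤ)
    (hi : ∀ j, freqWeight (κ j) ≤ freqWeight (κ (Fin.last (n + 1)))) :
    ‖conjSymbol p (n + 1) κ‖ ≤ 2 * B * 64 ^ (n + 1) * ((n + 1 + 1 : ℕ) : ℝ) ^ r *
      (freqWeight (κ (Fin.last (n + 1))) ^ r *
        ∏ j, freqWeight (κ ((Fin.last (n + 1)).succAbove j))) := by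
  have hB := hp.nonneg
  have hρ := freqWeight_sum_le κ _ hi
  have hM := freqWeight_pos (κ (Fin.last (n + 1)))
  have hmM := abs_le_freqWeight (κ (Fin.last (n + 1)))
  have hP : ∏ j, |((Fin.init κ j : ℤ) : ℝ)| ≤
      ∏ j, freqWeight (κ ((Fin.last (n + 1)).succAbove j)) := by
    refine Finset.prod_le_prod (fun j _ => abs_nonneg _) fun j _ => ?_
    rw [Fin.succAbove_last]
    exact abs_le_freqWeight _
  have hprod0 : 0 ≤ ∏ j, freqWeight (κ ((Fin.last (n + 1)).succAbove j)) :=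
    Finset.prod_nonneg fun j _ => (freqWeight_pos _).le
  rw [Fin.sum_univ_castSucc] at hρ
  generalize freqWeight (κ (Fin.last (n + 1))) = M at *
  generalize ∏ j, freqWeight (κ ((Fin.last (n + 1)).succAbove j)) = P at *
  have hN1 : (1:ℝ) ≤ ((n + 1 + 1 : ℕ) : ℝ) := by exact_mod_cast Nat.le_add_left _ _
  generalize ((n + 1 + 1 : ℕ) : ℝ) = N at *
  have hb : ∀ y : ℝ, |y| ≤ N * M - 1 →
      ‖iteratedDeriv (n + 1) (fun z => z ^ n * p z) (y : ℂ)‖ ≤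
        (n + 1).factorial * 8 ^ (n + 1) * (B * (N * M) ^ (r - 1)) := by
    intro y hy
    refine (hp.norm_iteratedDeriv_succ_le n y).trans ?_
    gcongr
    linarith
  have h := norm_finDiff_le (n + 1)
    (fun j (x : ℝ) => iteratedDeriv j (fun z => z ^ n * p z) (x : ℂ))
    (fun j x => hp.hasDerivAt_iteratedDeriv n j x)
    (fun j => ((Fin.init κ j : ℤ) : ℝ)) (κ (Fin.last (n + 1)) : ℝ) hb
    (by unfold Fin.init; linarith)
  simp only [iteratedDeriv_zero] at h
  have h2 := norm_conjSymbol_succ_le n κ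
    (X := (∏ j, |((Fin.init κ j : ℤ) : ℝ)|) * (B * (N * M) ^ (r - 1)))
    (h.trans (le_of_eq (by ring)))
  refine h2.trans ?_
  have hNr : N ^ (r - 1) ≤ N ^ r := Real.rpow_le_rpow_of_exponent_le hN1 (by linarith)
  have hMr : M * M ^ (r - 1) = M ^ r := by
    rw [Real.rpow_sub_one (by positivity)]; field_simp
  rw [Real.mul_rpow (by positivity) (by positivity)]
  calc _ ≤ 64 ^ (n + 1) * (M * (P * (B * (N ^ r * M ^ (r - 1))))) := by gcongr
    _ = B * 64 ^ (n + 1) * N ^ r * ((M * M ^ (r - 1)) * P) := by ring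
    _ ≤ _ := by
      rw [hMr]
      have : 0 ≤ B * 64 ^ (n + 1) * N ^ r * (M ^ r * P) := by positivity
      linarith

/-- When a step k_i dominates, using it as a derivative would cost |k_i|. It is estimated trivially
instead: one derivative fewer gives order r in the largest weight, and |m| together with the other
steps supplies the remaining weights. -/
theorem SymbolBound.norm_conjSymbol_le_castSucc {p : ℂ → ℂ} {B r : ℝ} (hp : SymbolBound p B r)
    (hr : 1 ≤ r) (n : ℕ) (κ : Fin (n + 2) → ℤ) (i : Fin (n + 1))
    (hi : ∀ j, freqWeight (κ j) ≤ freqWeight (κ i.castSucc)) :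
    ‖conjSymbol p (n + 1) κ‖ ≤ 2 * B * 64 ^ (n + 1) * ((n + 1 + 1 : ℕ) : ℝ) ^ r *
      (freqWeight (κ i.castSucc) ^ r * ∏ j, freqWeight (κ (i.castSucc.succAbove j))) := by
  have hB := hp.nonneg
  have hρ := freqWeight_sum_le κ _ hi
  have hM := freqWeight_pos (κ i.castSucc)
  have hP := abs_last_mul_prod_le κ i
  rw [Fin.sum_univ_castSucc] at hρ
  generalize freqWeight (κ i.castSucc) = M at *
  generalize ∏ j, freqWeight (κ (i.castSucc.succAbove j)) = P at *
  have hN1 : (1:ℝ) ≤ ((n + 1 + 1 : ℕ) : ℝ) := by exact_mod_cast Nat.le_add_left _ _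
  generalize ((n + 1 + 1 : ℕ) : ℝ) = N at *
  have hb : ∀ y : ℝ, |y| ≤ N * M - 1 →
      ‖iteratedDeriv n (fun z => z ^ n * p z) (y : ℂ)‖ ≤
        (n + 1).factorial * 8 ^ (n + 1) * (B * (N * M) ^ r) := by
    intro y hy
    refine (hp.norm_iteratedDeriv_self_le n y).trans ?_
    gcongr
    linarith
  have h := norm_finDiff_le_drop n
    (fun j (x : ℝ) => iteratedDeriv j (fun z => z ^ n * p z) (x : ℂ))
    (fun j x => hp.hasDerivAt_iteratedDeriv n j x)
    (fun j => ((Fin.init κ j : ℤ) : ℝ)) (κ (Fin.last (n + 1)) : ℝ) hb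
    (by unfold Fin.init; linarith) i
  simp only [iteratedDeriv_zero] at h
  have h2 := norm_conjSymbol_succ_le n κ
    (X := (∏ j, if j = i then 1 else |((Fin.init κ j : ℤ) : ℝ)|) * (2 * (B * (N * M) ^ r)))
    (h.trans (le_of_eq (by ring)))
  refine h2.trans ?_
  rw [Real.mul_rpow (by positivity) (by positivity)]
  calc _ = 64 ^ (n + 1) * ((|(κ (Fin.last (n + 1)) : ℝ)| *
        (∏ j, if j = i then 1 else |((Fin.init κ j : ℤ) : ℝ)|)) *
          (2 * (B * (N ^ r * M ^ r)))) := by ring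
    _ ≤ 64 ^ (n + 1) * (P * (2 * (B * (N ^ r * M ^ r)))) := by gcongr
    _ = _ := by ring

/-- The symbol is bounded by the product of all frequency weights, with the largest one raised to
the power `r`. -/
theorem SymbolBound.norm_conjSymbol_le {p : ℂ → ℂ} {B r : ℝ} (hp : SymbolBound p B r)
    (hr : 1 ≤ r) : ∀ (n : ℕ) (κ : Fin (n + 1) → ℤ) (i : Fin (n + 1))
    (_ : ∀ j, freqWeight (κ j) ≤ freqWeight (κ i)),
    ‖conjSymbol p n κ‖ ≤ 2 * B * 64 ^ n * ((n + 1 : ℕ) : ℝ) ^ r *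
      (freqWeight (κ i) ^ r * ∏ j, freqWeight (κ (i.succAbove j)))
  | 0, κ, i, hi => by
    have hi0 : i = 0 := Fin.fin_one_eq_zero i
    subst hi0
    have := hp.norm_intCast_le (κ 0)
    simp only [conjSymbol, pow_zero, mul_one, zero_add, Nat.cast_one, Real.one_rpow,
      Finset.univ_eq_empty, Finset.prod_empty]
    nlinarith [norm_nonneg (p (κ 0))]
  | n + 1, κ, i, hi => by
    induction i using Fin.lastCases with
    | last => exact hp.norm_conjSymbol_le_last hr n κ hi
    | cast i => exact hp.norm_conjSymbol_le_castSucc hr n κ i hi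

/-! ### Multi-index sums of conjugated symbols -/

/-- One term of the expansion of a conjugated multiplier, for functions with coefficients `b`. -/
noncomputable def conjTerm (p : ℂ → ℂ) (n : ℕ) (b : Fin (n + 1) → ℤ → ℂ)
    (κ : Fin (n + 1) → ℤ) : ℂ := conjSymbol p n κ * ∏ j, b j (κ j)

/-- The growth of the bounds of the conjugated symbols. -/
noncomputable def conjBound (B t : ℝ) (n : ℕ) : ℝ := 2 * B * 64 ^ n * ((n + 1 : ℕ) : ℝ) ^ t

theorem conjBound_nonneg {B : ℝ} (hB : 0 ≤ B) (t : ℝ) (n : ℕ) : 0 ≤ conjBound B t n := by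
  unfold conjBound; positivity

/-- The output frequency is at most n + 1 times the largest input one, so the output weight to the
power τ can be put on the same factor that already carries the power r. -/
theorem SymbolBound.weight_mul_norm_conjTerm_le {p : ℂ → ℂ} {B r τ : ℝ} (hp : SymbolBound p B r)
    (hr : 1 ≤ r) (hτ : 0 ≤ τ) (n : ℕ) (b : Fin (n + 1) → ℤ → ℂ) (κ : Fin (n + 1) → ℤ) :
    ∃ i, freqWeight (∑ j, κ j) ^ τ * ‖conjTerm p n b κ‖ ≤ conjBound B (r + τ) n *
      ((freqWeight (κ i) ^ (r + τ) * ‖b i (κ i)‖) * ∏ j, (freqWeight (κ (i.succAbove j)) *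
        ‖b (i.succAbove j) (κ (i.succAbove j))‖)) := by
  obtain ⟨i, -, hi⟩ := Finset.exists_max_image Finset.univ (fun j => freqWeight (κ j))
    Finset.univ_nonempty
  refine ⟨i, ?_⟩
  have hB := hp.nonneg
  have hi' := fun j => hi j (Finset.mem_univ j)
  have h1 := hp.norm_conjSymbol_le hr n κ i hi'
  have h2 : freqWeight (∑ j, κ j) ^ τ ≤ ((n + 1 : ℕ) : ℝ) ^ τ * freqWeight (κ i) ^ τ := by
    rw [← Real.mul_rpow (by positivity) (freqWeight_pos _).le]
    exact Real.rpow_le_rpow (freqWeight_pos _).le (freqWeight_intSum_le κ i hi') hτ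
  have hw := freqWeight_pos (κ i)
  have hP : 0 ≤ ∏ j, freqWeight (κ (i.succAbove j)) :=
    Finset.prod_nonneg fun j _ => (freqWeight_pos _).le
  have hw' := freqWeight_pos (∑ j, κ j)
  rw [conjTerm, norm_mul, norm_prod, Fin.prod_univ_succAbove _ i, Finset.prod_mul_distrib,
    Real.rpow_add hw, conjBound, Real.rpow_add (by positivity)]
  calc _ ≤ (((n + 1 : ℕ) : ℝ) ^ τ * freqWeight (κ i) ^ τ) *
        ((2 * B * 64 ^ n * ((n + 1 : ℕ) : ℝ) ^ r *
      (freqWeight (κ i) ^ r * ∏ j, freqWeight (κ (i.succAbove j)))) *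
        (‖b i (κ i)‖ * ∏ j, ‖b (i.succAbove j) (κ (i.succAbove j))‖)) := by gcongr
    _ = _ := by ring

/-- Which entry is largest depends on `κ`. Summing over all `i` removes this dependence and will
cost only a factor n + 1. -/
theorem SymbolBound.weight_mul_enorm_conjTerm_le {p : ℂ → ℂ} {B r τ : ℝ}
    (hp : SymbolBound p B r) (hr : 1 ≤ r) (hτ : 0 ≤ τ) (n : ℕ) (b : Fin (n + 1) → ℤ → ℂ)
    (κ : Fin (n + 1) → ℤ) :
    ENNReal.ofReal (freqWeight (∑ j, κ j) ^ τ) * ‖conjTerm p n b κ‖ₑ ≤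
      ENNReal.ofReal (conjBound B (r + τ) n) *
      ∑ i, ENNReal.ofReal (freqWeight (κ i) ^ (r + τ) * ‖b i (κ i)‖) *
        ∏ j, ENNReal.ofReal (freqWeight (κ (i.succAbove j)) *
          ‖b (i.succAbove j) (κ (i.succAbove j))‖) := by
  obtain ⟨i, hi⟩ := hp.weight_mul_norm_conjTerm_le hr hτ n b κ
  have hw := fun k => (freqWeight_pos k).le
  have hw' := fun (k : ℤ) (t : ℝ) => Real.rpow_nonneg (hw k) t
  calc _ = ENNReal.ofReal (freqWeight (∑ j, κ j) ^ τ * ‖conjTerm p n b κ‖) := by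
        rw [ENNReal.ofReal_mul (hw' _ _), ofReal_norm]
    _ ≤ _ := ENNReal.ofReal_le_ofReal hi
    _ = ENNReal.ofReal (conjBound B (r + τ) n) *
        (ENNReal.ofReal (freqWeight (κ i) ^ (r + τ) * ‖b i (κ i)‖) *
        ∏ j, ENNReal.ofReal (freqWeight (κ (i.succAbove j)) *
          ‖b (i.succAbove j) (κ (i.succAbove j))‖)) := by
        rw [ENNReal.ofReal_mul (conjBound_nonneg hp.nonneg _ _),
          ENNReal.ofReal_mul (mul_nonneg (hw' _ _) (norm_nonneg _)),
          ENNReal.ofReal_prod_of_nonneg fun j _ => mul_nonneg (hw _) (norm_nonneg _)]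
    _ ≤ _ := by
        gcongr
        exact Finset.single_le_sum (f := fun i => ENNReal.ofReal (freqWeight (κ i) ^ (r + τ) *
          ‖b i (κ i)‖) * ∏ j, ENNReal.ofReal (freqWeight (κ (i.succAbove j)) *
          ‖b (i.succAbove j) (κ (i.succAbove j))‖)) (fun _ _ => zero_le) (Finset.mem_univ i)

theorem SymbolBound.tsum_sq_conjTerm_le {p : ℂ → ℂ} {B r τ : ℝ}
    (hp : SymbolBound p B r) (hr : 1 ≤ r) (hτ : 0 ≤ τ) (n : ℕ) (b : Fin (n + 1) → ℤ → ℂ)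
    (α : Fin (n + 1) → ℝ≥0∞) (L : ℝ≥0∞)
    (ha : ∀ i, ∑' k, ENNReal.ofReal (freqWeight k * ‖b i k‖) ≤ α i)
    (hb : ∀ i, ∑' k, ENNReal.ofReal (freqWeight k ^ (r + τ) * ‖b i k‖) ^ 2 ≤ (L * α i) ^ 2) :
    ∑' l : ℤ, (ENNReal.ofReal (freqWeight l ^ τ) * ∑' κ : Fin (n + 1) → ℤ,
      if ∑ j, κ j = l then ‖conjTerm p n b κ‖ₑ else 0) ^ 2 ≤
      (ENNReal.ofReal (conjBound B (r + τ) n) * ((n + 1 : ℕ) * (L * ∏ i, α i))) ^ 2 := by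
  have h := ENNReal.tsum_multiindex_sum_sq_le
    (fun i k => ENNReal.ofReal (freqWeight k * ‖b i k‖))
    (fun i k => ENNReal.ofReal (freqWeight k ^ (r + τ) * ‖b i k‖)) α L ha hb
  rw [mul_pow]
  refine le_trans ?_ (mul_le_mul' le_rfl h)
  rw [← ENNReal.tsum_mul_left]
  refine ENNReal.tsum_le_tsum fun l => ?_
  rw [← mul_pow]
  refine pow_le_pow_left' ?_ 2
  rw [← ENNReal.tsum_mul_left, ← ENNReal.tsum_mul_left]
  refine ENNReal.tsum_le_tsum fun κ => ?_
  split_ifs with hκ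
  · rw [← hκ]
    exact hp.weight_mul_enorm_conjTerm_le hr hτ n b κ
  · simp

theorem SymbolBound.tsum_enorm_conjTerm_le {p : ℂ → ℂ} {B r : ℝ}
    (hp : SymbolBound p B r) (hr : 1 ≤ r) (n : ℕ) (b : Fin (n + 1) → ℤ → ℂ)
    (α : Fin (n + 1) → ℝ≥0∞) (L : ℝ≥0∞)
    (ha : ∀ i, ∑' k, ENNReal.ofReal (freqWeight k * ‖b i k‖) ≤ α i)
    (hb : ∀ i, ∑' k, ENNReal.ofReal (freqWeight k ^ r * ‖b i k‖) ≤ L * α i) :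
    ∑' κ, ‖conjTerm p n b κ‖ₑ ≤
      ENNReal.ofReal (conjBound B r n) * ((n + 1 : ℕ) * (L * ∏ i, α i)) := by
  have h := ENNReal.tsum_multiindex_sum_le
    (fun i k => ENNReal.ofReal (freqWeight k * ‖b i k‖))
    (fun i k => ENNReal.ofReal (freqWeight k ^ r * ‖b i k‖)) α L ha hb
  refine le_trans ?_ (mul_le_mul' le_rfl h)
  rw [← ENNReal.tsum_mul_left]
  refine ENNReal.tsum_le_tsum fun κ => ?_
  simpa using hp.weight_mul_enorm_conjTerm_le hr le_rfl n b κ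

/-- The `l`-th Fourier coefficient of the `n`-th term of the expansion of a conjugated
multiplier. -/
noncomputable def conjCoeff (p : ℂ → ℂ) (n : ℕ) (b : Fin (n + 1) → ℤ → ℂ) (l : ℤ) : ℂ :=
  ∑' κ : Fin (n + 1) → ℤ, if ∑ j, κ j = l then conjTerm p n b κ else 0

theorem enorm_ite_zero (P : Prop) [Decidable P] (z : ℂ) :
    ‖if P then z else 0‖ₑ = if P then ‖z‖ₑ else 0 := by
  split_ifs <;> simp

theorem enorm_conjCoeff_le (p : ℂ → ℂ) (n : ℕ) (b : Fin (n + 1) → ℤ → ℂ) (l : ℤ) :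
    ‖conjCoeff p n b l‖ₑ ≤ ∑' κ : Fin (n + 1) → ℤ,
      if ∑ j, κ j = l then ‖conjTerm p n b κ‖ₑ else 0 := by
  simp_rw [← enorm_ite_zero]
  exact enorm_tsum_le_tsum_enorm

theorem summable_of_tsum_enorm_ne_top {ι : Type*} {f : ι → ℂ} (h : ∑' i, ‖f i‖ₑ ≠ ⊤) :
    Summable fun i => ‖f i‖ := by
  have h2 : ∑' i, ((‖f i‖₊ : NNReal) : ℝ≥0∞) ≠ ⊤ := h
  have h3 := ENNReal.tsum_coe_ne_top_iff_summable.1 h2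
  exact NNReal.summable_coe.2 h3

/-- The weighted Fourier coefficients of the `n`-th term of the expansion. -/
noncomputable def weightedConjCoeff (p : ℂ → ℂ) (τ : ℝ) (n : ℕ) (b : Fin (n + 1) → ℤ → ℂ)
    (l : ℤ) : ℂ := (((1 + (l : ℝ) ^ 2) ^ (τ / 2) : ℝ) : ℂ) * conjCoeff p n b l

theorem one_add_sq_rpow_half_le {τ : ℝ} (hτ : 0 ≤ τ) (k : ℤ) :
    (1 + (k : ℝ) ^ 2) ^ (τ / 2) ≤ freqWeight k ^ τ := by
  have h := one_add_sq_rpow_le (div_nonneg hτ zero_le_two) k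
  rwa [← Real.rpow_natCast (_ ^ _), ← Real.rpow_mul (freqWeight_pos k).le,
    show τ / 2 * ((2 : ℕ) : ℝ) = τ by push_cast; ring] at h

theorem enorm_weightedConjCoeff_le (p : ℂ → ℂ) {τ : ℝ} (hτ : 0 ≤ τ) (n : ℕ)
    (b : Fin (n + 1) → ℤ → ℂ) (l : ℤ) :
    ‖weightedConjCoeff p τ n b l‖ₑ ≤ ENNReal.ofReal (freqWeight l ^ τ) *
      ∑' κ : Fin (n + 1) → ℤ, if ∑ j, κ j = l then ‖conjTerm p n b κ‖ₑ else 0 := by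
  rw [weightedConjCoeff, enorm_mul]
  refine mul_le_mul' ?_ (enorm_conjCoeff_le p n b l)
  rw [← ofReal_norm, Complex.norm_real, Real.norm_of_nonneg (by positivity)]
  exact ENNReal.ofReal_le_ofReal (one_add_sq_rpow_half_le hτ l)

theorem lp_two_of_tsum_enorm_sq_le {f : ℤ → ℂ} {C : ℝ} (hC : 0 ≤ C)
    (h : ∑' l, ‖f l‖ₑ ^ 2 ≤ ENNReal.ofReal C ^ 2) :
    ∃ hf : Memℓp f 2, ‖(⟨f, hf⟩ : lp (fun _ : ℤ => ℂ) 2)‖ ≤ C := by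
  have e : ∀ l, ‖f l‖ₑ ^ 2 = ENNReal.ofReal (‖f l‖ ^ 2) := fun l => by
    rw [ENNReal.ofReal_pow (norm_nonneg _), ofReal_norm]
  simp_rw [e] at h
  rw [← ENNReal.ofReal_pow hC] at h
  have hs : Summable fun l => ‖f l‖ ^ 2 := by
    have := ENNReal.summable_toReal (ne_top_of_le_ne_top ENNReal.ofReal_ne_top h)
    simpa using this
  rw [← ENNReal.ofReal_tsum_of_nonneg (fun l => by positivity) hs,
    ENNReal.ofReal_le_ofReal_iff (by positivity)] at h
  have hf : Memℓp f 2 := (memℓp_gen_iff (by norm_num)).2 (by simpa using hs)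
  refine ⟨hf, le_of_sq_le_sq ?_ hC⟩
  rw [SobolevCircle.lp_two_norm_sq]
  exact h

theorem SymbolBound.lp_two_weightedConjCoeff {p : ℂ → ℂ} {B r τ : ℝ}
    (hp : SymbolBound p B r) (hr : 1 ≤ r) (hτ : 0 ≤ τ) (n : ℕ) (b : Fin (n + 1) → ℤ → ℂ)
    (α : Fin (n + 1) → ℝ) (L : ℝ) (hα : ∀ i, 0 ≤ α i) (hL : 0 ≤ L)
    (ha : ∀ i, ∑' k, ENNReal.ofReal (freqWeight k * ‖b i k‖) ≤ ENNReal.ofReal (α i))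
    (hb : ∀ i, ∑' k, ENNReal.ofReal (freqWeight k ^ (r + τ) * ‖b i k‖) ^ 2 ≤
      ENNReal.ofReal (L * α i) ^ 2) :
    ∃ hf : Memℓp (weightedConjCoeff p τ n b) 2,
      ‖(⟨_, hf⟩ : lp (fun _ : ℤ => ℂ) 2)‖ ≤
        conjBound B (r + τ) n * ((n + 1 : ℕ) * (L * ∏ i, α i)) := by
  have hB := conjBound_nonneg hp.nonneg (r + τ) n
  have hP : 0 ≤ ∏ i, α i := Finset.prod_nonneg fun i _ => hα i
  refine lp_two_of_tsum_enorm_sq_le (by positivity) ?_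
  have h := hp.tsum_sq_conjTerm_le hr hτ n b (fun i => ENNReal.ofReal (α i)) (ENNReal.ofReal L)
    ha (fun i => by rw [← ENNReal.ofReal_mul hL]; exact hb i)
  rw [← ENNReal.ofReal_prod_of_nonneg fun i _ => hα i, ← ENNReal.ofReal_mul hL,
    ← ENNReal.ofReal_natCast, ← ENNReal.ofReal_mul (by positivity),
    ← ENNReal.ofReal_mul hB] at h
  refine le_trans (ENNReal.tsum_le_tsum fun l => ?_) h
  exact pow_le_pow_left' (enorm_weightedConjCoeff_le p hτ n b l) 2

/-- A finite ℓ² sum has finite terms, and the weights are positive, so each coefficient is an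
absolutely convergent sum. Multilinearity of the Taylor coefficients is then checked termwise. -/
theorem summable_conjTerm_of_weighted {p : ℂ → ℂ} {τ : ℝ} {n : ℕ}
    {b : Fin (n + 1) → ℤ → ℂ}
    (h : ∑' l : ℤ, (ENNReal.ofReal (freqWeight l ^ τ) * ∑' κ : Fin (n + 1) → ℤ,
      if ∑ j, κ j = l then ‖conjTerm p n b κ‖ₑ else 0) ^ 2 ≠ ⊤) (l : ℤ) :
    Summable fun κ : Fin (n + 1) → ℤ => if ∑ j, κ j = l then conjTerm p n b κ else 0 := by
  have h1 := ENNReal.ne_top_of_tsum_ne_top h l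
  refine (summable_of_tsum_enorm_ne_top ?_).of_norm
  simp_rw [enorm_ite_zero]
  intro h2
  refine h1 ?_
  rw [h2, ENNReal.mul_top, ENNReal.top_pow two_ne_zero]
  rw [ne_eq, ENNReal.ofReal_eq_zero, not_le]
  exact Real.rpow_pos_of_pos (freqWeight_pos l) τ

/-- If all terms are absolutely summable, grouping them by their total frequency gives the Fourier
series with coefficients `conjCoeff`. -/
theorem hasSum_conjCoeff_mul_fourier {p : ℂ → ℂ} {n : ℕ} {b : Fin (n + 1) → ℤ → ℂ}
    (h : Summable fun κ => ‖conjTerm p n b κ‖) :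
    (Summable fun l => ‖conjCoeff p n b l‖) ∧ ∀ x : UnitAddCircle,
      trigSeries (conjCoeff p n b) x = ∑' κ, conjTerm p n b κ * fourier (∑ j, κ j) x := by
  have hs : ∑' l : ℤ, ∑' κ : Fin (n + 1) → ℤ,
      (if ∑ j, κ j = l then ‖conjTerm p n b κ‖ₑ else 0) ≠ ⊤ := by
    -- Each `κ` contributes to exactly one total frequency `l`.
    rw [ENNReal.tsum_comm]
    simp_rw [tsum_ite_eq' _ (fun _ => ‖conjTerm p n b _‖ₑ)]
    exact ENNReal.tsum_coe_ne_top_iff_summable.2 (NNReal.summable_coe.1 h)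
  refine ⟨summable_of_tsum_enorm_ne_top
    (ne_top_of_le_ne_top hs (ENNReal.tsum_le_tsum fun l => enorm_conjCoeff_le p n b l)),
    fun x => ?_⟩
  have hs2 : Summable (Function.uncurry fun (l : ℤ) (κ : Fin (n + 1) → ℤ) =>
      if ∑ j, κ j = l then conjTerm p n b κ * fourier (∑ j, κ j) x else 0) := by
    refine (summable_of_tsum_enorm_ne_top ?_).of_norm
    rw [ENNReal.tsum_prod']
    refine ne_top_of_le_ne_top hs (ENNReal.tsum_le_tsum fun l => ENNReal.tsum_le_tsum fun κ => ?_)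
    simp only [Function.uncurry, enorm_ite_zero, enorm_mul]
    have : ‖(fourier (∑ j, κ j) x : ℂ)‖ₑ = 1 := by
      rw [← ofReal_norm, norm_fourier_apply, ENNReal.ofReal_one]
    rw [this, mul_one]
  have h3 := hs2.tsum_comm
  unfold trigSeries conjCoeff
  simp_rw [← tsum_mul_right, ite_mul, zero_mul]
  have h4 : ∀ (l : ℤ) (κ : Fin (n + 1) → ℤ),
      (if ∑ j, κ j = l then conjTerm p n b κ * fourier l x else 0) =
      if ∑ j, κ j = l then conjTerm p n b κ * fourier (∑ j, κ j) x else 0 := by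
    intro l κ
    split_ifs with hκ
    · rw [hκ]
    · rfl
  simp_rw [h4]
  rw [← h3]
  refine tsum_congr fun κ => ?_
  exact tsum_ite_eq' (∑ j, κ j) fun _ => conjTerm p n b κ * fourier (∑ j, κ j) x

/-! ### The Taylor coefficients as bounded multilinear maps -/

namespace SobolevCircle

variable {σ : ℝ}

theorem tsum_weight_sq_le (hσ : 0 ≤ σ) (u : SobolevCircle σ) :
    ∑' k, ENNReal.ofReal (freqWeight k ^ σ * ‖circleCoeff u.toCont k‖) ^ 2 ≤
      ENNReal.ofReal (2 ^ σ * ‖u‖ ^ 2) := by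
  rw [norm_sq_eq, ← tsum_mul_left,
    ENNReal.ofReal_tsum_of_nonneg (fun k => by positivity) (u.summable_sq.mul_left _)]
  refine ENNReal.tsum_le_tsum fun k => ?_
  have hw := freqWeight_pos k
  rw [← ENNReal.ofReal_pow (by positivity)]
  refine ENNReal.ofReal_le_ofReal ?_
  rw [mul_pow, ← mul_assoc]
  exact mul_le_mul_of_nonneg_right (freqWeight_rpow_sq_le hσ k) (sq_nonneg _)

/-- The constant in the embedding of `H^σ` into the functions with `∑ₖ (1 + |k|)^a |û(k)| < ∞`. -/
noncomputable def embedConst (σ a : ℝ) : ℝ :=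
  Real.sqrt (2 ^ σ * (1 + ∑' k : ℤ, freqWeight k ^ (2 * (a - σ))))

theorem one_le_tsum_add (σ a : ℝ) : 1 ≤ 1 + ∑' k : ℤ, freqWeight k ^ (2 * (a - σ)) :=
  le_add_of_nonneg_right (tsum_nonneg fun k => Real.rpow_nonneg (freqWeight_pos k).le _)

theorem embedConst_pos (σ a : ℝ) : 0 < embedConst σ a :=
  Real.sqrt_pos.2 (mul_pos (by positivity) (one_pos.trans_le (one_le_tsum_add σ a)))

theorem embedConst_sq (σ a : ℝ) :
    embedConst σ a ^ 2 = 2 ^ σ * (1 + ∑' k : ℤ, freqWeight k ^ (2 * (a - σ))) :=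
  Real.sq_sqrt (mul_nonneg (by positivity) (zero_le_one.trans (one_le_tsum_add σ a)))

/-- The summand 1 in `embedConst` makes the same constant serve for the ℓ² norm and for the ℓ¹ norm,
so that the ratio `L` of strong to weak bounds can be taken to be 1. -/
theorem tsum_weight_sq_le_embed (hσ : 0 ≤ σ) (a : ℝ) (u : SobolevCircle σ) :
    ∑' k, ENNReal.ofReal (freqWeight k ^ σ * ‖circleCoeff u.toCont k‖) ^ 2 ≤
      ENNReal.ofReal (embedConst σ a * ‖u‖) ^ 2 := by
  refine (u.tsum_weight_sq_le hσ).trans ?_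
  have hC := embedConst_pos σ a
  rw [← ENNReal.ofReal_pow (by positivity), mul_pow, embedConst_sq]
  refine ENNReal.ofReal_le_ofReal (mul_le_mul_of_nonneg_right ?_ (sq_nonneg _))
  exact le_mul_of_one_le_right (by positivity) (one_le_tsum_add σ a)

/-- Weighted Cauchy–Schwarz with weight (1 + |k|)^(2(a - σ)), summable because a + 1/2 < σ. -/
theorem tsum_weight_le (hσ : 0 ≤ σ) {a : ℝ} (ha : a + 1 / 2 < σ) (u : SobolevCircle σ) :
    ∑' k, ENNReal.ofReal (freqWeight k ^ a * ‖circleCoeff u.toCont k‖) ≤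
      ENNReal.ofReal (embedConst σ a * ‖u‖) := by
  have hC := embedConst_pos σ a
  have h1 := ENNReal.tsum_mul_sq_le (fun k : ℤ => ENNReal.ofReal (freqWeight k ^ (2 * (a - σ))))
    fun k => ENNReal.ofReal (freqWeight k ^ (2 * σ - a) * ‖circleCoeff u.toCont k‖)
  have e1 : ∀ k, ENNReal.ofReal (freqWeight k ^ (2 * (a - σ))) *
      ENNReal.ofReal (freqWeight k ^ (2 * σ - a) * ‖circleCoeff u.toCont k‖) =
      ENNReal.ofReal (freqWeight k ^ a * ‖circleCoeff u.toCont k‖) := fun k => by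
    have hw := freqWeight_pos k
    rw [← ENNReal.ofReal_mul (by positivity), ← mul_assoc, ← Real.rpow_add hw]
    congr 3; ring
  have e2 : ∀ k, ENNReal.ofReal (freqWeight k ^ (2 * (a - σ))) *
      ENNReal.ofReal (freqWeight k ^ (2 * σ - a) * ‖circleCoeff u.toCont k‖) ^ 2 =
      ENNReal.ofReal (freqWeight k ^ σ * ‖circleCoeff u.toCont k‖) ^ 2 := fun k => by
    have hw := freqWeight_pos k
    rw [← ENNReal.ofReal_pow (by positivity), ← ENNReal.ofReal_pow (by positivity),
      ← ENNReal.ofReal_mul (by positivity), mul_pow, mul_pow, ← mul_assoc,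
      ← Real.rpow_natCast (freqWeight k ^ (2 * σ - a)), ← Real.rpow_natCast (freqWeight k ^ σ),
      ← Real.rpow_mul hw.le, ← Real.rpow_mul hw.le, ← Real.rpow_add hw]
    congr 3; push_cast; ring
  simp_rw [e1, e2] at h1
  refine (ENNReal.pow_right_strictMono two_ne_zero).le_iff_le.1 ?_
  refine h1.trans ((mul_le_mul' le_rfl (u.tsum_weight_sq_le hσ)).trans ?_)
  have hs := summable_freqWeight_rpow (p := 2 * (a - σ)) (by linarith)
  rw [← ENNReal.ofReal_tsum_of_nonneg (fun k => Real.rpow_nonneg (freqWeight_pos k).le _) hs,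
    ← ENNReal.ofReal_mul (tsum_nonneg fun k => Real.rpow_nonneg (freqWeight_pos k).le _),
    ← ENNReal.ofReal_pow (by positivity), mul_pow, embedConst_sq]
  refine ENNReal.ofReal_le_ofReal ?_
  have : 0 ≤ (2:ℝ) ^ σ * ‖u‖ ^ 2 := by positivity
  nlinarith

theorem tsum_freqWeight_le (hσ : 3 / 2 < σ) (u : SobolevCircle σ) :
    ∑' k, ENNReal.ofReal (freqWeight k * ‖circleCoeff u.toCont k‖) ≤
      ENNReal.ofReal (embedConst σ 1 * ‖u‖) := by
  simpa using u.tsum_weight_le (a := 1) (by linarith) (by linarith)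

/-- The Fourier coefficients of a family of Sobolev functions. -/
noncomputable def coeffs {n : ℕ} (u : Fin n → SobolevCircle σ) (i : Fin n) : ℤ → ℂ :=
  circleCoeff (u i).toCont

/-- The `k`-th Fourier coefficient as a linear map. -/
noncomputable def coeffLM (σ : ℝ) (k : ℤ) : SobolevCircle σ →ₗ[ℝ] ℂ where
  toFun u := circleCoeff u.toCont k
  map_add' u v := circleCoeff_add _ _ k
  map_smul' c u := by simp [circleCoeff_smul]

/-- One term of the expansion of a conjugated multiplier, as a multilinear map. -/
noncomputable def conjTermMultilinear (σ : ℝ) (p : ℂ → ℂ) (n : ℕ) (κ : Fin (n + 1) → ℤ) :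
    MultilinearMap ℝ (fun _ : Fin (n + 1) => SobolevCircle σ) ℂ :=
  conjSymbol p n κ • (MultilinearMap.mkPiAlgebra ℝ (Fin (n + 1)) ℂ).compLinearMap
    fun j => coeffLM σ (κ j)

theorem conjTermMultilinear_apply (p : ℂ → ℂ) (n : ℕ) (κ : Fin (n + 1) → ℤ)
    (u : Fin (n + 1) → SobolevCircle σ) :
    conjTermMultilinear σ p n κ u = conjTerm p n (coeffs u) κ := by
  rfl

variable {p : ℂ → ℂ} {B r τ : ℝ}

theorem summable_conjTerm (hp : SymbolBound p B r) (hr : 1 ≤ r) (hτ : 0 ≤ τ)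
    (hσ : 3 / 2 < σ) (hrτ : r + τ = σ) (n : ℕ) (u : Fin (n + 1) → SobolevCircle σ) (l : ℤ) :
    Summable fun κ : Fin (n + 1) → ℤ =>
      if ∑ j, κ j = l then conjTerm p n (coeffs u) κ else 0 := by
  refine summable_conjTerm_of_weighted (τ := τ) (ne_top_of_le_ne_top ?_
    (hp.tsum_sq_conjTerm_le hr hτ n (coeffs u)
      (fun i => ENNReal.ofReal (embedConst σ 1 * ‖u i‖)) 1
      (fun i => (u i).tsum_freqWeight_le hσ) fun i => ?_)) l
  · refine ENNReal.pow_ne_top (ENNReal.mul_ne_top ENNReal.ofReal_ne_top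
      (ENNReal.mul_ne_top (ENNReal.natCast_ne_top _) (ENNReal.mul_ne_top ENNReal.one_ne_top ?_)))
    exact ENNReal.prod_ne_top fun i _ => ENNReal.ofReal_ne_top
  · rw [one_mul, hrτ]
    exact (u i).tsum_weight_sq_le_embed (by linarith) 1

theorem lp_two_weightedConjCoeff (hp : SymbolBound p B r) (hr : 1 ≤ r) (hτ : 0 ≤ τ)
    (hσ : 3 / 2 < σ) (hrτ : r + τ = σ) (n : ℕ) (u : Fin (n + 1) → SobolevCircle σ) :
    ∃ hf : Memℓp (weightedConjCoeff p τ n (coeffs u)) 2,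
      ‖(⟨_, hf⟩ : lp (fun _ : ℤ => ℂ) 2)‖ ≤
        conjBound B σ n * (n + 1 : ℕ) * embedConst σ 1 ^ (n + 1) * ∏ i, ‖u i‖ := by
  have hC := embedConst_pos σ 1
  obtain ⟨hf, h⟩ := hp.lp_two_weightedConjCoeff hr hτ n (coeffs u)
    (fun i => embedConst σ 1 * ‖u i‖) 1 (fun i => by positivity) zero_le_one
    (fun i => (u i).tsum_freqWeight_le hσ) (fun i => by
      rw [one_mul, hrτ]
      exact (u i).tsum_weight_sq_le_embed (by linarith) 1)
  refine ⟨hf, h.trans (le_of_eq ?_)⟩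
  rw [hrτ, Finset.prod_mul_distrib]
  simp
  ring

/-- The `n`-th Taylor coefficient of a conjugated multiplier with symbol of order `r`, as a bounded
multilinear map with values in the sequences of weighted Fourier coefficients. -/
noncomputable def conjMultilinear (hp : SymbolBound p B r) (hr : 1 ≤ r) (hτ : 0 ≤ τ)
    (hσ : 3 / 2 < σ) (hrτ : r + τ = σ) (n : ℕ) :
    ContinuousMultilinearMap ℝ (fun _ : Fin (n + 1) => SobolevCircle σ)
      (lp (fun _ : ℤ => ℂ) 2) :=
  MultilinearMap.mkContinuous
    { toFun := fun u => ⟨_, (lp_two_weightedConjCoeff hp hr hτ hσ hrτ n u).1⟩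
      map_update_add' := fun u i x y => by
        refine Subtype.ext (funext fun l => ?_)
        change weightedConjCoeff _ _ _ _ _ =
          weightedConjCoeff _ _ _ _ _ + weightedConjCoeff _ _ _ _ _
        simp only [weightedConjCoeff, conjCoeff]
        rw [← mul_add, ← (summable_conjTerm hp hr hτ hσ hrτ n _ l).tsum_add
          (summable_conjTerm hp hr hτ hσ hrτ n _ l)]
        congr 2
        funext κ
        rw [← conjTermMultilinear_apply, ← conjTermMultilinear_apply,
          ← conjTermMultilinear_apply, MultilinearMap.map_update_add]
        split_ifs <;> simp
      map_update_smul' := fun u i c x => by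
        refine Subtype.ext (funext fun l => ?_)
        change weightedConjCoeff _ _ _ _ _ = c • weightedConjCoeff _ _ _ _ _
        simp only [weightedConjCoeff, conjCoeff]
        rw [← mul_smul_comm, ← tsum_const_smul'']
        congr 2
        funext κ
        rw [← conjTermMultilinear_apply, ← conjTermMultilinear_apply,
          MultilinearMap.map_update_smul]
        split_ifs <;> simp }
    (conjBound B σ n * (n + 1 : ℕ) * embedConst σ 1 ^ (n + 1))
    fun u => (lp_two_weightedConjCoeff hp hr hτ hσ hrτ n u).2

theorem norm_conjMultilinear_le (hp : SymbolBound p B r) (hr : 1 ≤ r) (hτ : 0 ≤ τ)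
    (hσ : 3 / 2 < σ) (hrτ : r + τ = σ) (n : ℕ) :
    ‖conjMultilinear hp hr hτ hσ hrτ n‖ ≤
      conjBound B σ n * (n + 1 : ℕ) * embedConst σ 1 ^ (n + 1) :=
  MultilinearMap.mkContinuous_norm_le _ (by
    have := conjBound_nonneg hp.nonneg σ n
    have := embedConst_pos σ 1
    positivity) _

end SobolevCircle

theorem HasSum.of_eq {ι : Type*} {f g : ι → ℂ} {a : ℂ} (h : HasSum g a) (e : ∀ i, f i = g i) :
    HasSum f a := (funext e : f = g) ▸ h

/-! ### Termwise integration and differentiation -/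

theorem norm_fourierCoeff_le {F : UnitAddCircle → ℂ} {C : ℝ} (h : ∀ y, ‖F y‖ ≤ C) (n : ℤ) :
    ‖fourierCoeff F n‖ ≤ C := by
  unfold fourierCoeff
  have := MeasureTheory.norm_integral_le_of_norm_le_const
    (μ := (AddCircle.haarAddCircle : MeasureTheory.Measure UnitAddCircle))
    (f := fun t => (fourier (-n) t • F t : ℂ)) (C := C)
    (Filter.Eventually.of_forall fun y => by
      rw [norm_smul, norm_fourier_apply, one_mul]; exact h y)
  simpa using this

theorem fourierCoeff_sub_of_continuous {F G : UnitAddCircle → ℂ} (hF : Continuous F)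
    (hG : Continuous G) (n : ℤ) :
    fourierCoeff (fun y => F y - G y) n = fourierCoeff F n - fourierCoeff G n := by
  have h := congrFun (fourierCoeff.add (integrable_of_continuous_circle hF)
    (integrable_of_continuous_circle hG.neg)) n
  have h2 := fourierCoeff.const_mul G (-1) n
  have e1 : (fun y => F y - G y) = F + fun y => -G y := by
    funext y; simp [sub_eq_add_neg]
  have e2 : -G = fun y => -1 * G y := by funext y; simp
  rw [Pi.add_apply] at h
  rw [e1]
  refine h.trans ?_
  rw [e2, h2]
  ring

/-- Termwise integration, justified by a summable bound uniform on the circle. -/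
theorem hasSum_fourierCoeff_of_hasSum {ι : Type*} [Countable ι] {F : ι → UnitAddCircle → ℂ}
    {G : UnitAddCircle → ℂ} {b : ι → ℝ} (hF : ∀ i, Continuous (F i)) (hb : Summable b)
    (hFb : ∀ i y, ‖F i y‖ ≤ b i) (hG : ∀ y, HasSum (fun i => F i y) (G y)) (n : ℤ) :
    HasSum (fun i => fourierCoeff (F i) n) (fourierCoeff G n) := by
  have h := MeasureTheory.hasSum_integral_of_summable_integral_norm
    (μ := (AddCircle.haarAddCircle : MeasureTheory.Measure UnitAddCircle))
    (F := fun i t => (fourier (-n) t • F i t : ℂ))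
    (fun i => integrable_of_continuous_circle ((fourier (-n)).continuous.smul (hF i))) (by
      refine Summable.of_nonneg_of_le (fun i => MeasureTheory.integral_nonneg fun y =>
        norm_nonneg _) (fun i => ?_) hb
      have := MeasureTheory.norm_integral_le_of_norm_le_const
        (μ := (AddCircle.haarAddCircle : MeasureTheory.Measure UnitAddCircle))
        (f := fun t => ‖(fourier (-n) t • F i t : ℂ)‖) (C := b i)
        (Filter.Eventually.of_forall fun y => by
          rw [norm_norm, norm_smul, norm_fourier_apply, one_mul]; exact hFb i y)
      exact (Real.le_norm_self _).trans (by simpa using this))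
  have e : fourierCoeff G n = ∫ t : UnitAddCircle, ∑' i, (fourier (-n) t • F i t : ℂ)
      ∂AddCircle.haarAddCircle := by
    unfold fourierCoeff
    congr 1
    funext t
    rw [tsum_const_smul'', (hG t).tsum_eq]
  rw [e]
  exact h

theorem fourier_coe_eq (n : ℤ) (x : ℝ) :
    (fourier n (x : UnitAddCircle) : ℂ) = Complex.exp (2 * Real.pi * Complex.I * n * x) := by
  rw [fourier_coe_apply]; simp

theorem hasDerivAt_fourier_coe (n : ℤ) (x : ℝ) :
    HasDerivAt (fun y : ℝ => (fourier n (y : UnitAddCircle) : ℂ))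
      (2 * Real.pi * Complex.I * n * fourier n (x : UnitAddCircle)) x := by
  have := hasDerivAt_fourier 1 n x
  simpa using this

theorem norm_two_pi_I_mul_le (k : ℤ) (z : ℂ) :
    ‖2 * Real.pi * Complex.I * k * z‖ ≤ 2 * Real.pi * (freqWeight k * ‖z‖) := by
  rw [norm_mul, norm_mul, norm_mul, norm_mul]
  simp only [Complex.norm_I, Complex.norm_real, Complex.norm_intCast,
    Complex.norm_ofNat, mul_one, Real.norm_eq_abs, abs_of_pos Real.pi_pos]
  rw [mul_assoc]
  have := abs_le_freqWeight k
  gcongr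

theorem summable_two_pi_I_mul {a : ℤ → ℂ} (ha : Summable fun k => freqWeight k * ‖a k‖) :
    Summable fun k : ℤ => ‖2 * Real.pi * Complex.I * k * a k‖ :=
  Summable.of_nonneg_of_le (fun _ => norm_nonneg _) (fun k => norm_two_pi_I_mul_le k (a k))
    (ha.mul_left _)

theorem summable_of_summable_freqWeight {a : ℤ → ℂ}
    (ha : Summable fun k => freqWeight k * ‖a k‖) : Summable fun k => ‖a k‖ :=
  Summable.of_nonneg_of_le (fun _ => norm_nonneg _)
    (fun k => le_mul_of_one_le_left (norm_nonneg _) (one_le_freqWeight k)) ha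

theorem hasDerivAt_trigSeries {a : ℤ → ℂ} (ha : Summable fun k => freqWeight k * ‖a k‖) (x : ℝ) :
    HasDerivAt (fun y : ℝ => trigSeries a (y : UnitAddCircle))
      (trigSeries (fun k => 2 * Real.pi * Complex.I * k * a k) (x : UnitAddCircle)) x := by
  refine hasDerivAt_tsum (summable_two_pi_I_mul ha)
    (g := fun (k : ℤ) (y : ℝ) => a k * fourier k (y : UnitAddCircle))
    (g' := fun (k : ℤ) (y : ℝ) => 2 * Real.pi * Complex.I * k * a k *
      fourier k (y : UnitAddCircle)) (fun k y => ?_) (fun k y => ?_)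
    (summable_mul_fourier (summable_of_summable_freqWeight ha) ((0 : ℝ) : UnitAddCircle)) x
  · refine ((hasDerivAt_fourier_coe k y).const_mul (a k)).congr_deriv ?_
    ring
  · rw [norm_mul, norm_fourier_apply, mul_one]

/-! ### Expansion of a product of differences -/

/-- This is op(Q), applied in y and evaluated at y = x. In a factor e_k(x) - e_k(y) the first term
leaves the frequency m unchanged and the second shifts it to m + k; on the diagonal both give the
same exponential. Hence each factor takes one difference Q(m) - Q(m + k). -/
theorem hasSum_mul_fourierCoeff_prod_sub (Q : ℤ → ℂ) (x : UnitAddCircle) :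
    ∀ (n : ℕ) (k : Fin n → ℤ) (m : ℤ),
    HasSum (fun ξ => Q ξ * (fourier ξ x * fourierCoeff (fun y : UnitAddCircle =>
      (∏ j, ((fourier (k j) x : ℂ) - fourier (k j) y)) * fourier m y) ξ))
      (finDiff Q n k m * fourier (∑ j, k j + m) x)
  | 0, k, m => by
    have h : ∀ ξ, fourierCoeff (fun y : UnitAddCircle => (∏ j : Fin 0,
        ((fourier (k j) x : ℂ) - fourier (k j) y)) * fourier m y) ξ = if ξ = m then 1 else 0 := by
      intro ξ
      simp only [Finset.univ_eq_empty, Finset.prod_empty, one_mul]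
      have h5 := congrFun (fourierCoeff_fourier (T := 1) m) ξ
      rw [h5]
      by_cases hk : ξ = m
      · subst hk; simp
      · simp [hk]
    simp_rw [h]
    have := hasSum_single (f := fun ξ => Q ξ * (fourier ξ x * if ξ = m then (1:ℂ) else 0)) m
      fun ξ hξ => by simp [hξ]
    simpa [finDiff] using this
  | n + 1, k, m => by
    have h1 := (hasSum_mul_fourierCoeff_prod_sub Q x n (Fin.tail k) m).mul_left
      (fourier (k 0) x : ℂ)
    have h2 := hasSum_mul_fourierCoeff_prod_sub Q x n (Fin.tail k) (m + k 0)
    have hc : ∀ m : ℤ, Continuous fun y : UnitAddCircle => (∏ j, ((fourier (Fin.tail k j) x : ℂ) -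
        fourier (Fin.tail k j) y)) * fourier m y := fun m =>
      (continuous_finsetProd _ fun j _ => continuous_const.sub (fourier _).continuous).mul
        (fourier m).continuous
    have e1 : ∑ j, k j + m = k 0 + (∑ j, Fin.tail k j + m) := by
      rw [Fin.sum_univ_succ]; simp only [Fin.tail]; ring
    have e2 : ∑ j, Fin.tail k j + (m + k 0) = k 0 + (∑ j, Fin.tail k j + m) := by ring
    have e3 : finDiff Q (n + 1) k m * fourier (∑ j, k j + m) x =
        (fourier (k 0) x : ℂ) * (finDiff Q n (Fin.tail k) m * fourier (∑ j, Fin.tail k j + m) x) -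
        finDiff Q n (Fin.tail k) (m + k 0) * fourier (∑ j, Fin.tail k j + (m + k 0)) x := by
      rw [e1, e2, fourier_add, finDiff]
      ring
    rw [e3]
    refine (h1.sub h2).of_eq fun ξ => ?_
    have e : (fun y : UnitAddCircle => (∏ j, ((fourier (k j) x : ℂ) - fourier (k j) y)) *
        fourier m y) = fun y => (fourier (k 0) x : ℂ) * ((∏ j,
          ((fourier (Fin.tail k j) x : ℂ) - fourier (Fin.tail k j) y)) * fourier m y) -
        (∏ j, ((fourier (Fin.tail k j) x : ℂ) -
          fourier (Fin.tail k j) y)) * fourier (m + k 0) y := by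
      funext y
      rw [Fin.prod_univ_succ, fourier_add]
      simp only [Fin.tail]
      ring
    have hm : Continuous fun y : UnitAddCircle => (fourier (k 0) x : ℂ) * ((∏ j,
        ((fourier (Fin.tail k j) x : ℂ) - fourier (Fin.tail k j) y)) * fourier m y) :=
      continuous_const.mul (hc m)
    rw [e, fourierCoeff_sub_of_continuous hm (hc (m + k 0)),
      fourierCoeff.const_mul]
    ring

theorem hasSum_prod_sub_mul {n : ℕ} {b : Fin (n + 1) → ℤ → ℂ} (x y : UnitAddCircle)
    (hb : ∀ j, Summable fun k => freqWeight k * ‖b j k‖) :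
    HasSum (fun κ : Fin (n + 1) → ℤ => (∏ j, b j (κ j)) *
      (2 * Real.pi * Complex.I * κ (Fin.last n) *
        ((∏ j : Fin n, ((fourier (Fin.init κ j) x : ℂ) - fourier (Fin.init κ j) y)) *
          fourier (κ (Fin.last n)) y)))
      ((∏ j : Fin n, (trigSeries (b j.castSucc) x - trigSeries (b j.castSucc) y)) *
        trigSeries (fun k => 2 * Real.pi * Complex.I * k * b (Fin.last n) k) y) := by
  -- The product of n + 1 series is expanded: differences of the series of the first n functions,
  -- and the derivative series of the last.
  let f : Fin (n + 1) → ℤ → ℂ := fun j k => Fin.lastCases (motive := fun _ => ℂ)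
    (2 * Real.pi * Complex.I * k * b (Fin.last n) k * fourier k y)
    (fun j => b j.castSucc k * ((fourier k x : ℂ) - fourier k y)) j
  let g : Fin (n + 1) → ℂ := fun j => Fin.lastCases (motive := fun _ => ℂ)
    (trigSeries (fun k => 2 * Real.pi * Complex.I * k * b (Fin.last n) k) y)
    (fun j => trigSeries (b j.castSucc) x - trigSeries (b j.castSucc) y) j
  have hf : ∀ j, Summable fun k => ‖f j k‖ := by
    intro j
    induction j using Fin.lastCases with
    | last =>
      simp only [f, Fin.lastCases_last]
      simpa only [norm_mul _ (fourier _ _ : ℂ), norm_fourier_apply, mul_one] using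
        summable_two_pi_I_mul (hb (Fin.last n))
    | cast j =>
      simp only [f, Fin.lastCases_castSucc]
      refine Summable.of_nonneg_of_le (fun _ => norm_nonneg _) (fun k => ?_)
        ((summable_of_summable_freqWeight (hb j.castSucc)).mul_right 2)
      rw [norm_mul]
      refine mul_le_mul_of_nonneg_left ((norm_sub_le _ _).trans ?_) (norm_nonneg _)
      rw [norm_fourier_apply, norm_fourier_apply]; norm_num
  have hg : ∀ j, HasSum (f j) (g j) := by
    intro j
    induction j using Fin.lastCases with
    | last =>
      simp only [f, g, Fin.lastCases_last]
      exact (summable_mul_fourier (summable_two_pi_I_mul (hb (Fin.last n))) y).hasSum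
    | cast j =>
      simp only [f, g, Fin.lastCases_castSucc, mul_sub]
      have := summable_of_summable_freqWeight (hb j.castSucc)
      exact (summable_mul_fourier this x).hasSum.sub (summable_mul_fourier this y).hasSum
  have h := hasSum_pi_prod hf hg
  convert h using 1
  · funext κ
    rw [Fin.prod_univ_castSucc, Fin.prod_univ_castSucc]
    simp only [Fin.init, f, Fin.lastCases_last, Fin.lastCases_castSucc, Finset.prod_mul_distrib]
    ring
  · rw [Fin.prod_univ_castSucc]
    simp only [g, Fin.lastCases_last, Fin.lastCases_castSucc]

theorem summable_prod_mul_freq {n : ℕ} {b : Fin (n + 1) → ℤ → ℂ}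
    (hb : ∀ j, Summable fun k => freqWeight k * ‖b j k‖) :
    Summable fun κ : Fin (n + 1) → ℤ =>
      ‖(∏ j, b j (κ j)) * (2 * Real.pi * Complex.I * κ (Fin.last n))‖ := by
  have h1 := (summable_norm_and_tsum_pi_prod (n + 1)
    (fun j k => ((freqWeight k : ℝ) : ℂ) * b j k) (fun j => by
      simpa [Complex.norm_real, abs_of_pos (freqWeight_pos _)] using hb j)).1
  refine Summable.of_nonneg_of_le (fun _ => norm_nonneg _) (fun κ => ?_)
    (h1.mul_left (2 * Real.pi))
  rw [mul_comm]
  refine (norm_two_pi_I_mul_le _ _).trans (mul_le_mul_of_nonneg_left ?_ (by positivity))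
  rw [norm_prod, norm_prod, Fin.prod_univ_castSucc, Fin.prod_univ_castSucc, mul_left_comm]
  simp only [norm_mul, Complex.norm_real, Real.norm_eq_abs, abs_of_pos (freqWeight_pos _)]
  refine mul_le_mul_of_nonneg_right ?_ (mul_nonneg (freqWeight_pos _).le (norm_nonneg _))
  exact Finset.prod_le_prod (fun _ _ => norm_nonneg _) fun _ _ =>
    le_mul_of_one_le_left (norm_nonneg _) (one_le_freqWeight _)

theorem norm_prod_sub_fourier_le {n : ℕ} (k : Fin n → ℤ) (m : ℤ) (x y : UnitAddCircle) :
    ‖(∏ j, ((fourier (k j) x : ℂ) - fourier (k j) y)) * fourier m y‖ ≤ 2 ^ n := by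
  rw [norm_mul, norm_fourier_apply, mul_one, norm_prod]
  refine (Finset.prod_le_prod (fun _ _ => norm_nonneg _) (fun _ _ => ?_)).trans
    (le_of_eq (by simp : ∏ _ : Fin n, (2 : ℝ) = 2 ^ n))
  refine (norm_sub_le _ _).trans ?_
  rw [norm_fourier_apply, norm_fourier_apply]; norm_num

theorem continuous_prod_sub_fourier {n : ℕ} (k : Fin n → ℤ) (m : ℤ) (x : UnitAddCircle) :
    Continuous fun y : UnitAddCircle =>
      (∏ j, ((fourier (k j) x : ℂ) - fourier (k j) y)) * fourier m y :=
  (continuous_finsetProd _ fun _ _ => continuous_const.sub (fourier _).continuous).mul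
    (fourier _).continuous

/-- The function whose Fourier coefficients occur in the `n`-th Taylor term. -/
noncomputable def diffProd {n : ℕ} (b : Fin (n + 1) → ℤ → ℂ) (x y : UnitAddCircle) : ℂ :=
  (∏ j : Fin n, (trigSeries (b j.castSucc) x - trigSeries (b j.castSucc) y)) *
    trigSeries (fun k => 2 * Real.pi * Complex.I * k * b (Fin.last n) k) y

theorem hasSum_fourierCoeff_diffProd {n : ℕ} {b : Fin (n + 1) → ℤ → ℂ}
    (hb : ∀ j, Summable fun k => freqWeight k * ‖b j k‖) (x : UnitAddCircle) (ξ : ℤ) :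
    HasSum (fun κ : Fin (n + 1) → ℤ =>
      (∏ j, b j (κ j)) * (2 * Real.pi * Complex.I * κ (Fin.last n)) *
        fourierCoeff (fun y : UnitAddCircle => (∏ j, ((fourier (Fin.init κ j) x : ℂ) -
          fourier (Fin.init κ j) y)) * fourier (κ (Fin.last n)) y) ξ)
      (fourierCoeff (diffProd b x) ξ) := by
  have := hasSum_fourierCoeff_of_hasSum (G := diffProd b x)
    (F := fun (κ : Fin (n + 1) → ℤ) (y : UnitAddCircle) =>
      (∏ j, b j (κ j)) * (2 * Real.pi * Complex.I * κ (Fin.last n)) *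
        ((∏ j, ((fourier (Fin.init κ j) x : ℂ) -
          fourier (Fin.init κ j) y)) * fourier (κ (Fin.last n)) y))
    (fun κ => continuous_const.mul
      (continuous_prod_sub_fourier (Fin.init κ) (κ (Fin.last n)) x))
    ((summable_prod_mul_freq hb).mul_right (2 ^ n)) (fun κ y => by
      rw [norm_mul]
      exact mul_le_mul_of_nonneg_left (norm_prod_sub_fourier_le (Fin.init κ) _ x y)
        (norm_nonneg _))
    (fun y => by
      simp only [mul_assoc (∏ j, b j _)]
      exact hasSum_prod_sub_mul x y hb) ξ
  simpa only [fourierCoeff.const_mul] using this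

/-- The sum over all `ξ` of the `(n+1)`-st Taylor terms is a sum over multi-indices. -/
theorem hasSum_conjTerm_mul_fourier {p : ℂ → ℂ} {n : ℕ} {b : Fin (n + 2) → ℤ → ℂ}
    (hp : Summable fun ξ : ℤ => ‖(ξ : ℂ) ^ n * p ξ‖)
    (hb : ∀ j, Summable fun k => freqWeight k * ‖b j k‖) (x : UnitAddCircle) :
    HasSum (fun κ => conjTerm p (n + 1) b κ * fourier (∑ j, κ j) x)
      (∑' ξ : ℤ, p ξ * (2 * Real.pi * Complex.I * ξ) ^ n / (n + 1).factorial *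
        (fourier ξ x * fourierCoeff (diffProd b x) ξ)) := by
  have hAs := summable_prod_mul_freq hb
  have hcs : Summable fun ξ : ℤ =>
      ‖p ξ * (2 * Real.pi * Complex.I * ξ) ^ n / (n + 1).factorial‖ := by
    refine (hp.mul_left (‖(2 * Real.pi * Complex.I : ℂ) ^ n‖ / (n + 1).factorial)).congr
      fun ξ => ?_
    rw [norm_div, norm_mul, mul_pow _ (ξ : ℂ), norm_mul, norm_mul, Complex.norm_natCast]
    ring
  -- The Fourier coefficients of the products of differences are at most 2^(n+1), so the double
  -- family over `κ` and ξ is absolutely summable. Summing over ξ first gives the finite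
  -- differences; summing over `κ` first gives the coefficients of `diffProd`.
  have hprod : Summable fun z : (Fin (n + 2) → ℤ) × ℤ =>
      (∏ j, b j (z.1 j)) * (2 * Real.pi * Complex.I * z.1 (Fin.last (n + 1))) *
        (p z.2 * (2 * Real.pi * Complex.I * z.2) ^ n / (n + 1).factorial) *
        (fourier z.2 x * fourierCoeff (fun y : UnitAddCircle => (∏ j, ((fourier (Fin.init z.1 j) x : ℂ) -
          fourier (Fin.init z.1 j) y)) * fourier (z.1 (Fin.last (n + 1))) y) z.2) := by
    refine Summable.of_norm_bounded ((hAs.mul_norm hcs).mul_right (2 ^ (n + 1))) fun z => ?_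
    rw [norm_mul, norm_mul (fourier _ _ : ℂ), norm_fourier_apply, one_mul]
    exact mul_le_mul_of_nonneg_left
      (norm_fourierCoeff_le (norm_prod_sub_fourier_le (Fin.init z.1) _ x) z.2) (norm_nonneg _)
  have h2 := hprod.hasSum.prod_fiberwise (g := fun κ =>
    conjTerm p (n + 1) b κ * fourier (∑ j, κ j) x) fun κ => by
      have h := (hasSum_mul_fourierCoeff_prod_sub (fun ξ : ℤ => (ξ : ℂ) ^ n * p ξ) x (n + 1)
        (Fin.init κ) (κ (Fin.last (n + 1)))).mul_left
        ((∏ j, b j (κ j)) * (2 * Real.pi * Complex.I * κ (Fin.last (n + 1))) *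
          ((2 * Real.pi * Complex.I) ^ n / (n + 1).factorial))
      have e : conjTerm p (n + 1) b κ * fourier (∑ j, κ j) x =
          (∏ j, b j (κ j)) * (2 * Real.pi * Complex.I * κ (Fin.last (n + 1))) *
          ((2 * Real.pi * Complex.I) ^ n / (n + 1).factorial) *
          (finDiff (fun ξ : ℤ => (ξ : ℂ) ^ n * p ξ) (n + 1) (Fin.init κ)
            (κ (Fin.last (n + 1))) * fourier (∑ j, Fin.init κ j + κ (Fin.last (n + 1))) x) := by
        rw [conjTerm, conjSymbol, Fin.sum_univ_castSucc]
        simp only [Fin.init, pow_succ]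
        ring
      rw [e]
      refine h.of_eq fun ξ => ?_
      simp only [mul_pow]
      ring
  have h3 := ((Equiv.prodComm _ _).hasSum_iff.2 hprod.hasSum).prod_fiberwise (g := fun ξ : ℤ =>
    p ξ * (2 * Real.pi * Complex.I * ξ) ^ n / (n + 1).factorial *
      (fourier ξ x * fourierCoeff (diffProd b x) ξ)) fun ξ => by
      rw [← mul_assoc]
      refine ((hasSum_fourierCoeff_diffProd hb x ξ).mul_left
        (p ξ * (2 * Real.pi * Complex.I * ξ) ^ n / (n + 1).factorial * fourier ξ x)).of_eq
        fun κ => ?_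
      simp only [Function.comp, Equiv.prodComm_apply, Prod.swap]
      ring
  rw [h3.tsum_eq]
  exact h2

/-! ### Integrals over the circle -/

theorem fourierCoeff_eq_integral (G : UnitAddCircle → ℂ) (n : ℤ) :
    fourierCoeff G n = ∫ x in (0 : ℝ)..1,
      (fourier (-n) (x : UnitAddCircle) : ℂ) * G (x : UnitAddCircle) := by
  rw [fourierCoeff_eq_intervalIntegral G n 0]
  simp

theorem continuous_circle_coe : Continuous fun x : ℝ => (x : UnitAddCircle) :=
  AddCircle.continuous_mk' 1

theorem coe_add_one_circle (x : ℝ) : ((x + 1 : ℝ) : UnitAddCircle) = (x : UnitAddCircle) := by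
  have := AddCircle.coe_period (1 : ℝ)
  rw [AddCircle.coe_add, this, add_zero]

namespace SobolevCircle

variable {σ : ℝ}

theorem summable_freqWeight (hσ : 3 / 2 < σ) (u : SobolevCircle σ) :
    Summable fun k => freqWeight k * ‖circleCoeff u.toCont k‖ := by
  simpa using summable_rpow_mul_of_summable_sq (a := 1) (by linarith) (by linarith) u.summable_sq

theorem trigSeries_coeff (hσ : 1 / 2 < σ) (u : SobolevCircle σ) (x : UnitAddCircle) :
    trigSeries (circleCoeff u.toCont) x = ((u x : ℝ) : ℂ) := (u.hasSum_coeff hσ x).tsum_eq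

/-- The derivative of `u`, meaningful for `u ∈ H^σ` with `σ > 3/2`. -/
noncomputable def deriv (u : SobolevCircle σ) (x : UnitAddCircle) : ℝ :=
  (trigSeries (fun k => 2 * Real.pi * Complex.I * k * circleCoeff u.toCont k) x).re

theorem continuous_deriv (hσ : 3 / 2 < σ) (u : SobolevCircle σ) : Continuous u.deriv :=
  Complex.continuous_re.comp
    (continuous_trigSeries (summable_two_pi_I_mul (u.summable_freqWeight hσ)))

theorem hasDerivAt (hσ : 3 / 2 < σ) (u : SobolevCircle σ) (x : ℝ) :
    HasDerivAt (fun y : ℝ => u (y : UnitAddCircle)) (u.deriv (x : UnitAddCircle)) x := by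
  have h := hasDerivAt_trigSeries (u.summable_freqWeight hσ) x
  have h2 := Complex.reCLM.hasFDerivAt.comp_hasDerivAt x h
  simp_rw [u.trigSeries_coeff (by linarith : 1 / 2 < σ)] at h2
  exact h2

/-- The derivative series is real because it differentiates a real function and derivatives are
unique. -/
theorem ofReal_deriv (hσ : 3 / 2 < σ) (u : SobolevCircle σ) (x : UnitAddCircle) :
    ((u.deriv x : ℝ) : ℂ) =
      trigSeries (fun k => 2 * Real.pi * Complex.I * k * circleCoeff u.toCont k) x := by
  induction x using QuotientAddGroup.induction_on with
  | H x =>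
    have h := hasDerivAt_trigSeries (u.summable_freqWeight hσ) x
    simp_rw [u.trigSeries_coeff (by linarith : 1 / 2 < σ)] at h
    exact (u.hasDerivAt hσ x).ofReal_comp.unique h

theorem abs_deriv_le (hσ : 3 / 2 < σ) (u : SobolevCircle σ) (x : UnitAddCircle) :
    |u.deriv x| ≤ 2 * Real.pi * ∑' k, freqWeight k * ‖circleCoeff u.toCont k‖ := by
  have hs := u.summable_freqWeight hσ
  refine (Complex.abs_re_le_norm _).trans ?_
  rw [trigSeries, ← tsum_mul_left]
  refine tsum_of_norm_bounded (hs.mul_left _).hasSum fun k => ?_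
  rw [norm_mul, norm_fourier_apply, mul_one]
  exact norm_two_pi_I_mul_le k _

/-- The lift `x ↦ x + u(x)` of the circle map with displacement `u`. -/
def lift (u : SobolevCircle σ) (x : ℝ) : ℝ := x + u (x : UnitAddCircle)

theorem hasDerivAt_lift (hσ : 3 / 2 < σ) (u : SobolevCircle σ) (x : ℝ) :
    HasDerivAt u.lift (1 + u.deriv (x : UnitAddCircle)) x :=
  (hasDerivAt_id x).add (u.hasDerivAt hσ x)

theorem lift_add_one (u : SobolevCircle σ) (x : ℝ) : u.lift (x + 1) = u.lift x + 1 := by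
  rw [lift, lift, coe_add_one_circle]; ring

theorem coe_lift (u : SobolevCircle σ) (x : ℝ) :
    ((u.lift x : ℝ) : UnitAddCircle) =
      (x : UnitAddCircle) + ((u (x : UnitAddCircle) : ℝ) : UnitAddCircle) :=
  AddCircle.coe_add 1 _ _

/-- Change of variables for a circle map with displacement `u`. -/
theorem integral_comp_lift (hσ : 3 / 2 < σ) (u : SobolevCircle σ) {G : UnitAddCircle → ℂ}
    (hG : Continuous G) :
    ∫ y in (0 : ℝ)..1, ((1 + u.deriv (y : UnitAddCircle) : ℝ) : ℂ) *
      G ((u.lift y : ℝ) : UnitAddCircle) = ∫ y in (0 : ℝ)..1, G (y : UnitAddCircle) := by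
  have hc : Continuous fun y : ℝ => 1 + u.deriv (y : UnitAddCircle) :=
    continuous_const.add ((u.continuous_deriv hσ).comp continuous_circle_coe)
  have h := intervalIntegral.integral_deriv_smul_comp (a := 0) (b := 1) (f := u.lift)
    (g := fun y : ℝ => G (y : UnitAddCircle)) (fun x _ => u.hasDerivAt_lift hσ x)
    hc.continuousOn (hG.comp continuous_circle_coe)
  -- No injectivity is used: the lift sends [0, 1] to endpoints one period apart, and the integrand
  -- is periodic.
  have h1 := u.lift_add_one 0
  rw [zero_add] at h1
  have hper : Function.Periodic (fun y : ℝ => G (y : UnitAddCircle)) 1 := fun y => by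
    simp only [coe_add_one_circle]
  rw [h1, hper.intervalIntegral_add_eq (u.lift 0) 0, zero_add] at h
  rw [← h]
  simp only [Function.comp, Complex.real_smul]

end SobolevCircle

/-! ### The Taylor expansion of a conjugated multiplier -/

/-- The quotient `(exp (c t) - 1) / c`, continued by `t` to `c = 0`. -/
noncomputable def expQuot (c t : ℂ) : ℂ := if c = 0 then t else (Complex.exp (c * t) - 1) / c

theorem mul_expQuot (c t : ℂ) : c * expQuot c t = Complex.exp (c * t) - 1 := by
  unfold expQuot
  split_ifs with h
  · simp [h]
  · field_simp

theorem hasDerivAt_expQuot (c t : ℂ) : HasDerivAt (expQuot c) (Complex.exp (c * t)) t := by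
  by_cases h : c = 0
  · have e : expQuot c = fun t => t := by funext t; simp [expQuot, h]
    rw [e, h, zero_mul, Complex.exp_zero]
    exact hasDerivAt_id t
  · have e : expQuot c = fun t => (Complex.exp (c * t) - 1) / c := by
      funext t; simp [expQuot, h]
    rw [e]
    have h1 := (((hasDerivAt_id t).const_mul c).cexp.sub_const 1).div_const c
    refine h1.congr_deriv ?_
    simp only [id]
    field_simp

theorem hasSum_expQuot (c t : ℂ) :
    HasSum (fun n : ℕ => c ^ n * t ^ (n + 1) / (n + 1).factorial) (expQuot c t) := by
  by_cases h : c = 0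
  · have := hasSum_single (f := fun n : ℕ => c ^ n * t ^ (n + 1) / (n + 1).factorial) 0
      fun n hn => by simp [h, hn]
    simpa [expQuot, h] using this
  · have h1 := NormedSpace.expSeries_div_hasSum_exp (c * t)
    rw [← Complex.exp_eq_exp_ℂ] at h1
    have h2 := (hasSum_nat_add_iff' 1).2 h1
    simp only [Finset.range_one, Finset.sum_singleton, pow_zero, Nat.factorial_zero,
      Nat.cast_one, div_one] at h2
    have h3 := h2.div_const c
    rw [expQuot, if_neg h]
    refine h3.of_eq fun n => ?_
    rw [mul_pow, pow_succ c]
    field_simp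

theorem fourier_neg_mul_fourier (ξ : ℤ) (x y : ℝ) :
    (fourier ξ (x : UnitAddCircle) : ℂ) * fourier (-ξ) (y : UnitAddCircle) =
      Complex.exp (2 * Real.pi * Complex.I * ξ * (x - y)) := by
  rw [fourier_coe_eq, fourier_coe_eq, ← Complex.exp_add]
  congr 1
  push_cast
  ring

namespace SobolevCircle

variable {σ : ℝ}

/-- A primitive, periodic in y, of the difference between the kernel exp(c(x - y)) and the kernel
pulled back by φ with its Jacobian. Integrating by parts against f moves this difference onto f'. -/
theorem hasDerivAt_exp_mul_expQuot (hσ : 3 / 2 < σ) (u : SobolevCircle σ) (c : ℂ) (x y : ℝ) :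
    HasDerivAt (fun y : ℝ => Complex.exp (c * (x - y)) *
        expQuot c ((u (x : UnitAddCircle) - u (y : UnitAddCircle) : ℝ) : ℂ))
      (Complex.exp (c * (x - y)) - Complex.exp (c * (u.lift x - u.lift y)) *
        ((1 + u.deriv (y : UnitAddCircle) : ℝ) : ℂ)) y := by
  have h1 : HasDerivAt (fun y : ℝ => Complex.exp (c * (x - y)))
      (Complex.exp (c * (x - y)) * (c * -1)) y :=
    (((hasDerivAt_id (y : ℂ)).const_sub (x : ℂ)).const_mul c).cexp.comp_ofReal
  have h2 : HasDerivAt (fun y : ℝ => ((u (x : UnitAddCircle) - u (y : UnitAddCircle) : ℝ) : ℂ))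
      ((-u.deriv (y : UnitAddCircle) : ℝ) : ℂ) y :=
    ((u.hasDerivAt hσ y).const_sub _).ofReal_comp
  have h3 := (hasDerivAt_expQuot c _).comp y h2
  refine (h1.mul h3).congr_deriv ?_
  have e : Complex.exp (c * (u.lift x - u.lift y)) = Complex.exp (c * (x - y)) *
      Complex.exp (c * ((u (x : UnitAddCircle) - u (y : UnitAddCircle) : ℝ) : ℂ)) := by
    rw [← Complex.exp_add]
    congr 1
    simp only [lift]
    push_cast
    ring
  have e2 := mul_expQuot c ((u (x : UnitAddCircle) - u (y : UnitAddCircle) : ℝ) : ℂ)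
  rw [e]
  simp only [Function.comp]
  push_cast at e2 ⊢
  linear_combination (-Complex.exp (c * (x - y))) * e2

/-- The Fourier coefficients of `g` when `g ∘ φ = f`, where `φ` has displacement `u`. -/
theorem fourierCoeff_mul_fourier_lift (hσ : 3 / 2 < σ) (u f : SobolevCircle σ)
    {g : UnitAddCircle → ℂ} (hg : Continuous g)
    (hgf : ∀ y : ℝ, g ((u.lift y : ℝ) : UnitAddCircle) = ((f (y : UnitAddCircle) : ℝ) : ℂ))
    (ξ : ℤ) (x : ℝ) :
    fourierCoeff g ξ * fourier ξ ((u.lift x : ℝ) : UnitAddCircle) =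
      circleCoeff f.toCont ξ * fourier ξ (x : UnitAddCircle) +
      fourier ξ (x : UnitAddCircle) * fourierCoeff (fun y =>
        expQuot (2 * Real.pi * Complex.I * ξ) ((u (x : UnitAddCircle) - u y : ℝ) : ℂ) *
          ((f.deriv y : ℝ) : ℂ)) ξ := by
  set c : ℂ := 2 * Real.pi * Complex.I * ξ with hc
  have hfc : Continuous fun y : ℝ => ((f (y : UnitAddCircle) : ℝ) : ℂ) :=
    Complex.continuous_ofReal.comp (f.toCont.continuous.comp continuous_circle_coe)
  have hfd : Continuous fun y : ℝ => ((f.deriv (y : UnitAddCircle) : ℝ) : ℂ) :=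
    Complex.continuous_ofReal.comp ((f.continuous_deriv hσ).comp continuous_circle_coe)
  have hud : Continuous fun y : ℝ => ((1 + u.deriv (y : UnitAddCircle) : ℝ) : ℂ) :=
    Complex.continuous_ofReal.comp
      (continuous_const.add ((u.continuous_deriv hσ).comp continuous_circle_coe))
  have hul : Continuous fun y : ℝ => ((u.lift y : ℝ) : ℂ) := by
    refine Complex.continuous_ofReal.comp ?_
    exact continuous_id.add (u.toCont.continuous.comp continuous_circle_coe)
  have hE : Continuous fun y : ℝ => Complex.exp (c * (x - y)) := by fun_prop
  have hL : Continuous fun y : ℝ => Complex.exp (c * (u.lift x - u.lift y)) *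
      ((1 + u.deriv (y : UnitAddCircle) : ℝ) : ℂ) := by fun_prop
  have h1 : fourierCoeff g ξ * fourier ξ ((u.lift x : ℝ) : UnitAddCircle) =
      ∫ y in (0 : ℝ)..1, Complex.exp (c * (u.lift x - u.lift y)) *
        ((1 + u.deriv (y : UnitAddCircle) : ℝ) : ℂ) * ((f (y : UnitAddCircle) : ℝ) : ℂ) := by
    rw [fourierCoeff_eq_integral,
      ← u.integral_comp_lift hσ (G := fun y => (fourier (-ξ) y : ℂ) * g y)
        ((fourier (-ξ)).continuous.mul hg), ← intervalIntegral.integral_mul_const]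
    refine intervalIntegral.integral_congr fun y _ => ?_
    simp only [hgf, hc, ← fourier_neg_mul_fourier]
    ring
  have h2 : circleCoeff f.toCont ξ * fourier ξ (x : UnitAddCircle) =
      ∫ y in (0 : ℝ)..1, Complex.exp (c * (x - y)) * ((f (y : UnitAddCircle) : ℝ) : ℂ) := by
    rw [circleCoeff, fourierCoeff_eq_integral, ← intervalIntegral.integral_mul_const]
    refine intervalIntegral.integral_congr fun y _ => ?_
    simp only [hc, ← fourier_neg_mul_fourier]
    change _ * ((f (y : UnitAddCircle) : ℝ) : ℂ) * _ = _
    ring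
  have h3 : fourier ξ (x : UnitAddCircle) * fourierCoeff (fun y =>
        expQuot c ((u (x : UnitAddCircle) - u y : ℝ) : ℂ) * ((f.deriv y : ℝ) : ℂ)) ξ =
      ∫ y in (0 : ℝ)..1, Complex.exp (c * (x - y)) *
        expQuot c ((u (x : UnitAddCircle) - u (y : UnitAddCircle) : ℝ) : ℂ) *
          ((f.deriv (y : UnitAddCircle) : ℝ) : ℂ) := by
    rw [fourierCoeff_eq_integral, ← intervalIntegral.integral_const_mul]
    refine intervalIntegral.integral_congr fun y _ => ?_
    simp only [hc, ← fourier_neg_mul_fourier]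
    ring
  -- The boundary terms at 0 and 1 cancel: exp(c(x - y)) has period 1 in y because c = 2πiξ with ξ
  -- an integer.
  have hibp := intervalIntegral.integral_mul_deriv_eq_deriv_mul (a := 0) (b := 1)
    (fun y _ => u.hasDerivAt_exp_mul_expQuot hσ c x y)
    (fun y _ => (f.hasDerivAt hσ y).ofReal_comp)
    ((hE.sub hL).intervalIntegrable 0 1) (hfd.intervalIntegrable 0 1)
  have hper : Complex.exp (c * (x - (1 : ℝ))) = Complex.exp (c * (x - (0 : ℝ))) := by
    rw [hc, ← fourier_neg_mul_fourier, ← fourier_neg_mul_fourier]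
    congr 2
    have := coe_add_one_circle 0
    rw [zero_add] at this
    rw [this]
  have hper2 : ((1 : ℝ) : UnitAddCircle) = ((0 : ℝ) : UnitAddCircle) := by
    have := coe_add_one_circle 0
    rwa [zero_add] at this
  rw [hper, hper2, sub_self, zero_sub] at hibp
  rw [h1, h2, h3, hibp, ← intervalIntegral.integral_neg, ← intervalIntegral.integral_add]
  · refine intervalIntegral.integral_congr fun y _ => ?_
    ring
  · exact (hE.mul hfc).intervalIntegrable 0 1
  · exact (((hE.sub hL).mul hfc).neg).intervalIntegrable 0 1

/-- The family `(u, …, u, f)` of `n` copies of `u` followed by `f`. -/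
def snocConst (u f : SobolevCircle σ) (n : ℕ) : Fin (n + 1) → SobolevCircle σ :=
  Fin.snoc (α := fun _ => SobolevCircle σ) (fun _ : Fin n => u) f

theorem snocConst_last (u f : SobolevCircle σ) (n : ℕ) : snocConst u f n (Fin.last n) = f := by
  simp [snocConst]

theorem snocConst_castSucc (u f : SobolevCircle σ) (n : ℕ) (j : Fin n) :
    snocConst u f n j.castSucc = u := by
  simp [snocConst]

theorem diffProd_snocConst (hσ : 3 / 2 < σ) (u f : SobolevCircle σ) (n : ℕ)
    (x y : UnitAddCircle) :
    diffProd (coeffs (snocConst u f n)) x y = ((u x - u y : ℝ) : ℂ) ^ n *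
      ((f.deriv y : ℝ) : ℂ) := by
  have hσ' : 1 / 2 < σ := by linarith
  simp only [diffProd, coeffs, snocConst_castSucc, snocConst_last]
  rw [u.trigSeries_coeff hσ', u.trigSeries_coeff hσ', ← f.ofReal_deriv hσ]
  simp

theorem exists_abs_le (u : C(UnitAddCircle, ℝ)) : ∃ C, 0 ≤ C ∧ ∀ x, |u x| ≤ C :=
  ⟨‖u‖, norm_nonneg _, fun x => u.norm_coe_le_norm x⟩

/-- Summed over n, the bound becomes C D exp(‖c‖ C), exponential in |ξ| when c = 2πiξ. The decay
required of the symbol in the expansion is dictated by this. -/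
theorem hasSum_expQuot_coeff (hσ : 3 / 2 < σ) (u f : SobolevCircle σ) (c : ℂ)
    (x : UnitAddCircle) {C D : ℝ} (hC : ∀ y, |u x - u y| ≤ C)
    (hD : ∀ y, |f.deriv y| ≤ D) (ξ : ℤ) :
    HasSum (fun n : ℕ => c ^ n / (n + 1).factorial *
        fourierCoeff (diffProd (coeffs (snocConst u f (n + 1))) x) ξ)
      (fourierCoeff (fun y => expQuot c ((u x - u y : ℝ) : ℂ) * ((f.deriv y : ℝ) : ℂ)) ξ) ∧
    ∀ n : ℕ, ‖c ^ n / (n + 1).factorial *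
        fourierCoeff (diffProd (coeffs (snocConst u f (n + 1))) x) ξ‖ ≤
      C * D * ((‖c‖ * C) ^ n / n.factorial) := by
  have hC0 : 0 ≤ C := (abs_nonneg _).trans (hC x)
  have hD0 : 0 ≤ D := (abs_nonneg _).trans (hD x)
  have hcont : Continuous fun y => ((u x - u y : ℝ) : ℂ) :=
    Complex.continuous_ofReal.comp (continuous_const.sub u.toCont.continuous)
  have hdc : Continuous fun y => ((f.deriv y : ℝ) : ℂ) :=
    Complex.continuous_ofReal.comp (f.continuous_deriv hσ)
  have hb : ∀ (n : ℕ) (y : UnitAddCircle), ‖c ^ n / (n + 1).factorial *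
      (((u x - u y : ℝ) : ℂ) ^ (n + 1) * ((f.deriv y : ℝ) : ℂ))‖ ≤
        C * D * ((‖c‖ * C) ^ n / n.factorial) := by
    intro n y
    rw [norm_mul, norm_mul, norm_div, norm_pow, norm_pow, Complex.norm_natCast,
      Complex.norm_real, Complex.norm_real, Real.norm_eq_abs, Real.norm_eq_abs]
    have hfac : ((n.factorial : ℕ) : ℝ) ≤ (n + 1).factorial := by
      exact_mod_cast Nat.factorial_le (Nat.le_succ n)
    have hpos : (0 : ℝ) < n.factorial := by positivity
    calc _ ≤ ‖c‖ ^ n / n.factorial * (C ^ (n + 1) * D) := by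
          gcongr
          · exact hC y
          · exact hD y
      _ = _ := by rw [mul_pow]; ring
  have hs : Summable fun n : ℕ => C * D * ((‖c‖ * C) ^ n / n.factorial) :=
    (Real.summable_pow_div_factorial _).mul_left _
  have e : ∀ n : ℕ, c ^ n / (n + 1).factorial *
      fourierCoeff (diffProd (coeffs (snocConst u f (n + 1))) x) ξ =
      fourierCoeff (fun y => c ^ n / (n + 1).factorial *
        (((u x - u y : ℝ) : ℂ) ^ (n + 1) * ((f.deriv y : ℝ) : ℂ))) ξ := by
    intro n
    rw [fourierCoeff.const_mul]
    congr 2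
    funext y
    exact diffProd_snocConst hσ u f (n + 1) x y
  refine ⟨?_, fun n => ?_⟩
  · refine (hasSum_fourierCoeff_of_hasSum (F := fun (n : ℕ) y => c ^ n / (n + 1).factorial *
      (((u x - u y : ℝ) : ℂ) ^ (n + 1) * ((f.deriv y : ℝ) : ℂ)))
      (fun n => continuous_const.mul ((hcont.pow _).mul hdc)) hs hb (fun y => ?_) ξ).of_eq e
    refine ((hasSum_expQuot c ((u x - u y : ℝ) : ℂ)).mul_right _).of_eq fun n => ?_
    ring
  · rw [e]
    exact norm_fourierCoeff_le (hb n) ξ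

end SobolevCircle

namespace SobolevCircle

variable {σ : ℝ}

theorem summable_freqWeight_coeffs (hσ : 3 / 2 < σ) {n : ℕ} (u : Fin n → SobolevCircle σ)
    (j : Fin n) : Summable fun k => freqWeight k * ‖coeffs u j k‖ :=
  (u j).summable_freqWeight hσ

theorem summable_mul_pow_div_factorial {p : ℂ → ℂ}
    (hp : ∀ R : ℝ, Summable fun ξ : ℤ => ‖p ξ‖ * Real.exp (R * |(ξ : ℝ)|)) {a b : ℝ}
    (ha : 0 ≤ a) (hb : 0 ≤ b) : Summable fun z : ℤ × ℕ =>
      ‖p z.1‖ * (a * ((b * |(z.1 : ℝ)|) ^ z.2 / z.2.factorial)) := by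
  refine (summable_prod_of_nonneg fun z => by positivity).2 ⟨fun ξ => ?_, ?_⟩
  · have h : Summable fun n : ℕ => ‖p ξ‖ * (a * ((b * |(ξ : ℝ)|) ^ n / n.factorial)) :=
      ((Real.summable_pow_div_factorial _).mul_left _).mul_left _
    exact h
  · have h : ∀ ξ : ℤ, ∑' n : ℕ, ‖p ξ‖ * (a * ((b * |(ξ : ℝ)|) ^ n / n.factorial)) =
        a * (‖p ξ‖ * Real.exp (b * |(ξ : ℝ)|)) := fun ξ => by
      rw [tsum_mul_left, tsum_mul_left]
      have := NormedSpace.expSeries_div_hasSum_exp (𝔸 := ℝ) (b * |(ξ : ℝ)|)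
      rw [this.tsum_eq, ← Real.exp_eq_exp_ℝ]
      ring
    exact ((hp b).mul_left a).congr fun ξ => (h ξ).symm

theorem summable_pow_mul_of_exp {p : ℂ → ℂ}
    (hp : ∀ R : ℝ, Summable fun ξ : ℤ => ‖p ξ‖ * Real.exp (R * |(ξ : ℝ)|)) (n : ℕ) :
    Summable fun ξ : ℤ => ‖(ξ : ℂ) ^ n * p ξ‖ := by
  refine Summable.of_nonneg_of_le (fun _ => norm_nonneg _) (fun ξ => ?_)
    ((hp 1).mul_left (n.factorial : ℝ))
  rw [norm_mul, norm_pow, Complex.norm_intCast, one_mul]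
  have h1 := Real.pow_div_factorial_le_exp |(ξ : ℝ)| (abs_nonneg _) n
  rw [div_le_iff₀ (by positivity)] at h1
  calc _ ≤ (Real.exp |(ξ : ℝ)| * n.factorial) * ‖p ξ‖ := by gcongr
    _ = _ := by ring

theorem tsum_conjTerm_zero (p : ℂ → ℂ) (u f : SobolevCircle σ) (x : UnitAddCircle) :
    ∑' κ : Fin 1 → ℤ, conjTerm p 0 (coeffs (snocConst u f 0)) κ * fourier (∑ j, κ j) x =
      ∑' ξ : ℤ, p ξ * (circleCoeff f.toCont ξ * fourier ξ x) := by
  rw [← (Equiv.funUnique (Fin 1) ℤ).symm.tsum_eq]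
  refine tsum_congr fun ξ => ?_
  have : snocConst u f 0 0 = f := snocConst_last u f 0
  simp only [conjTerm, conjSymbol, coeffs]
  simp only [Fin.prod_univ_succ, Fin.sum_univ_succ, Fin.prod_univ_zero, Fin.sum_univ_zero,
    mul_one, add_zero, this]
  simp only [Equiv.funUnique_symm_apply, uniqueElim_const, mul_assoc]

/-- Taylor expansion of `R_φ op(p) R_φ⁻¹ f` at the point `x`, for a symbol decaying faster than any
exponential; here `φ` has displacement `u` and `g = f ∘ φ⁻¹`. -/
theorem hasSum_conj_expansion (hσ : 3 / 2 < σ) (u f : SobolevCircle σ)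
    {g : UnitAddCircle → ℂ} (hg : Continuous g)
    (hgf : ∀ y : ℝ, g ((u.lift y : ℝ) : UnitAddCircle) = ((f (y : UnitAddCircle) : ℝ) : ℂ))
    {p : ℂ → ℂ} (hp : ∀ R : ℝ, Summable fun ξ : ℤ => ‖p ξ‖ * Real.exp (R * |(ξ : ℝ)|))
    (x : ℝ) :
    HasSum (fun n : ℕ => ∑' κ, conjTerm p n (coeffs (snocConst u f n)) κ *
        fourier (∑ j, κ j) (x : UnitAddCircle))
      (∑' ξ : ℤ, p ξ * fourierCoeff g ξ * fourier ξ ((u.lift x : ℝ) : UnitAddCircle)) := by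
  obtain ⟨U, hU0, hU⟩ := exists_abs_le u.toCont
  obtain ⟨D, hD0, hD⟩ := exists_abs_le ⟨f.deriv, f.continuous_deriv hσ⟩
  have hC : ∀ y, |u (x : UnitAddCircle) - u y| ≤ 2 * U := fun y =>
    (abs_sub _ _).trans (by linarith [hU (x : UnitAddCircle), hU y])
  have hc : ∀ ξ : ℤ, ‖(2 * Real.pi * Complex.I * ξ : ℂ)‖ = 2 * Real.pi * |(ξ : ℝ)| := fun ξ => by
    simp [abs_of_pos Real.pi_pos]
  have hps : Summable fun ξ : ℤ => ‖p ξ‖ := by simpa using hp 0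
  have hfs := f.summable_coeff (by linarith : 1 / 2 < σ)
  have hXY := fun ξ : ℤ =>
    hasSum_expQuot_coeff hσ u f (2 * Real.pi * Complex.I * ξ) (x : UnitAddCircle) hC hD ξ
  -- Absolute summability over (ξ, n) allows the sum over ξ of exponential series to be rearranged
  -- as a series in the degree n of u.
  have hprod : Summable fun z : ℤ × ℕ =>
      p z.1 * fourier z.1 (x : UnitAddCircle) *
        ((2 * Real.pi * Complex.I * z.1) ^ z.2 / (z.2 + 1).factorial *
        fourierCoeff (diffProd (coeffs (snocConst u f (z.2 + 1))) (x : UnitAddCircle)) z.1) := by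
    refine Summable.of_norm_bounded (summable_mul_pow_div_factorial hp
      (a := 2 * U * D) (b := 2 * Real.pi * (2 * U)) (by positivity) (by positivity)) fun z => ?_
    rw [norm_mul, norm_mul (p _), norm_fourier_apply, mul_one]
    refine mul_le_mul_of_nonneg_left (((hXY z.1).2 z.2).trans (le_of_eq ?_)) (norm_nonneg _)
    rw [hc]
    congr 3
    ring
  have hA : Summable fun ξ : ℤ => p ξ * (circleCoeff f.toCont ξ * fourier ξ (x : UnitAddCircle)) := by
    refine Summable.of_norm_bounded (g := fun ξ : ℤ => ‖p ξ‖ * ∑' k, ‖circleCoeff f.toCont k‖)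
      (hps.mul_right _) fun ξ => ?_
    rw [norm_mul, norm_mul, norm_fourier_apply, mul_one]
    exact mul_le_mul_of_nonneg_left (hfs.le_tsum ξ fun _ _ => norm_nonneg _) (norm_nonneg _)
  have h1 := hprod.hasSum.prod_fiberwise fun ξ =>
    (hXY ξ).1.mul_left (p ξ * fourier ξ (x : UnitAddCircle))
  have h2 : ∑' ξ : ℤ, p ξ * fourierCoeff g ξ * fourier ξ ((u.lift x : ℝ) : UnitAddCircle) =
      ∑' ξ : ℤ, p ξ * (circleCoeff f.toCont ξ * fourier ξ (x : UnitAddCircle)) +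
        ∑' z : ℤ × ℕ, p z.1 * fourier z.1 (x : UnitAddCircle) *
        ((2 * Real.pi * Complex.I * z.1) ^ z.2 / (z.2 + 1).factorial *
        fourierCoeff (diffProd (coeffs (snocConst u f (z.2 + 1))) (x : UnitAddCircle)) z.1) := by
    rw [← h1.tsum_eq, ← hA.tsum_add h1.summable]
    refine tsum_congr fun ξ => ?_
    rw [mul_assoc, u.fourierCoeff_mul_fourier_lift hσ f hg hgf ξ x]
    ring
  have h3 := ((Equiv.prodComm ℕ ℤ).hasSum_iff.2 hprod.hasSum).prod_fiberwise (g := fun n : ℕ =>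
    ∑' κ, conjTerm p (n + 1) (coeffs (snocConst u f (n + 1))) κ *
        fourier (∑ j, κ j) (x : UnitAddCircle)) fun n => by
      have h4 := hasSum_conjTerm_mul_fourier (p := p) (n := n) (summable_pow_mul_of_exp hp n)
        (summable_freqWeight_coeffs hσ (snocConst u f (n + 1))) (x : UnitAddCircle)
      rw [h4.tsum_eq]
      have h5 := hprod.comp_injective (i := fun ξ : ℤ => (ξ, n)) fun a b hab => by
        simpa using hab
      have h6 : ∀ ξ : ℤ, p ξ * (2 * Real.pi * Complex.I * ξ) ^ n / (n + 1).factorial *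
          (fourier ξ (x : UnitAddCircle) * fourierCoeff (diffProd (coeffs (snocConst u f (n + 1)))
            (x : UnitAddCircle)) ξ) = p ξ * fourier ξ (x : UnitAddCircle) *
        ((2 * Real.pi * Complex.I * ξ) ^ n / (n + 1).factorial *
        fourierCoeff (diffProd (coeffs (snocConst u f (n + 1))) (x : UnitAddCircle)) ξ) :=
        fun ξ => by ring
      simp_rw [h6]
      exact h5.hasSum
  rw [h2]
  -- The term of degree 0 is op(p) f at x, which comes from the part without `expQuot`; the degrees
  -- n + 1 come from `hprod`.
  refine (hasSum_nat_add_iff' 1).1 ?_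
  rw [Finset.range_one, Finset.sum_singleton, tsum_conjTerm_zero, add_sub_cancel_left]
  exact h3

end SobolevCircle

/-! ### Gaussian regularizations of the symbols `(1 + ξ²)^(r/2)` -/

/-- The symbol `(1 + z²)^(r/2) exp(-ε z²)`. -/
noncomputable def gaussSymbol (r ε : ℝ) (z : ℂ) : ℂ :=
  (1 + z ^ 2) ^ ((r / 2 : ℝ) : ℂ) * Complex.exp (-ε * z ^ 2)

theorem gaussSymbol_intCast (r ε : ℝ) (k : ℤ) : gaussSymbol r ε k =
    (((1 + (k : ℝ) ^ 2) ^ (r / 2) * Real.exp (-ε * (k : ℝ) ^ 2) : ℝ) : ℂ) := by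
  rw [gaussSymbol, Complex.ofReal_mul, Complex.ofReal_cpow (by positivity), Complex.ofReal_exp]
  push_cast
  rfl

theorem differentiableOn_gaussSymbol (r ε : ℝ) :
    DifferentiableOn ℂ (gaussSymbol r ε) {z | 0 < (1 + z ^ 2).re} := by
  intro z hz
  refine DifferentiableAt.differentiableWithinAt ?_
  unfold gaussSymbol
  refine DifferentiableAt.mul ?_ (by fun_prop)
  exact DifferentiableAt.cpow (by fun_prop) (by fun_prop) (Or.inl hz)

theorem norm_gaussSymbol_le {r : ℝ} (hr : 0 ≤ r) (ε : ℝ) {ξ : ℝ} {z : ℂ}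
    (hz : ‖z - ξ‖ ≤ (1 + |ξ|) / 4) :
    ‖gaussSymbol r ε z‖ ≤ 5 ^ (r / 2) * (1 + |ξ|) ^ r * Real.exp (-ε * (z ^ 2).re) := by
  have hξ := abs_nonneg ξ
  rw [gaussSymbol, norm_mul, Complex.norm_cpow_real, Complex.norm_exp]
  have e : (-(ε : ℂ) * z ^ 2).re = -ε * (z ^ 2).re := by
    rw [← Complex.ofReal_neg, Complex.re_ofReal_mul]
  rw [e]
  refine mul_le_mul_of_nonneg_right ?_ (Real.exp_pos _).le
  have h1 : ‖1 + z ^ 2‖ ≤ 5 * (1 + |ξ|) ^ 2 := by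
    have := norm_le_of_near hz
    calc ‖1 + z ^ 2‖ ≤ 1 + ‖z‖ ^ 2 := (norm_add_le _ _).trans (by rw [norm_one, norm_pow])
      _ ≤ 1 + (2 * (1 + |ξ|)) ^ 2 := by gcongr
      _ ≤ _ := by nlinarith
  calc ‖1 + z ^ 2‖ ^ (r / 2) ≤ (5 * (1 + |ξ|) ^ 2) ^ (r / 2) :=
        Real.rpow_le_rpow (norm_nonneg _) h1 (by linarith)
    _ = _ := by
      rw [Real.mul_rpow (by norm_num) (by positivity), ← Real.rpow_natCast,
        ← Real.rpow_mul (by positivity)]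
      congr 2
      push_cast
      ring

/-- On the discs Re z² > -1, so the Gaussian factor is at most e there. The constant does not depend
on ε in [0, 1], which permits the limit ε → 0. -/
theorem symbolBound_gaussSymbol {r ε : ℝ} (hr : 0 ≤ r) (hε0 : 0 ≤ ε) (hε1 : ε ≤ 1) :
    SymbolBound (gaussSymbol r ε) (5 ^ (r / 2) * Real.exp 1) r where
  diff := differentiableOn_gaussSymbol r ε
  bound ξ z hz := by
    refine (norm_gaussSymbol_le hr ε hz).trans ?_
    rw [mul_right_comm]
    have h1 : -ε * (z ^ 2).re ≤ 1 := by
      have h := mem_domain_of_near hz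
      rw [Complex.add_re, Complex.one_re] at h
      nlinarith
    have := abs_nonneg ξ
    gcongr

theorem exists_bound_rpow_mul_exp (r b : ℝ) {ε : ℝ} (hε : 0 < ε) :
    ∃ C, ∀ t : ℝ, 0 ≤ t → (1 + t) ^ r * Real.exp (b * t - ε * t ^ 2) ≤ C := by
  obtain ⟨N, hN⟩ := exists_nat_ge r
  refine ⟨N.factorial * Real.exp (1 + (1 + b) ^ 2 / (4 * ε)), fun t ht => ?_⟩
  have h1 : (1 + t) ^ r ≤ N.factorial * Real.exp (1 + t) := by
    calc (1 + t) ^ r ≤ (1 + t) ^ (N : ℝ) := Real.rpow_le_rpow_of_exponent_le (by linarith) hN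
      _ = (1 + t) ^ N := Real.rpow_natCast _ _
      _ ≤ _ := by
        have := Real.pow_div_factorial_le_exp (1 + t) (by linarith) N
        rw [div_le_iff₀ (by positivity)] at this
        linarith
  calc _ ≤ N.factorial * Real.exp (1 + t) * Real.exp (b * t - ε * t ^ 2) := by gcongr
    _ = N.factorial * Real.exp (1 + ((1 + b) * t - ε * t ^ 2)) := by
      rw [mul_assoc, ← Real.exp_add]; congr 2; ring
    _ ≤ _ := by
      -- Completing the square: (1 + b)t - εt² is at most (1 + b)²/(4ε).
      gcongr
      rw [le_div_iff₀ (by positivity)]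
      nlinarith [sq_nonneg (2 * ε * t - (1 + b))]

/-- For fixed ε > 0 the Gaussian absorbs any power, so the symbol also has order 1, with a constant
depending on ε. At order 1 absolute convergence needs only ∑ (1 + |k|)|û(k)| < ∞, while order σ
would need more than H^σ provides. -/
theorem exists_symbolBound_one_gaussSymbol {r ε : ℝ} (hr : 0 ≤ r) (hε : 0 < ε) :
    ∃ B, SymbolBound (gaussSymbol r ε) B 1 := by
  obtain ⟨C, hC⟩ := exists_bound_rpow_mul_exp r (ε / 2) (half_pos hε)
  have hC0 : 0 ≤ C := (by positivity : (0:ℝ) ≤ _).trans (hC 0 le_rfl)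
  refine ⟨5 ^ (r / 2) * C * Real.exp (ε / 2), differentiableOn_gaussSymbol r ε,
    fun ξ z hz => ?_⟩
  have hξ := abs_nonneg ξ
  refine (norm_gaussSymbol_le hr ε hz).trans ?_
  have h1 := re_sq_ge hz
  have h2 : Real.exp (-ε * (z ^ 2).re) ≤
      Real.exp (ε / 2 * |ξ| - ε / 2 * |ξ| ^ 2) * Real.exp (ε / 2) := by
    rw [← Real.exp_add]
    refine Real.exp_le_exp.2 ?_
    rw [sq_abs]
    nlinarith
  calc _ ≤ 5 ^ (r / 2) * (1 + |ξ|) ^ r *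
        (Real.exp (ε / 2 * |ξ| - ε / 2 * |ξ| ^ 2) * Real.exp (ε / 2)) := by gcongr
    _ = 5 ^ (r / 2) * ((1 + |ξ|) ^ r * Real.exp (ε / 2 * |ξ| - ε / 2 * |ξ| ^ 2)) *
        Real.exp (ε / 2) := by ring
    _ ≤ 5 ^ (r / 2) * C * Real.exp (ε / 2) := by
      gcongr
      exact hC _ hξ
    _ ≤ _ := by
      rw [Real.rpow_one]
      exact le_mul_of_one_le_right (by positivity) (by linarith)

theorem summable_gaussSymbol_mul_exp {r ε : ℝ} (hr : 0 ≤ r) (hε : 0 < ε) (R : ℝ) :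
    Summable fun ξ : ℤ => ‖gaussSymbol r ε ξ‖ * Real.exp (R * |(ξ : ℝ)|) := by
  obtain ⟨C, hC⟩ := exists_bound_rpow_mul_exp (r + 2) R hε
  refine Summable.of_nonneg_of_le (fun _ => by positivity) (fun ξ => ?_)
    ((summable_freqWeight_rpow (p := -2) (by norm_num)).mul_left C)
  have hw := freqWeight_pos ξ
  rw [gaussSymbol_intCast, Complex.norm_real, Real.norm_of_nonneg (by positivity)]
  have h1 := hC |(ξ : ℝ)| (abs_nonneg _)
  change freqWeight ξ ^ (r + 2) * _ ≤ C at h1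
  rw [sq_abs, sub_eq_add_neg, Real.exp_add, Real.rpow_add hw] at h1
  rw [Real.rpow_neg hw.le, ← div_eq_mul_inv, le_div_iff₀ (by positivity)]
  refine le_trans ?_ h1
  calc _ ≤ freqWeight ξ ^ r * Real.exp (-ε * (ξ : ℝ) ^ 2) * Real.exp (R * |(ξ : ℝ)|) *
        freqWeight ξ ^ (2 : ℝ) := by
        gcongr
        exact one_add_sq_rpow_half_le hr ξ
    _ = _ := by rw [neg_mul]; ring

/-! ### Parseval's identity for absolutely convergent series -/

/-- The mean of the conjugate of F times F, with F expanded termwise in the second factor. -/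
theorem parseval_trigSeries {a : ℤ → ℂ} (ha : Summable fun k => ‖a k‖) :
    HasSum (fun k => ‖a k‖ ^ 2)
      (∫ y in (0 : ℝ)..1, ‖trigSeries a (y : UnitAddCircle)‖ ^ 2) := by
  have hc := continuous_trigSeries ha
  have hcc : Continuous fun y => (starRingEnd ℂ) (trigSeries a y) :=
    Complex.continuous_conj.comp hc
  obtain ⟨C, hC⟩ : ∃ C, ∀ y, ‖trigSeries a y‖ ≤ C :=
    ⟨_, (⟨trigSeries a, hc⟩ : C(UnitAddCircle, ℂ)).norm_coe_le_norm⟩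
  have h1 := hasSum_fourierCoeff_of_hasSum
    (F := fun k y => a k * ((starRingEnd ℂ) (trigSeries a y) * fourier k y))
    (G := fun y => (starRingEnd ℂ) (trigSeries a y) * trigSeries a y)
    (b := fun k => ‖a k‖ * C)
    (fun k => continuous_const.mul (hcc.mul (fourier k).continuous)) (ha.mul_right C)
    (fun k y => by
      rw [norm_mul, norm_mul, RCLike.norm_conj, norm_fourier_apply, mul_one]
      exact mul_le_mul_of_nonneg_left (hC y) (norm_nonneg _))
    (fun y => ((summable_mul_fourier ha y).hasSum.mul_left _).of_eq fun k => by ring) 0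
  have h2 : ∀ k, fourierCoeff (fun y : UnitAddCircle =>
      a k * ((starRingEnd ℂ) (trigSeries a y) * fourier k y)) 0 = ((‖a k‖ ^ 2 : ℝ) : ℂ) := by
    intro k
    rw [fourierCoeff.const_mul]
    have h3 := fourierCoeff_conj (trigSeries a) (-k)
    rw [neg_neg, fourierCoeff_trigSeries ha] at h3
    have h4 : fourierCoeff (fun y : UnitAddCircle =>
        (starRingEnd ℂ) (trigSeries a y) * fourier k y) 0 =
        fourierCoeff (fun y => (starRingEnd ℂ) (trigSeries a y)) (-k) := by
      unfold fourierCoeff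
      congr 1
      funext y
      rw [neg_zero, fourier_zero, neg_neg, one_smul, smul_eq_mul, mul_comm]
    rw [h4, h3, Complex.mul_conj, Complex.normSq_eq_norm_sq]
  simp_rw [h2] at h1
  rw [fourierCoeff_eq_integral] at h1
  have h5 : ∀ y : ℝ, (fourier (-0) (y : UnitAddCircle) : ℂ) *
      ((starRingEnd ℂ) (trigSeries a (y : UnitAddCircle)) * trigSeries a (y : UnitAddCircle)) =
      ((‖trigSeries a (y : UnitAddCircle)‖ ^ 2 : ℝ) : ℂ) := fun y => by
    rw [neg_zero, fourier_zero, one_mul, mul_comm, Complex.mul_conj, Complex.normSq_eq_norm_sq]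
  simp_rw [h5] at h1
  rw [intervalIntegral.integral_ofReal] at h1
  exact_mod_cast h1

/-! ### Summation of the expansion -/

theorem summable_half_pow_mul_rpow (t : ℝ) :
    Summable fun n : ℕ => (1 / 2 : ℝ) ^ n * ((n + 1 : ℕ) : ℝ) ^ t := by
  obtain ⟨N, hN⟩ := exists_nat_ge t
  have h := (summable_nat_add_iff 1).2
    (summable_pow_mul_geometric_of_norm_lt_one (R := ℝ) N (r := 1 / 2) (by norm_num))
  refine Summable.of_nonneg_of_le (fun n => by positivity) (fun n => ?_) (h.mul_left 2)
  have h1 : ((n + 1 : ℕ) : ℝ) ^ t ≤ ((n + 1 : ℕ) : ℝ) ^ N := by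
    rw [← Real.rpow_natCast]
    exact Real.rpow_le_rpow_of_exponent_le (by exact_mod_cast Nat.le_add_left 1 n) hN
  calc _ ≤ (1 / 2 : ℝ) ^ n * ((n + 1 : ℕ) : ℝ) ^ N := by gcongr
    _ = _ := by rw [pow_succ]; ring

/-- The origin of 1/128: against the growth 64^n of the symbols it leaves the geometric factor
2^(-n). -/
theorem conjBound_mul_eq (B t L A : ℝ) (n : ℕ) :
    conjBound B t n * ((n + 1 : ℕ) * (L * ((1 / 128) ^ n * A))) =
      2 * B * L * A * ((1 / 2 : ℝ) ^ n * ((n + 1 : ℕ) : ℝ) ^ (t + 1)) := by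
  have h : (1 / 2 : ℝ) ^ n = 64 ^ n * (1 / 128) ^ n := by rw [← mul_pow]; norm_num
  rw [conjBound, Real.rpow_add_one (by positivity), h]
  ring

theorem lp_two_of_summable_norm_le {c : ℕ → ℤ → ℂ} {K : ℕ → ℝ} (hK : Summable K)
    (h : ∀ n, ∃ hf : Memℓp (c n) 2, ‖(⟨_, hf⟩ : lp (fun _ : ℤ => ℂ) 2)‖ ≤ K n) :
    (Summable fun l => ‖∑' n, c n l‖ ^ 2) ∧ ∑' l, ‖∑' n, c n l‖ ^ 2 ≤ (∑' n, K n) ^ 2 := by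
  choose hf hn using h
  let a : ℕ → lp (fun _ : ℤ => ℂ) 2 := fun n => ⟨c n, hf n⟩
  have ha : Summable a := Summable.of_norm_bounded hK hn
  have h1 : ∀ l : ℤ, (∑' n, a n) l = ∑' n, c n l := fun l => by
    let ev : lp (fun _ : ℤ => ℂ) 2 →L[ℂ] ℂ := LinearMap.mkContinuous
      { toFun := fun b => b l, map_add' := fun _ _ => rfl, map_smul' := fun _ _ => rfl } 1
      fun b => by rw [one_mul]; exact lp.norm_apply_le_norm two_ne_zero b l
    exact ev.map_tsum ha
  have h2 : ‖∑' n, a n‖ ≤ ∑' n, K n := tsum_of_norm_bounded hK.hasSum hn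
  have h3 := SobolevCircle.lp_two_norm_sq (∑' n, a n)
  have h4 := (memℓp_gen_iff (by norm_num)).1 (lp.memℓp (∑' n, a n))
  simp_rw [h1] at h3 h4
  refine ⟨by simpa using h4, ?_⟩
  rw [← h3]
  exact pow_le_pow_left₀ (norm_nonneg _) h2 2

/-- Fubini over the degree, the output frequency and the multi-index, all dominated by the summable
`K`. -/
theorem trigSeries_tsum_conjCoeff {p : ℂ → ℂ} {b : (n : ℕ) → Fin (n + 1) → ℤ → ℂ} {K : ℕ → ℝ}
    (hK0 : ∀ n, 0 ≤ K n) (hK : Summable K)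
    (h : ∀ n, ∑' κ, ‖conjTerm p n (b n) κ‖ₑ ≤ ENNReal.ofReal (K n)) :
    (Summable fun l => ‖∑' n, conjCoeff p n (b n) l‖) ∧ ∀ x : UnitAddCircle,
      trigSeries (fun l => ∑' n, conjCoeff p n (b n) l) x =
        ∑' n, ∑' κ, conjTerm p n (b n) κ * fourier (∑ j, κ j) x := by
  have h1 : ∀ n, Summable fun κ => ‖conjTerm p n (b n) κ‖ := fun n =>
    summable_of_tsum_enorm_ne_top (ne_top_of_le_ne_top ENNReal.ofReal_ne_top (h n))
  have h2 : ∑' n : ℕ, ∑' l : ℤ, ‖conjCoeff p n (b n) l‖ₑ ≠ ⊤ := by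
    refine ne_top_of_le_ne_top (b := ∑' n, ENNReal.ofReal (K n)) ?_
      (ENNReal.tsum_le_tsum fun n => ?_)
    · rw [← ENNReal.ofReal_tsum_of_nonneg hK0 hK]
      exact ENNReal.ofReal_ne_top
    · refine le_trans (ENNReal.tsum_le_tsum fun l => enorm_conjCoeff_le p n (b n) l) ?_
      rw [ENNReal.tsum_comm]
      simp_rw [tsum_ite_eq' _ (fun _ => ‖conjTerm p n (b n) _‖ₑ)]
      exact h n
  constructor
  · refine summable_of_tsum_enorm_ne_top ?_
    rw [ENNReal.tsum_comm] at h2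
    exact ne_top_of_le_ne_top h2 (ENNReal.tsum_le_tsum fun l => enorm_tsum_le_tsum_enorm)
  · intro x
    have h3 : Summable (Function.uncurry fun (n : ℕ) (l : ℤ) =>
        conjCoeff p n (b n) l * fourier l x) := by
      refine (summable_of_tsum_enorm_ne_top ?_).of_norm
      rw [ENNReal.tsum_prod']
      refine ne_top_of_le_ne_top h2 (ENNReal.tsum_le_tsum fun n => ENNReal.tsum_le_tsum fun l => ?_)
      have : ‖(fourier l x : ℂ)‖ₑ = 1 := by
        rw [← ofReal_norm, norm_fourier_apply, ENNReal.ofReal_one]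
      simp only [Function.uncurry, enorm_mul, this, mul_one, le_refl]
    simp_rw [fun n => ((hasSum_conjCoeff_mul_fourier (h1 n)).2 x).symm]
    unfold trigSeries
    simp_rw [← tsum_mul_right]
    exact h3.tsum_comm

/-- The family `(a, …, a, A)` of `n` copies of `a` followed by `A`. -/
def snocReal (a A : ℝ) (n : ℕ) : Fin (n + 1) → ℝ :=
  Fin.snoc (α := fun _ => ℝ) (fun _ : Fin n => a) A

theorem prod_snocReal (a A : ℝ) (n : ℕ) : ∏ i, snocReal a A n i = a ^ n * A := by
  simp [snocReal, Fin.prod_univ_castSucc]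

namespace SobolevCircle

variable {σ : ℝ}

theorem forall_snocConst {Q : SobolevCircle σ → ℝ → Prop} {u f : SobolevCircle σ} {a A : ℝ}
    (hu : Q u a) (hf : Q f A) (n : ℕ) (i : Fin (n + 1)) :
    Q (snocConst u f n i) (snocReal a A n i) := by
  refine Fin.lastCases ?_ (fun j => ?_) i
  · simpa [snocConst, snocReal] using hf
  · simpa [snocConst, snocReal] using hu

/-- `∑ₖ (1 + |k|)^t |û(k)|`, with values in `[0, ∞]`. -/
noncomputable def weightedSum (t : ℝ) (u : SobolevCircle σ) : ℝ≥0∞ :=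
  ∑' k, ENNReal.ofReal (freqWeight k ^ t * ‖circleCoeff u.toCont k‖)

theorem weightedSum_le (hσ : 0 ≤ σ) {t : ℝ} (ht : t + 1 / 2 < σ) (u : SobolevCircle σ) :
    weightedSum t u ≤ ENNReal.ofReal (embedConst σ t * ‖u‖) := u.tsum_weight_le hσ ht

theorem tsum_enorm_conjTerm_snocConst_le {p : ℂ → ℂ} {B r : ℝ} (hp : SymbolBound p B r)
    (hr : 1 ≤ r) {u f : SobolevCircle σ} {a A L : ℝ} (ha : 0 ≤ a) (hA : 0 ≤ A) (hL : 0 ≤ L)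
    (hu : weightedSum 1 u ≤ ENNReal.ofReal a) (hf : weightedSum 1 f ≤ ENNReal.ofReal A)
    (hu' : weightedSum r u ≤ ENNReal.ofReal (L * a))
    (hf' : weightedSum r f ≤ ENNReal.ofReal (L * A)) (n : ℕ) :
    ∑' κ, ‖conjTerm p n (coeffs (snocConst u f n)) κ‖ₑ ≤
      ENNReal.ofReal (conjBound B r n * ((n + 1 : ℕ) * (L * (a ^ n * A)))) := by
  have h := hp.tsum_enorm_conjTerm_le hr n (coeffs (snocConst u f n))
    (fun i => ENNReal.ofReal (snocReal a A n i)) (ENNReal.ofReal L)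
    (fun i => by
      have := forall_snocConst (Q := fun v c => weightedSum 1 v ≤ ENNReal.ofReal c) hu hf n i
      simpa only [weightedSum, Real.rpow_one, coeffs] using this)
    (fun i => by
      rw [← ENNReal.ofReal_mul hL]
      exact forall_snocConst (Q := fun v c => weightedSum r v ≤ ENNReal.ofReal (L * c)) hu' hf' n i)
  have h0 : ∀ i, 0 ≤ snocReal a A n i :=
    forall_snocConst (u := u) (f := f) (Q := fun _ c => 0 ≤ c) ha hA n
  rwa [← ENNReal.ofReal_prod_of_nonneg fun i _ => h0 i, prod_snocReal, ← ENNReal.ofReal_mul hL,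
    ← ENNReal.ofReal_natCast, ← ENNReal.ofReal_mul (by positivity),
    ← ENNReal.ofReal_mul (conjBound_nonneg hp.nonneg _ _)] at h

/-- The case τ = 0, r = σ: all the regularity of the arguments is spent on the symbol and the output
lies in ℓ². Smallness is asked of u in the weak norm `weightedSum 1` only. -/
theorem lp_two_conjCoeff_snocConst {p : ℂ → ℂ} {B : ℝ} (hp : SymbolBound p B σ)
    (hσ : 1 ≤ σ) {u f : SobolevCircle σ} {a A L : ℝ} (ha : 0 ≤ a) (hA : 0 ≤ A) (hL : 0 ≤ L)
    (hu : weightedSum 1 u ≤ ENNReal.ofReal a) (hf : weightedSum 1 f ≤ ENNReal.ofReal A)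
    (hu' : embedConst σ 1 * ‖u‖ ≤ L * a) (hf' : embedConst σ 1 * ‖f‖ ≤ L * A) (n : ℕ) :
    ∃ hf : Memℓp (conjCoeff p n (coeffs (snocConst u f n))) 2,
      ‖(⟨_, hf⟩ : lp (fun _ : ℤ => ℂ) 2)‖ ≤
        conjBound B σ n * ((n + 1 : ℕ) * (L * (a ^ n * A))) := by
  have h0 : ∀ i, 0 ≤ snocReal a A n i :=
    forall_snocConst (u := u) (f := f) (Q := fun _ c => 0 ≤ c) ha hA n
  have h := hp.lp_two_weightedConjCoeff hσ le_rfl n (coeffs (snocConst u f n))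
    (snocReal a A n) L h0 hL
    (fun i => by
      have := forall_snocConst (Q := fun v c => weightedSum 1 v ≤ ENNReal.ofReal c) hu hf n i
      simpa only [weightedSum, Real.rpow_one, coeffs] using this)
    (fun i => by
      rw [add_zero]
      refine ((snocConst u f n i).tsum_weight_sq_le_embed (by linarith) 1).trans ?_
      refine pow_le_pow_left' (ENNReal.ofReal_le_ofReal ?_) 2
      exact forall_snocConst (Q := fun v c => embedConst σ 1 * ‖v‖ ≤ L * c) hu' hf' n i)
  have e : weightedConjCoeff p 0 n (coeffs (snocConst u f n)) =
      conjCoeff p n (coeffs (snocConst u f n)) := by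
    funext l
    simp [weightedConjCoeff]
  rw [e, add_zero, prod_snocReal] at h
  exact h

/-- The expansion of a conjugated multiplier, grouped by frequencies. -/
theorem trigSeries_conj_expansion (hσ : 3 / 2 < σ) {u f : SobolevCircle σ}
    (hu : weightedSum 1 u ≤ ENNReal.ofReal (1 / 128))
    {g : UnitAddCircle → ℂ} (hg : Continuous g)
    (hgf : ∀ y : ℝ, g ((u.lift y : ℝ) : UnitAddCircle) = ((f (y : UnitAddCircle) : ℝ) : ℂ))
    {p : ℂ → ℂ} {B : ℝ} (hB : SymbolBound p B 1)
    (hp : ∀ R : ℝ, Summable fun ξ : ℤ => ‖p ξ‖ * Real.exp (R * |(ξ : ℝ)|)) :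
    (Summable fun l => ‖∑' n, conjCoeff p n (coeffs (snocConst u f n)) l‖) ∧ ∀ x : ℝ,
      trigSeries (fun l => ∑' n, conjCoeff p n (coeffs (snocConst u f n)) l) (x : UnitAddCircle) =
      trigSeries (fun ξ => p ξ * fourierCoeff g ξ) ((u.lift x : ℝ) : UnitAddCircle) := by
  have hA : 0 ≤ embedConst σ 1 * ‖f‖ := mul_nonneg (embedConst_pos σ 1).le (norm_nonneg f)
  have hf : weightedSum 1 f ≤ ENNReal.ofReal (embedConst σ 1 * ‖f‖) :=
    weightedSum_le (by linarith) (by linarith) f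
  have h := trigSeries_tsum_conjCoeff (p := p) (b := fun n => coeffs (snocConst u f n))
    (K := fun n => conjBound B 1 n * ((n + 1 : ℕ) * (1 * ((1 / 128) ^ n *
      (embedConst σ 1 * ‖f‖)))))
    (fun n => by have := conjBound_nonneg hB.nonneg 1 n; positivity)
    (by
      simp_rw [conjBound_mul_eq]
      exact (summable_half_pow_mul_rpow _).mul_left _)
    (fun n => tsum_enorm_conjTerm_snocConst_le hB le_rfl (by norm_num) hA zero_le_one hu hf
      (by rwa [one_mul]) (by rwa [one_mul]) n)
  refine ⟨h.1, fun x => ?_⟩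
  rw [h.2, (hasSum_conj_expansion hσ u f hg hgf hp x).tsum_eq]
  rfl

/-! ### Composition with the inverse of a map of small displacement -/

theorem abs_deriv_le_half (hσ : 3 / 2 < σ) {u : SobolevCircle σ}
    (hu : weightedSum 1 u ≤ ENNReal.ofReal (1 / 128)) (x : UnitAddCircle) :
    |u.deriv x| ≤ 1 / 2 := by
  have hs := u.summable_freqWeight hσ
  have h1 : ∑' k, freqWeight k * ‖circleCoeff u.toCont k‖ ≤ 1 / 128 := by
    rw [← ENNReal.ofReal_le_ofReal_iff (by norm_num), ENNReal.ofReal_tsum_of_nonneg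
      (fun k => mul_nonneg (freqWeight_pos k).le (norm_nonneg _)) hs]
    simpa only [weightedSum, Real.rpow_one] using hu
  have h2 := u.abs_deriv_le hσ x
  have h3 := Real.pi_lt_four
  have h4 := Real.pi_pos
  nlinarith

/-- Parseval's identity and the change of variables `x ↦ x + u(x)`. -/
theorem tsum_sq_le_of_comp_lift (hσ : 3 / 2 < σ) {u : SobolevCircle σ}
    (hu : weightedSum 1 u ≤ ENNReal.ofReal (1 / 128)) {a b : ℤ → ℂ}
    (ha : Summable fun k => ‖a k‖) (hb : Summable fun k => ‖b k‖)
    (h : ∀ x : ℝ, trigSeries b (x : UnitAddCircle) =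
      trigSeries a ((u.lift x : ℝ) : UnitAddCircle)) :
    ∑' k, ‖a k‖ ^ 2 ≤ 2 * ∑' k, ‖b k‖ ^ 2 := by
  have hac := continuous_trigSeries ha
  have hbc := continuous_trigSeries hb
  have h1 := u.integral_comp_lift hσ (G := fun y => ((‖trigSeries a y‖ ^ 2 : ℝ) : ℂ))
    (Complex.continuous_ofReal.comp (hac.norm.pow 2))
  simp_rw [← h, ← Complex.ofReal_mul] at h1
  rw [intervalIntegral.integral_ofReal, intervalIntegral.integral_ofReal] at h1
  have h2 := Complex.ofReal_injective h1
  rw [(parseval_trigSeries ha).tsum_eq, (parseval_trigSeries hb).tsum_eq, ← h2,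
    ← intervalIntegral.integral_const_mul]
  have hb2 : Continuous fun y : ℝ => ‖trigSeries b (y : UnitAddCircle)‖ ^ 2 :=
    ((hbc.comp continuous_circle_coe).norm.pow 2)
  refine intervalIntegral.integral_mono_on zero_le_one
    (Continuous.intervalIntegrable ?_ 0 1) (Continuous.intervalIntegrable ?_ 0 1) fun y _ => ?_
  · exact (continuous_const.add ((u.continuous_deriv hσ).comp continuous_circle_coe)).mul hb2
  · exact continuous_const.mul hb2
  · refine mul_le_mul_of_nonneg_right ?_ (sq_nonneg _)
    -- The Jacobian 1 + u' is at most 3/2, whence the factor 2.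
    have := (abs_le.1 (abs_deriv_le_half hσ hu (y : UnitAddCircle))).2
    linarith

/-- Two bounds of the same symbol are combined: order 1, with a constant depending on ε, justifies
the expansion; order σ, uniformly in ε, gives the estimate. The expansion describes (op(p_ε) g) ∘ φ,
and the change of variables passes to op(p_ε) g. -/
theorem sum_gaussSymbol_sq_le (hσ : 3 / 2 < σ) {u f : SobolevCircle σ}
    (hu : weightedSum 1 u ≤ ENNReal.ofReal (1 / 128))
    {g : UnitAddCircle → ℂ} (hg : Continuous g)
    (hgf : ∀ y : ℝ, g ((u.lift y : ℝ) : UnitAddCircle) = ((f (y : UnitAddCircle) : ℝ) : ℂ))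
    {L : ℝ} (hL : 1 ≤ L) (huL : embedConst σ 1 * ‖u‖ ≤ L * (1 / 128)) {ε : ℝ} (hε : 0 < ε)
    (hε1 : ε ≤ 1) (F : Finset ℤ) :
    ∑ ξ ∈ F, ‖gaussSymbol σ ε ξ * fourierCoeff g ξ‖ ^ 2 ≤
      2 * (∑' n : ℕ, conjBound (5 ^ (σ / 2) * Real.exp 1) σ n * ((n + 1 : ℕ) *
        (L * ((1 / 128) ^ n * (embedConst σ 1 * ‖f‖))))) ^ 2 := by
  have hσ0 : 0 ≤ σ := by linarith
  obtain ⟨B, hB⟩ := exists_symbolBound_one_gaussSymbol hσ0 hε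
  have hp := summable_gaussSymbol_mul_exp hσ0 hε
  obtain ⟨hb, h⟩ := trigSeries_conj_expansion hσ hu hg hgf hB hp
  obtain ⟨D, hD⟩ : ∃ D, ∀ ξ, ‖fourierCoeff g ξ‖ ≤ D := by
    refine ⟨‖(⟨g, hg⟩ : C(UnitAddCircle, ℂ))‖, fun ξ => norm_fourierCoeff_le ?_ ξ⟩
    exact (⟨g, hg⟩ : C(UnitAddCircle, ℂ)).norm_coe_le_norm
  have hps : Summable fun ξ : ℤ => ‖gaussSymbol σ ε ξ‖ := by simpa using hp 0
  have ha : Summable fun ξ : ℤ => ‖gaussSymbol σ ε ξ * fourierCoeff g ξ‖ := by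
    refine Summable.of_nonneg_of_le (fun _ => norm_nonneg _) (fun ξ => ?_) (hps.mul_right D)
    rw [norm_mul]
    exact mul_le_mul_of_nonneg_left (hD ξ) (norm_nonneg _)
  have hA : 0 ≤ embedConst σ 1 * ‖f‖ := mul_nonneg (embedConst_pos σ 1).le (norm_nonneg f)
  have hf : weightedSum 1 f ≤ ENNReal.ofReal (embedConst σ 1 * ‖f‖) :=
    weightedSum_le hσ0 (by linarith) f
  have h1 := lp_two_of_summable_norm_le
    (c := fun n l => conjCoeff (gaussSymbol σ ε) n (coeffs (snocConst u f n)) l)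
    (by
      simp_rw [conjBound_mul_eq]
      exact (summable_half_pow_mul_rpow _).mul_left _)
    (fun n => lp_two_conjCoeff_snocConst (symbolBound_gaussSymbol hσ0 hε.le hε1) (by linarith)
      (by norm_num) hA (by linarith) hu hf huL (le_mul_of_one_le_left hA hL) n)
  refine ((parseval_trigSeries ha).summable.sum_le_tsum F fun _ _ => sq_nonneg _).trans ?_
  refine (tsum_sq_le_of_comp_lift hσ hu ha hb h).trans ?_
  exact mul_le_mul_of_nonneg_left h1.2 (by norm_num)

/-- Letting ε → 0 in finite partial sums gives the H^σ bound of g without assuming beforehand that g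
is in H^σ; only continuity of g is needed. -/
theorem exists_comp_bound (hσ : 3 / 2 < σ) {u : SobolevCircle σ}
    (hu : weightedSum 1 u ≤ ENNReal.ofReal (1 / 128)) :
    ∃ C, ∀ (f : SobolevCircle σ) (g : UnitAddCircle → ℂ), Continuous g →
      (∀ y : ℝ, g ((u.lift y : ℝ) : UnitAddCircle) = ((f (y : UnitAddCircle) : ℝ) : ℂ)) →
      ∀ F : Finset ℤ, ∑ ξ ∈ F, (1 + (ξ : ℝ) ^ 2) ^ σ * ‖fourierCoeff g ξ‖ ^ 2 ≤ C * ‖f‖ ^ 2 := by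
  -- The bound 1 serves for f, the other one for u, whose weak norm is only known to be at most
  -- 1/128. Hence `L` depends on u but not on f.
  set L : ℝ := max 1 (128 * (embedConst σ 1 * ‖u‖)) with hLdef
  have hL : 1 ≤ L := le_max_left _ _
  have huL : embedConst σ 1 * ‖u‖ ≤ L * (1 / 128) := by
    have := le_max_right 1 (128 * (embedConst σ 1 * ‖u‖))
    linarith
  refine ⟨2 * (2 * (5 ^ (σ / 2) * Real.exp 1) * L * embedConst σ 1 *
    ∑' n : ℕ, (1 / 2 : ℝ) ^ n * ((n + 1 : ℕ) : ℝ) ^ (σ + 1)) ^ 2, fun f g hg hgf F => ?_⟩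
  have h := fun (ε : ℝ) (hε : 0 < ε) (hε1 : ε ≤ 1) =>
    sum_gaussSymbol_sq_le hσ hu hg hgf hL huL hε hε1 F
  simp_rw [conjBound_mul_eq] at h
  rw [tsum_mul_left] at h
  have e : 2 * (2 * (5 ^ (σ / 2) * Real.exp 1) * L * (embedConst σ 1 * ‖f‖) *
      ∑' n : ℕ, (1 / 2 : ℝ) ^ n * ((n + 1 : ℕ) : ℝ) ^ (σ + 1)) ^ 2 =
      2 * (2 * (5 ^ (σ / 2) * Real.exp 1) * L * embedConst σ 1 *
    ∑' n : ℕ, (1 / 2 : ℝ) ^ n * ((n + 1 : ℕ) : ℝ) ^ (σ + 1)) ^ 2 * ‖f‖ ^ 2 := by ring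
  rw [e] at h
  have h1 : Filter.Tendsto (fun ε : ℝ => ∑ ξ ∈ F, ‖gaussSymbol σ ε ξ * fourierCoeff g ξ‖ ^ 2)
      (nhdsWithin 0 (Set.Ioi 0))
      (nhds (∑ ξ ∈ F, (1 + (ξ : ℝ) ^ 2) ^ σ * ‖fourierCoeff g ξ‖ ^ 2)) := by
    refine tendsto_finsetSum F fun ξ _ => ?_
    have h2 : Continuous fun ε : ℝ => ‖gaussSymbol σ ε ξ * fourierCoeff g ξ‖ ^ 2 := by
      unfold gaussSymbol
      fun_prop
    have h3 := h2.tendsto 0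
    have h4 : ‖gaussSymbol σ 0 ξ * fourierCoeff g ξ‖ ^ 2 =
        (1 + (ξ : ℝ) ^ 2) ^ σ * ‖fourierCoeff g ξ‖ ^ 2 := by
      have hξ : (0 : ℝ) ≤ 1 + (ξ : ℝ) ^ 2 := by positivity
      rw [gaussSymbol_intCast, norm_mul, mul_pow, Complex.norm_real,
        Real.norm_of_nonneg (by positivity), neg_zero, zero_mul, Real.exp_zero, mul_one,
        ← Real.rpow_natCast, ← Real.rpow_mul hξ]
      norm_num
    rw [h4] at h3
    exact h3.mono_left nhdsWithin_le_nhds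
  refine le_of_tendsto h1 ?_
  filter_upwards [Ioc_mem_nhdsGT (zero_lt_one' ℝ)] with ε hε
  exact h ε hε.1 hε.2

/-- A uniform bound for composition with `ψ` on `H^σ` gives a bounded right translation. -/
theorem exists_clm_comp {ψ : UnitAddCircle → UnitAddCircle} (hψ : Continuous ψ) {C : ℝ}
    (h : ∀ (f : SobolevCircle σ) (F : Finset ℤ), ∑ ξ ∈ F, (1 + (ξ : ℝ) ^ 2) ^ σ *
      ‖circleCoeff (f.toCont.comp ⟨ψ, hψ⟩) ξ‖ ^ 2 ≤ C * ‖f‖ ^ 2) :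
    ∃ T : SobolevCircle σ →L[ℝ] SobolevCircle σ, ∀ f x, T f x = f (ψ x) := by
  have h1 := fun f : SobolevCircle σ =>
    summable_of_sum_le (fun ξ => by positivity) (h f)
  refine ⟨LinearMap.mkContinuous
    { toFun := fun f => mk (f.toCont.comp ⟨ψ, hψ⟩) (h1 f)
      map_add' := fun _ _ => rfl
      map_smul' := fun _ _ => rfl } (Real.sqrt (max C 0)) fun f => ?_, fun f x => rfl⟩
  refine le_of_sq_le_sq ?_ (by positivity)
  rw [mul_pow, Real.sq_sqrt (le_max_right _ _), norm_sq_eq]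
  refine (h1 f).tsum_le_of_sum_le fun F => (h f F).trans ?_
  exact mul_le_mul_of_nonneg_right (le_max_left _ _) (sq_nonneg _)

/-- If `φ` has a small displacement in `H^σ`, composition with `φ⁻¹` is bounded on `H^σ`. -/
theorem exists_clm_comp_symm (hσ : 3 / 2 < σ) {u : SobolevCircle σ}
    (hu : weightedSum 1 u ≤ ENNReal.ofReal (1 / 128)) (φ : UnitAddCircle ≃ₜ UnitAddCircle)
    (hφ : ∀ x, φ x = x + ((u x : ℝ) : UnitAddCircle)) :
    ∃ T : SobolevCircle σ →L[ℝ] SobolevCircle σ, ∀ f x, T f x = f (φ.symm x) := by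
  obtain ⟨C, hC⟩ := exists_comp_bound hσ hu
  refine exists_clm_comp φ.symm.continuous (C := C) fun f F => ?_
  refine hC f (fun y => ((f (φ.symm y) : ℝ) : ℂ))
    (Complex.continuous_ofReal.comp (f.toCont.continuous.comp φ.symm.continuous)) (fun y => ?_) F
  rw [coe_lift, ← hφ, φ.symm_apply_apply]

end SobolevCircle

namespace SobolevCircle

variable {σ : ℝ}

/-! ### Second derivatives -/

theorem circleCoeff_deriv (hσ : 3 / 2 < σ) (u : SobolevCircle σ) (k : ℤ) :
    circleCoeff ⟨u.deriv, u.continuous_deriv hσ⟩ k =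
      2 * Real.pi * Complex.I * k * circleCoeff u.toCont k := by
  rw [circleCoeff]
  simp only [ContinuousMap.coe_mk]
  simp_rw [u.ofReal_deriv hσ]
  exact fourierCoeff_trigSeries (summable_two_pi_I_mul (u.summable_freqWeight hσ)) k

theorem norm_two_pi_I_mul_sq (k : ℤ) (z : ℂ) :
    ‖2 * Real.pi * Complex.I * k * z‖ ^ 2 = 4 * Real.pi ^ 2 * (k : ℝ) ^ 2 * ‖z‖ ^ 2 := by
  have : ‖(2 * Real.pi * Complex.I * k : ℂ)‖ = 2 * Real.pi * |(k : ℝ)| := by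
    simp [abs_of_pos Real.pi_pos]
  rw [norm_mul, this, mul_pow, mul_pow, sq_abs]
  ring

/-- The derivative of `u ∈ H^σ`, as an element of `H^(σ-1)`. -/
noncomputable def derivSobolev (hσ : 3 / 2 < σ) (u : SobolevCircle σ) : SobolevCircle (σ - 1) :=
  mk ⟨u.deriv, u.continuous_deriv hσ⟩ (by
    simp_rw [circleCoeff_deriv hσ u, norm_two_pi_I_mul_sq]
    refine Summable.of_nonneg_of_le (fun k => by positivity) (fun k => ?_)
      (u.summable_sq.mul_left (4 * Real.pi ^ 2))
    have h : (0 : ℝ) < 1 + (k : ℝ) ^ 2 := by positivity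
    have h1 : (1 + (k : ℝ) ^ 2) ^ σ = (1 + (k : ℝ) ^ 2) ^ (σ - 1) * (1 + (k : ℝ) ^ 2) := by
      rw [← Real.rpow_add_one h.ne']; congr 1; ring
    rw [h1]
    have h2 : 0 ≤ (1 + (k : ℝ) ^ 2) ^ (σ - 1) * (4 * Real.pi ^ 2) *
      ‖circleCoeff u.toCont k‖ ^ 2 := by positivity
    nlinarith)

theorem norm_circleCoeff_le (u : SobolevCircle σ) {V : ℝ} (hV : ∀ x, |u x| ≤ V) (k : ℤ) :
    ‖circleCoeff u.toCont k‖ ≤ V :=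
  norm_fourierCoeff_le (fun x => by rw [Complex.norm_real]; exact hV x) k

/-- `∑ₖ (1 + |k|) |û(k)|` is controlled by the suprema of `u` and its second derivative. -/
theorem weightedSum_one_le_of_abs_le (hσ : 5 / 2 < σ) (u : SobolevCircle σ) {V M : ℝ}
    (hV : ∀ x, |u x| ≤ V)
    (hM : ∀ x, |(u.derivSobolev (by linarith : 3 / 2 < σ)).deriv x| ≤ M) :
    weightedSum 1 u ≤ ENNReal.ofReal (∑' k : ℤ, freqWeight k ^ (-2 : ℝ) + V ^ 2 + M ^ 2) := by
  have hσ' : 3 / 2 < σ := by linarith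
  have hσ1 : 3 / 2 < σ - 1 := by linarith
  set d := u.derivSobolev hσ' with hd
  have hdk : ∀ k, circleCoeff d.toCont k = 2 * Real.pi * Complex.I * k * circleCoeff u.toCont k :=
    fun k => circleCoeff_deriv hσ' u k
  have hs := summable_two_pi_I_mul (d.summable_freqWeight hσ1)
  have hpar := parseval_trigSeries hs
  have hint : ∫ y in (0 : ℝ)..1, ‖trigSeries (fun k =>
      2 * Real.pi * Complex.I * k * circleCoeff d.toCont k) (y : UnitAddCircle)‖ ^ 2 ≤ M ^ 2 := by
    have h1 : ∫ y in (0 : ℝ)..1, ‖trigSeries (fun k =>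
      2 * Real.pi * Complex.I * k * circleCoeff d.toCont k) (y : UnitAddCircle)‖ ^ 2 ≤
        ∫ y in (0 : ℝ)..1, M ^ 2 := by
      refine intervalIntegral.integral_mono_on zero_le_one
        (Continuous.intervalIntegrable ?_ 0 1) (Continuous.intervalIntegrable ?_ 0 1)
        fun y _ => ?_
      · exact ((continuous_trigSeries hs).comp continuous_circle_coe).norm.pow 2
      · exact continuous_const
      · rw [← d.ofReal_deriv hσ1, Complex.norm_real]
        exact pow_le_pow_left₀ (norm_nonneg _) (hM _) 2
    simpa using h1
  have h0 := summable_freqWeight_rpow (p := -2) (by norm_num)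
  have hV0 : HasSum (fun k : ℤ => if k = 0 then V ^ 2 else 0) (V ^ 2) := hasSum_ite_eq 0 (V ^ 2)
  -- The zero mode is controlled by the supremum V. The other modes use 1 + |k| ≤ 2|k| and the
  -- coefficients (2πik)² û(k) of the second derivative, whose ℓ² norm is at most M by Parseval.
  have hb : ∀ k : ℤ, freqWeight k * ‖circleCoeff u.toCont k‖ ≤ freqWeight k ^ (-2 : ℝ) +
      (if k = 0 then V ^ 2 else 0) +
      ‖2 * Real.pi * Complex.I * k * circleCoeff d.toCont k‖ ^ 2 := by
    intro k
    have hw := freqWeight_pos k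
    have hw2 : freqWeight k ^ (-2 : ℝ) = (freqWeight k ^ 2)⁻¹ := by
      rw [Real.rpow_neg hw.le]; norm_num
    have h1 : freqWeight k * ‖circleCoeff u.toCont k‖ ≤
        (freqWeight k ^ 2)⁻¹ + freqWeight k ^ 4 * ‖circleCoeff u.toCont k‖ ^ 2 := by
      have h3 : freqWeight k * ‖circleCoeff u.toCont k‖ = (freqWeight k)⁻¹ *
        (freqWeight k ^ 2 * ‖circleCoeff u.toCont k‖) := by field_simp
      have h4 : (freqWeight k ^ 2)⁻¹ = ((freqWeight k)⁻¹) ^ 2 := by rw [inv_pow]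
      rw [h3, h4]
      nlinarith [sq_nonneg ((freqWeight k)⁻¹ - freqWeight k ^ 2 * ‖circleCoeff u.toCont k‖),
        sq_nonneg ((freqWeight k)⁻¹), sq_nonneg (freqWeight k ^ 2 * ‖circleCoeff u.toCont k‖)]
    rw [hw2, norm_two_pi_I_mul_sq, hdk, norm_two_pi_I_mul_sq, add_assoc]
    refine h1.trans (add_le_add le_rfl ?_)
    by_cases hk : k = 0
    · subst hk
      have := pow_le_pow_left₀ (norm_nonneg _) (u.norm_circleCoeff_le hV 0) 2
      simpa [freqWeight] using this
    · rw [if_neg hk, zero_add]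
      have hk1 : (1 : ℝ) ≤ |(k : ℝ)| := by exact_mod_cast Int.one_le_abs hk
      have h2 : freqWeight k ^ 4 ≤ 16 * (k : ℝ) ^ 4 := by
        have : freqWeight k ≤ 2 * |(k : ℝ)| := by unfold freqWeight; linarith
        calc freqWeight k ^ 4 ≤ (2 * |(k : ℝ)|) ^ 4 := pow_le_pow_left₀ hw.le this 4
          _ = _ := by
            rw [mul_pow, show |(k : ℝ)| ^ 4 = (|(k : ℝ)| ^ 2) ^ 2 by ring, sq_abs]; ring
      have h5 : (16 : ℝ) ≤ 4 * Real.pi ^ 2 * (4 * Real.pi ^ 2) := by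
        have := Real.pi_gt_three
        have : (9 : ℝ) ≤ Real.pi ^ 2 := by nlinarith
        nlinarith
      calc _ ≤ 16 * (k : ℝ) ^ 4 * ‖circleCoeff u.toCont k‖ ^ 2 := by gcongr
        _ ≤ 4 * Real.pi ^ 2 * (4 * Real.pi ^ 2) * (k : ℝ) ^ 4 *
            ‖circleCoeff u.toCont k‖ ^ 2 := by gcongr
        _ = _ := by ring
  have hsum := (h0.hasSum.add hV0).add hpar
  have hle := hasSum_le hb (u.summable_freqWeight hσ').hasSum hsum
  rw [weightedSum]
  simp only [Real.rpow_one]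
  rw [← ENNReal.ofReal_tsum_of_nonneg (fun k => mul_nonneg (freqWeight_pos k).le (norm_nonneg _))
    (u.summable_freqWeight hσ')]
  refine ENNReal.ofReal_le_ofReal (hle.trans ?_)
  linarith

/-- Bounds for `w = v ∘ φ⁻¹`, where `φ` has displacement `u`. -/
theorem abs_deriv_deriv_le_of_comp_lift (hσ : 5 / 2 < σ) {u v w : SobolevCircle σ}
    (hw : ∀ x : ℝ, w ((u.lift x : ℝ) : UnitAddCircle) = v (x : UnitAddCircle))
    {δ D E : ℝ} (hδ : 0 < δ) (hu : ∀ x, δ ≤ 1 + u.deriv x) (hv1 : ∀ x, |v.deriv x| ≤ D)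
    (hv2 : ∀ x, |(v.derivSobolev (by linarith : 3 / 2 < σ)).deriv x| ≤ E)
    (hu2 : ∀ x, |(u.derivSobolev (by linarith : 3 / 2 < σ)).deriv x| ≤ E) (x : ℝ) :
    |(w.derivSobolev (by linarith : 3 / 2 < σ)).deriv ((u.lift x : ℝ) : UnitAddCircle)| ≤
      (E + D / δ * E) / δ ^ 2 := by
  have hσ' : 3 / 2 < σ := by linarith
  have hσ1 : 3 / 2 < σ - 1 := by linarith
  -- With φ the lift of u, differentiating w ∘ φ = v once gives w'(φ) φ' = v', and once more w''(φ)
  -- φ'² + w'(φ) u'' = v''.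
  have h1 : ∀ x : ℝ, w.deriv ((u.lift x : ℝ) : UnitAddCircle) *
      (1 + u.deriv (x : UnitAddCircle)) = v.deriv (x : UnitAddCircle) := fun x => by
    have h := (w.hasDerivAt hσ' (u.lift x)).comp x (u.hasDerivAt_lift hσ' x)
    have h' := v.hasDerivAt hσ' x
    refine h.unique ?_
    refine h'.congr_of_eventuallyEq (Filter.Eventually.of_forall fun y => ?_)
    exact hw y
  have h2 : (w.derivSobolev hσ').deriv ((u.lift x : ℝ) : UnitAddCircle) *
      (1 + u.deriv (x : UnitAddCircle)) * (1 + u.deriv (x : UnitAddCircle)) +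
      w.deriv ((u.lift x : ℝ) : UnitAddCircle) *
        (u.derivSobolev hσ').deriv (x : UnitAddCircle) =
      (v.derivSobolev hσ').deriv (x : UnitAddCircle) := by
    have ha := ((w.derivSobolev hσ').hasDerivAt hσ1 (u.lift x)).comp x (u.hasDerivAt_lift hσ' x)
    have hb := ((u.derivSobolev hσ').hasDerivAt hσ1 x).const_add 1
    have hc := (v.derivSobolev hσ').hasDerivAt hσ1 x
    refine (ha.mul hb).unique ?_
    refine hc.congr_of_eventuallyEq (Filter.Eventually.of_forall fun y => ?_)
    exact h1 y
  have h3 := hu (x : UnitAddCircle)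
  have h4 : |w.deriv ((u.lift x : ℝ) : UnitAddCircle)| ≤ D / δ := by
    rw [le_div_iff₀ hδ]
    refine le_trans ?_ (hv1 (x : UnitAddCircle))
    rw [← h1 x, abs_mul, abs_of_pos (hδ.trans_le h3)]
    gcongr
  rw [le_div_iff₀ (by positivity)]
  have h5 : (w.derivSobolev hσ').deriv ((u.lift x : ℝ) : UnitAddCircle) *
      (1 + u.deriv (x : UnitAddCircle)) ^ 2 = (v.derivSobolev hσ').deriv (x : UnitAddCircle) -
      w.deriv ((u.lift x : ℝ) : UnitAddCircle) *
        (u.derivSobolev hσ').deriv (x : UnitAddCircle) := by linarith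
  calc _ ≤ |(w.derivSobolev hσ').deriv ((u.lift x : ℝ) : UnitAddCircle)| *
        (1 + u.deriv (x : UnitAddCircle)) ^ 2 := by gcongr
    _ = |(v.derivSobolev hσ').deriv (x : UnitAddCircle) -
      w.deriv ((u.lift x : ℝ) : UnitAddCircle) *
        (u.derivSobolev hσ').deriv (x : UnitAddCircle)| := by
        rw [← h5, abs_mul, abs_of_nonneg (sq_nonneg (1 + u.deriv (x : UnitAddCircle)))]
    _ ≤ _ := by
        refine (abs_sub _ _).trans ?_
        rw [abs_mul]
        exact add_le_add (hv2 _) (mul_le_mul h4 (hu2 _) (abs_nonneg _) ((abs_nonneg _).trans h4))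

theorem deriv_smul (hσ : 3 / 2 < σ) (t : ℝ) (v : SobolevCircle σ) (x : UnitAddCircle) :
    (t • v).deriv x = t * v.deriv x := by
  induction x using QuotientAddGroup.induction_on with
  | H x => exact ((t • v).hasDerivAt hσ x).unique ((v.hasDerivAt hσ x).const_mul t)

theorem derivSobolev_smul (hσ : 3 / 2 < σ) (t : ℝ) (v : SobolevCircle σ) :
    (t • v).derivSobolev hσ = t • v.derivSobolev hσ :=
  ext_apply fun x => deriv_smul hσ t v x

theorem weightedSum_smul {t : ℝ} (ht : 0 ≤ t) (s : ℝ) (v : SobolevCircle σ) :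
    weightedSum s (t • v) = ENNReal.ofReal t * weightedSum s v := by
  rw [weightedSum, weightedSum, ← ENNReal.tsum_mul_left]
  congr 1
  funext k
  rw [← ENNReal.ofReal_mul ht, toCont_smul, circleCoeff_smul, norm_mul, Complex.norm_real,
    Real.norm_of_nonneg ht]
  congr 1
  ring

/-! ### Circle maps given by a displacement -/

theorem lift_add_intCast (u : SobolevCircle σ) (x : ℝ) (n : ℤ) :
    u.lift (x + n) = u.lift x + n := by
  have h : ((n : ℝ) : UnitAddCircle) = 0 := by
    rw [AddCircle.coe_eq_zero_iff]
    exact ⟨n, by simp⟩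
  rw [lift, lift, AddCircle.coe_add, h, add_zero]
  ring

theorem continuous_lift (u : SobolevCircle σ) : Continuous u.lift :=
  continuous_id.add (u.toCont.continuous.comp continuous_circle_coe)

theorem exists_int_of_coe_eq {x y : ℝ} (h : (x : UnitAddCircle) = (y : UnitAddCircle)) :
    ∃ n : ℤ, x = y + n := by
  have h1 : ((x - y : ℝ) : UnitAddCircle) = 0 := by rw [AddCircle.coe_sub, h, sub_self]
  rw [AddCircle.coe_eq_zero_iff] at h1
  obtain ⟨n, hn⟩ := h1
  refine ⟨n, ?_⟩
  have : (n : ℝ) = x - y := by simpa using hn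
  linarith

/-- The lift is strictly increasing and commutes with integer translations, which gives injectivity
on the circle. Surjectivity follows from the intermediate value theorem, and continuity of the
inverse from compactness. -/
theorem exists_homeomorph (hσ : 3 / 2 < σ) (u : SobolevCircle σ)
    (hu : ∀ x, 0 < 1 + u.deriv x) :
    ∃ φ : UnitAddCircle ≃ₜ UnitAddCircle, ∀ x, φ x = x + ((u x : ℝ) : UnitAddCircle) := by
  have hmono : StrictMono u.lift := strictMono_of_hasDerivAt_pos
    (fun x => u.hasDerivAt_lift hσ x) fun x => hu x
  set ψ : UnitAddCircle → UnitAddCircle := fun x => x + ((u x : ℝ) : UnitAddCircle) with hψ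
  have hψl : ∀ x : ℝ, ψ (x : UnitAddCircle) = ((u.lift x : ℝ) : UnitAddCircle) := fun x =>
    (u.coe_lift x).symm
  have hcont : Continuous ψ :=
    continuous_id.add (continuous_circle_coe.comp u.toCont.continuous)
  have hinj : Function.Injective ψ := by
    intro x y
    induction x using QuotientAddGroup.induction_on with
    | H x =>
    induction y using QuotientAddGroup.induction_on with
    | H y =>
      intro h
      change ψ (x : UnitAddCircle) = ψ (y : UnitAddCircle) at h
      rw [hψl, hψl] at h
      obtain ⟨n, hn⟩ := exists_int_of_coe_eq h
      rw [← lift_add_intCast] at hn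
      have := hmono.injective hn
      rw [this]
      change ((y + n : ℝ) : UnitAddCircle) = (y : UnitAddCircle)
      have h0 : ((n : ℝ) : UnitAddCircle) = 0 := by
        rw [AddCircle.coe_eq_zero_iff]
        exact ⟨n, by simp⟩
      rw [AddCircle.coe_add, h0, add_zero]
  have hsurj : Function.Surjective ψ := by
    intro y
    induction y using QuotientAddGroup.induction_on with
    | H y =>
      obtain ⟨C, hC0, hC⟩ := exists_abs_le u.toCont
      have h1 := intermediate_value_Icc (a := y - C) (b := y + C) (by linarith)
        u.continuous_lift.continuousOn
      have h2 : y ∈ Set.Icc (u.lift (y - C)) (u.lift (y + C)) := by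
        have ha := abs_le.1 (hC ((y - C : ℝ) : UnitAddCircle))
        have hb := abs_le.1 (hC ((y + C : ℝ) : UnitAddCircle))
        constructor <;> unfold lift <;> linarith [ha.2, hb.1]
      obtain ⟨x, -, hx⟩ := h1 h2
      refine ⟨(x : UnitAddCircle), ?_⟩
      rw [hψl, hx]
  refine ⟨Continuous.homeoOfEquivCompactToT2 (f := Equiv.ofBijective ψ ⟨hinj, hsurj⟩) hcont,
    fun x => rfl⟩

theorem exists_lift_eq {u : SobolevCircle σ} {φ : UnitAddCircle ≃ₜ UnitAddCircle}
    (hφ : ∀ x, φ x = x + ((u x : ℝ) : UnitAddCircle)) (y : UnitAddCircle) :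
    ∃ x : ℝ, y = ((u.lift x : ℝ) : UnitAddCircle) := by
  obtain ⟨x, hx⟩ := QuotientAddGroup.mk_surjective (φ.symm y)
  refine ⟨x, ?_⟩
  rw [coe_lift, ← hφ]
  exact ((congrArg φ hx).trans (φ.apply_symm_apply y)).symm

/-- A homeomorphism which is of class `H^σ` with its inverse has positive derivative. -/
theorem one_add_deriv_pos (hσ : 3 / 2 < σ) {u w : SobolevCircle σ}
    {φ : UnitAddCircle ≃ₜ UnitAddCircle} (hφ : ∀ x, φ x = x + ((u x : ℝ) : UnitAddCircle))
    (hφ' : ∀ x, φ.symm x = x + ((w x : ℝ) : UnitAddCircle)) (x : UnitAddCircle) :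
    0 < 1 + u.deriv x := by
  -- The composed lifts differ from the identity by a continuous integer-valued function, which is
  -- locally constant. A zero of 1 + u' would give this function the derivative -1.
  have hint : ∀ x : ℝ, ∃ n : ℤ, w.lift (u.lift x) = x + n := fun x => by
    refine exists_int_of_coe_eq ?_
    rw [coe_lift, ← hφ', coe_lift, ← hφ, φ.symm_apply_apply]
  choose n hn using hint
  have hcont : Continuous fun x => w.lift (u.lift x) - x :=
    (w.continuous_lift.comp u.continuous_lift).sub continuous_id
  have hne : ∀ x : ℝ, 1 + u.deriv (x : UnitAddCircle) ≠ 0 := by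
    intro x h0
    have h1 := ((w.hasDerivAt_lift hσ (u.lift x)).comp x (u.hasDerivAt_lift hσ x)).sub
      (hasDerivAt_id x)
    have h2 : (fun y => w.lift (u.lift y) - y) =ᶠ[nhds x] fun _ => w.lift (u.lift x) - x := by
      have h3 := (hcont.tendsto x).eventually (Metric.ball_mem_nhds _ (zero_lt_one' ℝ))
      filter_upwards [h3] with y hy
      rw [Real.dist_eq, hn, hn, add_sub_cancel_left, add_sub_cancel_left,
        ← Int.cast_sub, ← Int.cast_abs] at hy
      have : |n y - n x| < 1 := by exact_mod_cast hy
      rw [hn, hn, add_sub_cancel_left, add_sub_cancel_left]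
      rw [Int.abs_lt_one_iff] at this
      rw [sub_eq_zero.1 this]
    have h4 := h1.unique ((hasDerivAt_const x _).congr_of_eventuallyEq h2)
    rw [h0] at h4
    norm_num at h4
  -- The lift gains 1 over a period, so its derivative equals 1 somewhere. As it never vanishes, it
  -- is positive everywhere.
  obtain ⟨c, -, hc⟩ := exists_hasDerivAt_eq_slope u.lift
    (fun x => 1 + u.deriv (x : UnitAddCircle)) (zero_lt_one' ℝ) u.continuous_lift.continuousOn
    fun x _ => u.hasDerivAt_lift hσ x
  have h1 := u.lift_add_one 0
  rw [zero_add] at h1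
  rw [h1] at hc
  have hc' : 1 + u.deriv (c : UnitAddCircle) = 1 := by rw [hc]; norm_num
  have hd : Continuous fun x : ℝ => 1 + u.deriv (x : UnitAddCircle) :=
    continuous_const.add ((u.continuous_deriv hσ).comp continuous_circle_coe)
  induction x using QuotientAddGroup.induction_on with
  | H x =>
    by_contra hx
    obtain ⟨z, hz⟩ := mem_range_of_exists_le_of_exists_ge hd ⟨x, not_lt.1 hx⟩
      ⟨c, by rw [hc']; norm_num⟩
    exact hne z hz

end SobolevCircle

/-! ### Right translations by arbitrary diffeomorphisms -/

namespace SobolevCircle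

variable {σ q : ℝ}

/-- The inclusion of `H^q` in `H^σ` for `σ ≤ q`. -/
def restrict (h : σ ≤ q) (u : SobolevCircle q) : SobolevCircle σ :=
  mk u.toCont (by
    refine Summable.of_nonneg_of_le (fun k => by positivity) (fun k => ?_) u.summable_sq
    refine mul_le_mul_of_nonneg_right ?_ (sq_nonneg _)
    exact Real.rpow_le_rpow_of_exponent_le (le_add_of_nonneg_right (sq_nonneg _)) h)

/-- The uniform bound on `v ∘ φ⁻¹` along the segment from the identity to `φ`. -/
theorem exists_weightedSum_comp_le (hq : 5 / 2 < q) (v : SobolevCircle q)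
    (hv : ∀ x, 0 < 1 + v.deriv x) :
    ∃ C : ℝ, 0 ≤ C ∧ ∀ t : ℝ, 0 ≤ t → t ≤ 1 → (∀ x, 0 < 1 + (t • v).deriv x) ∧
      ∀ (φ : UnitAddCircle ≃ₜ UnitAddCircle) (w : SobolevCircle q),
        (∀ x, φ x = x + (((t • v) x : ℝ) : UnitAddCircle)) → (∀ x, w x = v (φ.symm x)) →
        weightedSum 1 w ≤ ENNReal.ofReal C := by
  have hq' : 3 / 2 < q := by linarith
  have hq1 : 3 / 2 < q - 1 := by linarith
  have hc : Continuous fun x => 1 + v.deriv x := continuous_const.add (v.continuous_deriv hq')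
  obtain ⟨x₀, -, hx₀⟩ := isCompact_univ.exists_isMinOn Set.univ_nonempty hc.continuousOn
  have hmin : ∀ x, 1 + v.deriv x₀ ≤ 1 + v.deriv x := fun x => hx₀ (Set.mem_univ x)
  -- Since δ ≤ 1, the convex combination 1 + tv' = (1 - t) + t(1 + v') is also at least δ, so one
  -- constant works along the whole segment.
  obtain ⟨δ, hδ, hδ1, hδ2⟩ : ∃ δ : ℝ, 0 < δ ∧ δ ≤ 1 ∧ ∀ x, δ ≤ 1 + v.deriv x :=
    ⟨min 1 (1 + v.deriv x₀), lt_min one_pos (hv x₀), min_le_left _ _,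
      fun x => (min_le_right _ _).trans (hmin x)⟩
  obtain ⟨V, hV0, hV⟩ := exists_abs_le v.toCont
  obtain ⟨D, hD0, hD⟩ := exists_abs_le ⟨v.deriv, v.continuous_deriv hq'⟩
  obtain ⟨E, hE0, hE⟩ := exists_abs_le
    ⟨(v.derivSobolev hq').deriv, (v.derivSobolev hq').continuous_deriv hq1⟩
  refine ⟨∑' k : ℤ, freqWeight k ^ (-2 : ℝ) + V ^ 2 + ((E + D / δ * E) / δ ^ 2) ^ 2,
    add_nonneg (add_nonneg (tsum_nonneg fun k => Real.rpow_nonneg (freqWeight_pos k).le _)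
      (sq_nonneg _)) (sq_nonneg _), fun t ht0 ht1 => ?_⟩
  have ht : ∀ x, δ ≤ 1 + (t • v).deriv x := fun x => by
    rw [deriv_smul hq']
    nlinarith [hδ2 x]
  refine ⟨fun x => hδ.trans_le (ht x), fun φ w hφ hw => ?_⟩
  refine weightedSum_one_le_of_abs_le hq w (fun x => by rw [hw]; exact hV _) fun x => ?_
  obtain ⟨y, rfl⟩ := exists_lift_eq hφ x
  refine abs_deriv_deriv_le_of_comp_lift hq (u := t • v) (v := v) (fun z => ?_) hδ ht hD hE
    (fun x => ?_) y
  · rw [hw, coe_lift, ← hφ, φ.symm_apply_apply]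
  · rw [derivSobolev_smul, deriv_smul hq1, abs_mul, abs_of_nonneg ht0]
    have h1 := hE x
    have h2 := abs_nonneg ((v.derivSobolev hq').deriv x)
    change |(v.derivSobolev hq').deriv x| ≤ E at h1
    nlinarith

/-- The map ψ' ∘ ψ⁻¹ has displacement (b - a) v ∘ ψ⁻¹, which is small, and composition with ψ'⁻¹ is
composition with ψ⁻¹ followed by composition with the inverse of ψ' ∘ ψ⁻¹. -/
theorem exists_clm_comp_symm_step (hσ : 3 / 2 < σ) (hσq : σ ≤ q)
    {v : SobolevCircle q} {a b : ℝ} {ψ ψ' : UnitAddCircle ≃ₜ UnitAddCircle}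
    (hψ : ∀ x, ψ x = x + (((a • v) x : ℝ) : UnitAddCircle))
    (hψ' : ∀ x, ψ' x = x + (((b • v) x : ℝ) : UnitAddCircle))
    {w : SobolevCircle q} (hw : ∀ x, w x = v (ψ.symm x))
    (hw1 : weightedSum 1 ((b - a) • w) ≤ ENNReal.ofReal (1 / 128))
    (h : ∃ T : SobolevCircle σ →L[ℝ] SobolevCircle σ, ∀ f x, T f x = f (ψ.symm x)) :
    ∃ T : SobolevCircle σ →L[ℝ] SobolevCircle σ, ∀ f x, T f x = f (ψ'.symm x) := by
  obtain ⟨T, hT⟩ := h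
  have hχ : ∀ x, (ψ.symm.trans ψ') x =
      x + (((restrict hσq ((b - a) • w)) x : ℝ) : UnitAddCircle) := fun x => by
    have h1 : x = ψ.symm x + (((a • v) (ψ.symm x) : ℝ) : UnitAddCircle) := by
      rw [← hψ, ψ.apply_symm_apply]
    have h2 : (restrict hσq ((b - a) • w)) x = (b - a) * v (ψ.symm x) := by
      rw [← hw]; rfl
    have h3 : (b • v) (ψ.symm x) = (a • v) (ψ.symm x) + (b - a) * v (ψ.symm x) := by
      change b * v (ψ.symm x) = a * v (ψ.symm x) + _
      ring
    rw [Homeomorph.trans_apply, hψ', h2, h3, AddCircle.coe_add, ← add_assoc, ← h1]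
  obtain ⟨S, hS⟩ := exists_clm_comp_symm hσ (u := restrict hσq ((b - a) • w)) hw1 _ hχ
  refine ⟨S.comp T, fun f x => ?_⟩
  rw [ContinuousLinearMap.comp_apply, hS, hT]
  simp

/-- Composition with `φ⁻¹` is bounded on `H^σ` if the displacement of `φ` is in `H^q` and the
derivative of `φ` is positive. -/
theorem exists_clm_comp_symm_of_pos (hq : 5 / 2 < q) (hσ : 3 / 2 < σ) (hσq : σ ≤ q)
    {v : SobolevCircle q} (hv : ∀ x, 0 < 1 + v.deriv x) (φ : UnitAddCircle ≃ₜ UnitAddCircle)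
    (hφ : ∀ x, φ x = x + ((v x : ℝ) : UnitAddCircle)) :
    ∃ T : SobolevCircle σ →L[ℝ] SobolevCircle σ, ∀ f x, T f x = f (φ.symm x) := by
  obtain ⟨C, hC0, hC⟩ := exists_weightedSum_comp_le hq v hv
  obtain ⟨N, hN⟩ := exists_nat_ge (128 * C + 1)
  have hN0 : (0 : ℝ) < N := by linarith
  -- The assertion on H^q is carried along with the one on H^σ: it puts v ∘ ψ⁻¹ in H^q, as the
  -- uniform bound `hCj` for the next step requires.
  have key : ∀ j : ℕ, j ≤ N → ∀ ψ : UnitAddCircle ≃ₜ UnitAddCircle,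
      (∀ x, ψ x = x + (((((j : ℝ) / N) • v) x : ℝ) : UnitAddCircle)) →
      (∃ T : SobolevCircle q →L[ℝ] SobolevCircle q, ∀ f x, T f x = f (ψ.symm x)) ∧
      ∃ T : SobolevCircle σ →L[ℝ] SobolevCircle σ, ∀ f x, T f x = f (ψ.symm x) := by
    intro j
    induction j with
    | zero =>
      intro _ ψ hψ
      have h : ∀ x, ψ.symm x = x := fun x => by
        rw [ψ.symm_apply_eq, hψ]
        simp
      exact ⟨⟨ContinuousLinearMap.id ℝ _, fun f x => by rw [h]; rfl⟩,
        ⟨ContinuousLinearMap.id ℝ _, fun f x => by rw [h]; rfl⟩⟩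
    | succ j ih =>
      intro hj ψ' hψ'
      have hj' : (j : ℝ) / N ≤ 1 := by
        rw [div_le_one hN0]; exact_mod_cast (Nat.le_succ j).trans hj
      obtain ⟨hpos, hCj⟩ := hC ((j : ℝ) / N) (by positivity) hj'
      obtain ⟨ψ, hψ⟩ := exists_homeomorph (by linarith) (((j : ℝ) / N) • v) hpos
      obtain ⟨⟨T, hT⟩, hTσ⟩ := ih ((Nat.le_succ j).trans hj) ψ hψ
      have hw := hCj ψ (T v) hψ (hT v)
      have hw1 : weightedSum 1 ((((j + 1 : ℕ) : ℝ) / N - (j : ℝ) / N) • T v) ≤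
          ENNReal.ofReal (1 / 128) := by
        have e : ((j + 1 : ℕ) : ℝ) / N - (j : ℝ) / N = 1 / N := by push_cast; ring
        rw [e, weightedSum_smul (by positivity)]
        refine (mul_le_mul' le_rfl hw).trans ?_
        rw [← ENNReal.ofReal_mul (by positivity)]
        refine ENNReal.ofReal_le_ofReal ?_
        rw [one_div_mul_eq_div, div_le_iff₀ hN0]
        linarith
      exact ⟨exists_clm_comp_symm_step (by linarith) le_rfl hψ hψ' (hT v) hw1 ⟨T, hT⟩,
        exists_clm_comp_symm_step hσ hσq hψ hψ' (hT v) hw1 hTσ⟩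
  exact (key N le_rfl φ fun x => by rw [div_self hN0.ne', one_smul]; exact hφ x).2

end SobolevCircle

/-- Right translations by elements of `𝒟^q` are bounded on `H^σ` for `3/2 < σ ≤ q`. -/
theorem SobolevDiff.exists_isRightTranslation {σ q : ℝ} (hq : 5 / 2 < q) (hσ : 3 / 2 < σ)
    (hσq : σ ≤ q) (φ : SobolevDiff q) :
    ∃ T : SobolevCircle σ →L[ℝ] SobolevCircle σ, IsRightTranslation φ T := by
  obtain ⟨⟨u, hu⟩, ⟨w, hw⟩⟩ := φ.2
  -- Everything is applied to φ⁻¹, because the preceding result concerns composition with an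
  -- inverse.
  have hpos := SobolevCircle.one_add_deriv_pos (by linarith : 3 / 2 < q) (φ := φ.toHomeo.symm)
    hw hu
  exact SobolevCircle.exists_clm_comp_symm_of_pos hq hσ hσq hpos φ.toHomeo.symm hw

/-! ### Passing to the limit in the expansion -/

theorem tendsto_finDiff {ι G : Type*} [Add G] {l : Filter ι} {Q : ι → G → ℂ} {Q₀ : G → ℂ}
    (h : ∀ a, Filter.Tendsto (fun i => Q i a) l (nhds (Q₀ a))) :
    ∀ (n : ℕ) (k : Fin n → G) (a : G),
      Filter.Tendsto (fun i => finDiff (Q i) n k a) l (nhds (finDiff Q₀ n k a))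
  | 0, _, a => h a
  | n + 1, k, a => (tendsto_finDiff h n (Fin.tail k) a).sub (tendsto_finDiff h n (Fin.tail k) _)

theorem tendsto_conjSymbol {ι : Type*} {l : Filter ι} {p : ι → ℂ → ℂ} {p₀ : ℂ → ℂ}
    (h : ∀ ξ : ℤ, Filter.Tendsto (fun i => p i ξ) l (nhds (p₀ ξ))) :
    ∀ (n : ℕ) (κ : Fin (n + 1) → ℤ),
      Filter.Tendsto (fun i => conjSymbol (p i) n κ) l (nhds (conjSymbol p₀ n κ))
  | 0, κ => h (κ 0)
  | n + 1, κ => (tendsto_finDiff (Q := fun i (ξ : ℤ) => (ξ : ℂ) ^ n * p i ξ)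
      (fun a => (h a).const_mul _) (n + 1) (Fin.init κ) (κ (Fin.last (n + 1)))).const_mul _

theorem tendsto_gaussSymbol (r : ℝ) (ξ : ℤ) :
    Filter.Tendsto (fun ε => gaussSymbol r ε ξ) (nhdsWithin 0 (Set.Ioi 0))
      (nhds (gaussSymbol r 0 ξ)) := by
  have h : Continuous fun ε : ℝ => gaussSymbol r ε ξ := by
    unfold gaussSymbol
    fun_prop
  exact (h.tendsto 0).mono_left nhdsWithin_le_nhds

theorem norm_gaussSymbol_intCast_le {r ε : ℝ} (hε : 0 ≤ ε) (ξ : ℤ) :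
    ‖gaussSymbol r ε ξ‖ ≤ (1 + (ξ : ℝ) ^ 2) ^ (r / 2) := by
  rw [gaussSymbol_intCast, Complex.norm_real, Real.norm_of_nonneg (by positivity)]
  refine mul_le_of_le_one_right (by positivity) (Real.exp_le_one_iff.2 ?_)
  nlinarith [sq_nonneg (ξ : ℝ)]

/-- Dominated convergence over multi-indices: the common symbol bound gives a summable majorant
independent of the parameter. -/
theorem SymbolBound.tendsto_tsum_conjTerm {ι : Type*} {l : Filter ι} {p : ι → ℂ → ℂ}
    {p₀ : ℂ → ℂ} {B r : ℝ} (hp : ∀ᶠ i in l, SymbolBound (p i) B r) (hr : 1 ≤ r)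
    (h : ∀ ξ : ℤ, Filter.Tendsto (fun i => p i ξ) l (nhds (p₀ ξ))) (n : ℕ)
    (b : Fin (n + 1) → ℤ → ℂ) (hb : ∀ i, Summable fun k => freqWeight k ^ r * ‖b i k‖)
    (x : UnitAddCircle) :
    Filter.Tendsto (fun i => ∑' κ, conjTerm (p i) n b κ * fourier (∑ j, κ j) x) l
      (nhds (∑' κ, conjTerm p₀ n b κ * fourier (∑ j, κ j) x)) := by
  have hfin : ∀ i, ∑' k, ENNReal.ofReal (freqWeight k ^ r * ‖b i k‖) ≠ ⊤ := fun i => by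
    rw [← ENNReal.ofReal_tsum_of_nonneg (fun k => mul_nonneg
      (Real.rpow_nonneg (freqWeight_pos k).le _) (norm_nonneg _)) (hb i)]
    exact ENNReal.ofReal_ne_top
  have hle : ∀ i, ∑' k, ENNReal.ofReal (freqWeight k * ‖b i k‖) ≤
      ∑' k, ENNReal.ofReal (freqWeight k ^ r * ‖b i k‖) := fun i =>
    ENNReal.tsum_le_tsum fun k => ENNReal.ofReal_le_ofReal (mul_le_mul_of_nonneg_right
      (Real.self_le_rpow_of_one_le (one_le_freqWeight k) hr) (norm_nonneg _))
  have h1 := ENNReal.tsum_multiindex_sum_le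
    (fun i k => ENNReal.ofReal (freqWeight k * ‖b i k‖))
    (fun i k => ENNReal.ofReal (freqWeight k ^ r * ‖b i k‖))
    (fun i => ∑' k, ENNReal.ofReal (freqWeight k ^ r * ‖b i k‖)) 1 hle (fun i => by rw [one_mul])
  have h2 : ∑' κ : Fin (n + 1) → ℤ, ENNReal.ofReal (conjBound B r n) *
      ∑ i, ENNReal.ofReal (freqWeight (κ i) ^ r * ‖b i (κ i)‖) *
        ∏ j, ENNReal.ofReal (freqWeight (κ (i.succAbove j)) *
          ‖b (i.succAbove j) (κ (i.succAbove j))‖) ≠ ⊤ := by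
    rw [ENNReal.tsum_mul_left]
    refine ENNReal.mul_ne_top ENNReal.ofReal_ne_top (ne_top_of_le_ne_top ?_ h1)
    refine ENNReal.mul_ne_top (ENNReal.natCast_ne_top _)
      (ENNReal.mul_ne_top ENNReal.one_ne_top (ENNReal.prod_ne_top fun i _ => hfin i))
  refine tendsto_tsum_of_dominated_convergence (ENNReal.summable_toReal h2) (fun κ => ?_) ?_
  · exact ((tendsto_conjSymbol h n κ).mul_const _).mul_const _
  · filter_upwards [hp] with i hi κ
    rw [norm_mul, norm_fourier_apply, mul_one]
    have h3 := hi.weight_mul_enorm_conjTerm_le hr le_rfl n b κ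
    simp only [Real.rpow_zero, ENNReal.ofReal_one, one_mul, add_zero] at h3
    have h4 := ENNReal.toReal_mono (ENNReal.ne_top_of_tsum_ne_top h2 κ) h3
    rwa [toReal_enorm] at h4

namespace SobolevCircle

variable {σ q : ℝ}

/-- The expansion of `R_φ op((1 + ξ²)^(r/2)) R_φ⁻¹ f`, where `φ` has the small displacement `u` and
`g = f ∘ φ⁻¹`. -/
theorem hasSum_conj_expansion_gaussSymbol {r : ℝ} (hσ : 3 / 2 < σ) (hr : 1 ≤ r) (hrσ : r + 1 / 2 < σ)
    {u f : SobolevCircle σ} (hu : weightedSum 1 u ≤ ENNReal.ofReal (1 / 128))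
    {g : UnitAddCircle → ℂ} (hg : Continuous g)
    (hgf : ∀ y : ℝ, g ((u.lift y : ℝ) : UnitAddCircle) = ((f (y : UnitAddCircle) : ℝ) : ℂ))
    (hgs : Summable fun ξ : ℤ => (1 + (ξ : ℝ) ^ 2) ^ (r / 2) * ‖fourierCoeff g ξ‖) (x : ℝ) :
    HasSum (fun n => trigSeries (conjCoeff (gaussSymbol r 0) n (coeffs (snocConst u f n)))
      (x : UnitAddCircle))
      (∑' ξ : ℤ, gaussSymbol r 0 ξ * fourierCoeff g ξ *
        fourier ξ ((u.lift x : ℝ) : UnitAddCircle)) := by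
  have hσ0 : 0 ≤ σ := by linarith
  have hr0 : 0 ≤ r := by linarith
  have e1 := embedConst_pos σ 1
  have er := embedConst_pos σ r
  -- The first entry bounds the order-r norm of u relative to 1/128, the second that of f relative
  -- to `embedConst σ 1 * ‖f‖`.
  set L : ℝ := max (128 * (embedConst σ r * ‖u‖)) (embedConst σ r / embedConst σ 1) with hLdef
  have hL0 : 0 ≤ L := (div_pos er e1).le.trans (le_max_right _ _)
  have hA : 0 ≤ embedConst σ 1 * ‖f‖ := mul_nonneg e1.le (norm_nonneg f)
  have hf : weightedSum 1 f ≤ ENNReal.ofReal (embedConst σ 1 * ‖f‖) :=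
    weightedSum_le hσ0 (by linarith) f
  have hu' : weightedSum r u ≤ ENNReal.ofReal (L * (1 / 128)) := by
    refine (weightedSum_le hσ0 hrσ u).trans (ENNReal.ofReal_le_ofReal ?_)
    have := le_max_left (128 * (embedConst σ r * ‖u‖)) (embedConst σ r / embedConst σ 1)
    rw [← hLdef] at this
    linarith
  have hf' : weightedSum r f ≤ ENNReal.ofReal (L * (embedConst σ 1 * ‖f‖)) := by
    refine (weightedSum_le hσ0 hrσ f).trans (ENNReal.ofReal_le_ofReal ?_)
    have := le_max_right (128 * (embedConst σ r * ‖u‖)) (embedConst σ r / embedConst σ 1)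
    rw [← hLdef, div_le_iff₀ e1] at this
    rw [← mul_assoc]
    exact mul_le_mul_of_nonneg_right this (norm_nonneg _)
  have hle : ∀ ε : ℝ, 0 ≤ ε → ε ≤ 1 → ∀ n,
      ∑' κ, ‖conjTerm (gaussSymbol r ε) n (coeffs (snocConst u f n)) κ‖ₑ ≤
      ENNReal.ofReal (conjBound (5 ^ (r / 2) * Real.exp 1) r n * ((n + 1 : ℕ) *
        (L * ((1 / 128) ^ n * (embedConst σ 1 * ‖f‖))))) := fun ε h0 h1 n =>
    tsum_enorm_conjTerm_snocConst_le (symbolBound_gaussSymbol hr0 h0 h1) hr (by norm_num) hA hL0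
      hu hf hu' hf' n
  have hIoc : ∀ᶠ ε : ℝ in nhdsWithin 0 (Set.Ioi 0), ε ∈ Set.Ioc (0 : ℝ) 1 :=
    Ioc_mem_nhdsGT (zero_lt_one' ℝ)
  have hsum : ∀ n, trigSeries (conjCoeff (gaussSymbol r 0) n (coeffs (snocConst u f n)))
      (x : UnitAddCircle) = ∑' κ, conjTerm (gaussSymbol r 0) n (coeffs (snocConst u f n)) κ *
        fourier (∑ j, κ j) (x : UnitAddCircle) := fun n =>
    (hasSum_conjCoeff_mul_fourier (summable_of_tsum_enorm_ne_top
      (ne_top_of_le_ne_top ENNReal.ofReal_ne_top (hle 0 le_rfl zero_le_one n)))).2 _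
  simp_rw [hsum]
  have hB0 : 0 ≤ 5 ^ (r / 2) * Real.exp 1 := by positivity
  have hK : Summable fun n => conjBound (5 ^ (r / 2) * Real.exp 1) r n * ((n + 1 : ℕ) *
      (L * ((1 / 128) ^ n * (embedConst σ 1 * ‖f‖)))) := by
    simp_rw [conjBound_mul_eq]
    exact (summable_half_pow_mul_rpow _).mul_left _
  have hbd : ∀ ε : ℝ, 0 ≤ ε → ε ≤ 1 → ∀ n, ‖∑' κ, conjTerm (gaussSymbol r ε) n
      (coeffs (snocConst u f n)) κ * fourier (∑ j, κ j) (x : UnitAddCircle)‖ ≤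
      conjBound (5 ^ (r / 2) * Real.exp 1) r n * ((n + 1 : ℕ) *
        (L * ((1 / 128) ^ n * (embedConst σ 1 * ‖f‖)))) := fun ε hε0 hε1 n => by
    have h0 := conjBound_nonneg hB0 r n
    rw [← ENNReal.ofReal_le_ofReal_iff (by positivity), ofReal_norm]
    refine (enorm_tsum_le_tsum_enorm).trans (le_trans (le_of_eq ?_) (hle ε hε0 hε1 n))
    refine tsum_congr fun κ => ?_
    rw [← ofReal_norm, ← ofReal_norm, norm_mul, norm_fourier_apply, mul_one]
  have hleft : Filter.Tendsto (fun ε => ∑' n, ∑' κ, conjTerm (gaussSymbol r ε) n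
      (coeffs (snocConst u f n)) κ * fourier (∑ j, κ j) (x : UnitAddCircle))
      (nhdsWithin 0 (Set.Ioi 0)) (nhds (∑' n, ∑' κ, conjTerm (gaussSymbol r 0) n
      (coeffs (snocConst u f n)) κ * fourier (∑ j, κ j) (x : UnitAddCircle))) := by
    refine tendsto_tsum_of_dominated_convergence hK (fun n => ?_) ?_
    · refine SymbolBound.tendsto_tsum_conjTerm (B := 5 ^ (r / 2) * Real.exp 1) ?_ hr
        (tendsto_gaussSymbol r) n _ (fun i => ?_) _
      · filter_upwards [hIoc] with ε hε
        exact symbolBound_gaussSymbol hr0 hε.1.le hε.2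
      · exact summable_rpow_mul_of_summable_sq hσ0 hrσ (snocConst u f n i).summable_sq
    · filter_upwards [hIoc] with ε hε n
      exact hbd ε hε.1.le hε.2 n
  have hright : Filter.Tendsto (fun ε => ∑' ξ : ℤ, gaussSymbol r ε ξ * fourierCoeff g ξ *
        fourier ξ ((u.lift x : ℝ) : UnitAddCircle)) (nhdsWithin 0 (Set.Ioi 0))
      (nhds (∑' ξ : ℤ, gaussSymbol r 0 ξ * fourierCoeff g ξ *
        fourier ξ ((u.lift x : ℝ) : UnitAddCircle))) := by
    refine tendsto_tsum_of_dominated_convergence hgs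
      (fun ξ => ((tendsto_gaussSymbol r ξ).mul_const _).mul_const _) ?_
    filter_upwards [hIoc] with ε hε ξ
    rw [norm_mul, norm_mul, norm_fourier_apply, mul_one]
    exact mul_le_mul_of_nonneg_right (norm_gaussSymbol_intCast_le hε.1.le ξ) (norm_nonneg _)
  refine (Summable.of_norm_bounded hK (hbd 0 le_rfl zero_le_one)).hasSum_iff.2 ?_
  -- For ε > 0 both sides agree by the expansion for rapidly decaying symbols, and both converge as
  -- ε → 0.
  refine tendsto_nhds_unique hleft (hright.congr' ?_)
  filter_upwards [hIoc] with ε hε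
  exact (hasSum_conj_expansion hσ u f hg hgf (summable_gaussSymbol_mul_exp hr0 hε.1) x).tsum_eq.symm

/-! ### The multiplier and the analytic family of its conjugates -/

/-- Hermitian symmetry of the coefficients makes the sum real, so that the real part taken in
`ofLp2` loses nothing for a real even symbol. -/
theorem conj_trigSeries {b : ℤ → ℂ} (h : ∀ k, b (-k) = (starRingEnd ℂ) (b k))
    (x : UnitAddCircle) : (starRingEnd ℂ) (trigSeries b x) = trigSeries b x := by
  unfold trigSeries
  rw [Complex.conj_tsum, ← (Equiv.neg ℤ).tsum_eq]
  refine tsum_congr fun k => ?_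
  rw [map_mul, Equiv.neg_apply, h, Complex.conj_conj, fourier_neg, Complex.conj_conj]

theorem unweight_mul_weight (τ t : ℝ) (k : ℤ) (z : ℂ) :
    (((1 + (k : ℝ) ^ 2) ^ (-(τ / 2)) : ℝ) : ℂ) * ((((1 + (k : ℝ) ^ 2) ^ (t / 2) : ℝ) : ℂ) * z) =
      (((1 + (k : ℝ) ^ 2) ^ ((t - τ) / 2) : ℝ) : ℂ) * z := by
  have h : (0 : ℝ) < 1 + (k : ℝ) ^ 2 := by positivity
  rw [← mul_assoc, ← Complex.ofReal_mul, ← Real.rpow_add h]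
  congr 3
  ring

/-- The Fourier multiplier with symbol `(1 + k²)^(r/2)`, from `H^q` to `H^(q-r)`. -/
noncomputable def besselMultiplier (q : ℝ) {τ : ℝ} (hτ : 1 / 2 < τ) :
    SobolevCircle q →L[ℝ] SobolevCircle τ :=
  -- Weighting with exponent q/2 and unweighting with τ/2 leaves the symbol with exponent (q - τ)/2.
  (ofLp2 hτ).comp ((toLp2 q).mkContinuous 1 fun u => by rw [one_mul]; exact le_rfl)

theorem isFourierMultiplier_besselMultiplier {τ : ℝ} (hτ : 1 / 2 < τ) :
    IsFourierMultiplier (fun n : ℤ => (((1 + (n : ℝ) ^ 2) ^ ((q - τ) / 2) : ℝ) : ℂ))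
      (besselMultiplier q hτ) := by
  intro u x
  have hs := summable_of_summable_sq hτ (summable_unweighted τ (toLp2 q u))
  have e : ∀ k : ℤ, (((1 + (k : ℝ) ^ 2) ^ (-(τ / 2)) : ℝ) : ℂ) * (toLp2 q u) k =
      (((1 + (k : ℝ) ^ 2) ^ ((q - τ) / 2) : ℝ) : ℂ) * circleCoeff u.toCont k := fun k =>
    unweight_mul_weight τ q k _
  have h : ((besselMultiplier q hτ u x : ℝ) : ℂ) = trigSeries (fun k : ℤ =>
      (((1 + (k : ℝ) ^ 2) ^ ((q - τ) / 2) : ℝ) : ℂ) * circleCoeff u.toCont k) x := by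
    have h1 : besselMultiplier q hτ u x = (trigSeries (fun k : ℤ =>
        (((1 + (k : ℝ) ^ 2) ^ ((q - τ) / 2) : ℝ) : ℂ) * circleCoeff u.toCont k) x).re :=
      congrArg (fun b => (trigSeries b x).re) (funext e)
    rw [h1]
    refine Complex.conj_eq_iff_re.1 (conj_trigSeries (fun k => ?_) x)
    rw [map_mul, Complex.conj_ofReal, circleCoeff_neg_eq_conj]
    push_cast
    rw [neg_sq]
  rw [h]
  simp_rw [e] at hs
  exact (summable_mul_fourier hs x).hasSum

/-- Evaluation at a point, on `H^σ` with `σ > 1/2`. -/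
noncomputable def evalCLM (hσ : 1 / 2 < σ) (x : UnitAddCircle) : SobolevCircle σ →L[ℝ] ℝ :=
  LinearMap.mkContinuous
    { toFun := fun u => u x
      map_add' := fun _ _ => rfl
      map_smul' := fun _ _ => rfl } (embedConst σ 0) fun u => by
    have h1 := u.weightedSum_le (by linarith : 0 ≤ σ) (t := 0) (by linarith)
    rw [← ENNReal.ofReal_le_ofReal_iff (mul_nonneg (embedConst_pos σ 0).le (norm_nonneg _))]
    refine le_trans ?_ h1
    have h2 : ‖u x‖ = ‖((u x : ℝ) : ℂ)‖ := (Complex.norm_real _).symm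
    change ENNReal.ofReal ‖u x‖ ≤ _
    rw [h2, ofReal_norm, ← u.trigSeries_coeff hσ x]
    refine enorm_tsum_le_tsum_enorm.trans (ENNReal.tsum_le_tsum fun k => ?_)
    rw [← ofReal_norm, norm_mul, norm_fourier_apply, Real.rpow_zero, mul_one, one_mul]

/-- The Taylor series at `0` of `v ↦ R_φ op((1 + ξ²)^(r/2)) R_φ⁻¹`, where `φ` has displacement
`v`. -/
noncomputable def conjSeries {r τ : ℝ} (hr : 1 ≤ r) (hτ : 1 / 2 < τ) (hq : 3 / 2 < q)
    (hrτ : r + τ = q) :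
    FormalMultilinearSeries ℝ (SobolevCircle q) (SobolevCircle q →L[ℝ] SobolevCircle τ) :=
  fun n => ((ofLp2 hτ).compContinuousMultilinearMap
    (conjMultilinear (symbolBound_gaussSymbol (by linarith : 0 ≤ r) le_rfl zero_le_one) hr
      (by linarith : 0 ≤ τ) hq hrτ n)).curryRight

theorem conjSeries_apply {r τ : ℝ} (hr : 1 ≤ r) (hτ : 1 / 2 < τ) (hq : 3 / 2 < q)
    (hrτ : r + τ = q) (n : ℕ) (v f : SobolevCircle q) (x : UnitAddCircle) :
    conjSeries hr hτ hq hrτ n (fun _ => v) f x =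
      (trigSeries (conjCoeff (gaussSymbol r 0) n (coeffs (snocConst v f n))) x).re := by
  change (trigSeries (fun k : ℤ => (((1 + (k : ℝ) ^ 2) ^ (-(τ / 2)) : ℝ) : ℂ) *
    weightedConjCoeff (gaussSymbol r 0) τ n (coeffs (snocConst v f n)) k) x).re = _
  simp_rw [weightedConjCoeff, unweight_mul_weight, sub_self, zero_div, Real.rpow_zero,
    Complex.ofReal_one, one_mul]

/-- The (n+1)-linear map has norm of order 64^n `embedConst q 1`^(n+1), up to a power of n + 1, so
on this radius the terms decay like 2^(-n). -/
theorem le_radius_conjSeries {r τ : ℝ} (hr : 1 ≤ r) (hτ : 1 / 2 < τ) (hq : 3 / 2 < q)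
    (hrτ : r + τ = q) :
    ENNReal.ofReal (1 / (128 * embedConst q 1)) ≤ (conjSeries hr hτ hq hrτ).radius := by
  have he := embedConst_pos q 1
  have hρ : 0 ≤ 1 / (128 * embedConst q 1) := by positivity
  refine FormalMultilinearSeries.le_radius_of_summable_norm _ ?_
  rw [Real.coe_toNNReal _ hρ]
  have hs : Summable fun n : ℕ => ‖(ofLp2 hτ : _ →L[ℝ] SobolevCircle τ)‖ *
      (conjBound (5 ^ (r / 2) * Real.exp 1) q n * ((n + 1 : ℕ) *
        (1 * ((1 / 128) ^ n * embedConst q 1)))) := by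
    simp_rw [conjBound_mul_eq]
    exact ((summable_half_pow_mul_rpow _).mul_left _).mul_left _
  refine Summable.of_nonneg_of_le (fun n => by positivity) (fun n => ?_) hs
  have h1 := norm_conjMultilinear_le (symbolBound_gaussSymbol (by linarith : 0 ≤ r) le_rfl
    zero_le_one) hr (by linarith : 0 ≤ τ) hq hrτ n
  have h2 : ‖conjSeries hr hτ hq hrτ n‖ ≤ ‖(ofLp2 hτ : _ →L[ℝ] SobolevCircle τ)‖ *
      (conjBound (5 ^ (r / 2) * Real.exp 1) q n * (n + 1 : ℕ) * embedConst q 1 ^ (n + 1)) := by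
    rw [conjSeries, ContinuousMultilinearMap.curryRight_norm]
    refine (ContinuousLinearMap.norm_compContinuousMultilinearMap_le _ _).trans ?_
    exact mul_le_mul_of_nonneg_left h1 (norm_nonneg _)
  calc _ ≤ ‖(ofLp2 hτ : _ →L[ℝ] SobolevCircle τ)‖ *
      (conjBound (5 ^ (r / 2) * Real.exp 1) q n * (n + 1 : ℕ) * embedConst q 1 ^ (n + 1)) *
        (1 / (128 * embedConst q 1)) ^ n := by gcongr
    _ = _ := by
      rw [pow_succ, div_pow, one_pow, mul_pow, div_pow, one_pow]
      field_simp

theorem contDiffOn_conjSeries_sum {r τ : ℝ} (hr : 1 ≤ r) (hτ : 1 / 2 < τ) (hq : 3 / 2 < q)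
    (hrτ : r + τ = q) :
    ContDiffOn ℝ ∞ (conjSeries hr hτ hq hrτ).sum
      (Metric.ball 0 (1 / (128 * embedConst q 1))) := by
  have he := embedConst_pos q 1
  have hρ : 0 < 1 / (128 * embedConst q 1) := by positivity
  have := completeSpace hτ
  have hrad := le_radius_conjSeries hr hτ hq hrτ
  have h := (conjSeries hr hτ hq hrτ).hasFPowerSeriesOnBall
    ((ENNReal.ofReal_pos.2 hρ).trans_le hrad)
  have h2 : AnalyticOnNhd ℝ (conjSeries hr hτ hq hrτ).sum
      (Metric.ball 0 (1 / (128 * embedConst q 1))) := by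
    refine h.analyticOnNhd.mono ?_
    rw [← Metric.eball_ofReal]
    exact Metric.eball_subset_eball hrad
  exact h2.contDiffOn (uniqueDiffOn_convex (convex_ball _ _) (by
    rw [Metric.isOpen_ball.interior_eq]; exact ⟨0, Metric.mem_ball_self hρ⟩))

theorem weightedSum_one_le_of_mem_ball (hq : 3 / 2 < q) {v : SobolevCircle q}
    (hv : v ∈ Metric.ball 0 (1 / (128 * embedConst q 1))) :
    weightedSum 1 v ≤ ENNReal.ofReal (1 / 128) := by
  have he := embedConst_pos q 1
  refine (v.weightedSum_le (by linarith) (by linarith)).trans (ENNReal.ofReal_le_ofReal ?_)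
  rw [mem_ball_zero_iff, lt_div_iff₀ (by positivity)] at hv
  linarith

/-- The sum of the Taylor series is the conjugated multiplier. -/
theorem conjSeries_sum_apply {r τ : ℝ} (hr : 1 ≤ r) (hτ : 1 / 2 < τ) (hq : 3 / 2 < q)
    (hrτ : r + τ = q) {v f h : SobolevCircle q}
    (hv : v ∈ Metric.ball 0 (1 / (128 * embedConst q 1)))
    (hf : ∀ y, h (y + ((v y : ℝ) : UnitAddCircle)) = f y) (x : UnitAddCircle) :
    (conjSeries hr hτ hq hrτ).sum v f x =
      besselMultiplier q hτ h (x + ((v x : ℝ) : UnitAddCircle)) := by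
  have he := embedConst_pos q 1
  have := completeSpace hτ
  have hrad := le_radius_conjSeries hr hτ hq hrτ
  have hv' : v ∈ Metric.eball 0 (conjSeries hr hτ hq hrτ).radius := by
    refine Metric.eball_subset_eball hrad ?_
    rwa [Metric.eball_ofReal]
  have h1 := (conjSeries hr hτ hq hrτ).hasSum hv'
  -- Convergence in operator norm is tested on f and at the point x, where the limit is already
  -- known from the pointwise expansion.
  have h2 := (h1.mapL (ContinuousLinearMap.apply ℝ (SobolevCircle τ) f)).mapL (evalCLM hτ x)
  have h3 : ∀ n, evalCLM hτ x (ContinuousLinearMap.apply ℝ (SobolevCircle τ) f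
      (conjSeries hr hτ hq hrτ n fun _ => v)) =
      (trigSeries (conjCoeff (gaussSymbol r 0) n (coeffs (snocConst v f n))) x).re := fun n =>
    conjSeries_apply hr hτ hq hrτ n v f x
  simp_rw [h3] at h2
  have hs : Summable fun ξ : ℤ => (1 + (ξ : ℝ) ^ 2) ^ (r / 2) *
      ‖fourierCoeff (fun y : UnitAddCircle => ((h y : ℝ) : ℂ)) ξ‖ :=
    Summable.of_nonneg_of_le (fun ξ => by positivity)
      (fun ξ => mul_le_mul_of_nonneg_right (one_add_sq_rpow_half_le (by linarith) ξ)
        (norm_nonneg _))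
      (summable_rpow_mul_of_summable_sq (a := r) (by linarith) (by linarith) h.summable_sq)
  induction x using QuotientAddGroup.induction_on with
  | H x =>
    have h4 := hasSum_conj_expansion_gaussSymbol hq hr (by linarith)
      (weightedSum_one_le_of_mem_ball hq hv)
      (Complex.continuous_ofReal.comp h.toCont.continuous) (f := f)
      (fun y => by simp only [Function.comp, coe_lift, hf]) hs x
    have h5 := (isFourierMultiplier_besselMultiplier (q := q) hτ h
      ((v.lift x : ℝ) : UnitAddCircle)).tsum_eq
    have h6 : ∀ ξ : ℤ, gaussSymbol r 0 ξ =
        (((1 + (ξ : ℝ) ^ 2) ^ ((q - τ) / 2) : ℝ) : ℂ) := fun ξ => by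
      rw [gaussSymbol_intCast, neg_zero, zero_mul, Real.exp_zero, mul_one,
        show q - τ = r by linarith]
    simp_rw [h6] at h4
    have h7 := h4.mapL Complex.reCLM
    have h8 := h2.unique h7
    refine h8.trans ?_
    rw [← coe_lift]
    exact (congrArg Complex.re h5).trans (Complex.ofReal_re _)

end SobolevCircle

/-! ### Charts at an arbitrary diffeomorphism and conclusion -/

namespace SobolevDiff

variable {q : ℝ}

/-- The diffeomorphism `φ₀ + u` for `u` such that `u ∘ φ₀⁻¹` is small. -/
theorem exists_add_displacement (hq : 5 / 2 < q) (φ₀ : SobolevDiff q)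
    {u v : SobolevCircle q} (huv : ∀ x, v (φ₀ x) = u x)
    (hv : SobolevCircle.weightedSum 1 v ≤ ENNReal.ofReal (1 / 128)) :
    ∃ χ : SobolevDiff q, ∀ x, χ x = φ₀ x + ((u x : ℝ) : UnitAddCircle) := by
  have hq' : 3 / 2 < q := by linarith
  obtain ⟨⟨u₀, hu₀⟩, ⟨w₀, hw₀⟩⟩ := φ₀.2
  obtain ⟨ψ, hψ⟩ := v.exists_homeomorph hq' fun x => by
    have := (abs_le.1 (SobolevCircle.abs_deriv_le_half hq' hv x)).1
    linarith
  obtain ⟨T, hT⟩ := SobolevCircle.exists_clm_comp_symm hq' hv ψ hψ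
  have h1 : ∀ x, ψ (φ₀ x) = φ₀ x + ((u x : ℝ) : UnitAddCircle) := fun x => by rw [hψ, huv]
  -- With ψ = id + v, the inverse φ₀⁻¹ ∘ ψ⁻¹ has displacement w₀ ∘ ψ⁻¹ - v ∘ ψ⁻¹, which is in H^q
  -- because composition with ψ⁻¹ is bounded there.
  refine ⟨⟨φ₀.toHomeo.trans ψ, ⟨u₀ + u, fun x => ?_⟩, ⟨T w₀ - T v, fun x => ?_⟩⟩, h1⟩
  · have h2 : φ₀ x = x + ((u₀ x : ℝ) : UnitAddCircle) := hu₀ x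
    change ψ (φ₀ x) = x + ((u₀ x + u x : ℝ) : UnitAddCircle)
    rw [h1, h2, AddCircle.coe_add, add_assoc]
  · have h2 : φ₀.toHomeo.symm (ψ.symm x) =
        ψ.symm x + ((w₀ (ψ.symm x) : ℝ) : UnitAddCircle) := hw₀ _
    have h3 : (T w₀ - T v) x = w₀ (ψ.symm x) - v (ψ.symm x) := by
      rw [← hT, ← hT]; rfl
    have h4 : x = ψ.symm x + ((v (ψ.symm x) : ℝ) : UnitAddCircle) := by
      rw [← hψ, ψ.apply_symm_apply]
    change φ₀.toHomeo.symm (ψ.symm x) = _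
    rw [h2, h3, AddCircle.coe_sub]
    nth_rewrite 3 [h4]
    abel

end SobolevDiff

theorem mainTheorem2 (s q : ℝ) (hs : 1 / 2 ≤ s) (hq : 3 / 2 + 2 * s < q) :
    ∃ (R : SobolevDiff q → SobolevCircle q →L[ℝ] SobolevCircle q)
      (R' : SobolevDiff q → SobolevCircle (q - 2 * s) →L[ℝ] SobolevCircle (q - 2 * s))
      (Λ : SobolevCircle q →L[ℝ] SobolevCircle (q - 2 * s)),
      (∀ φ, IsRightTranslation φ (R φ)) ∧
      (∀ φ, IsRightTranslation φ (R' φ)) ∧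
      IsFourierMultiplier (fun n : ℤ => (((1 + (n : ℝ) ^ 2) ^ s : ℝ) : ℂ)) Λ ∧
      SobolevDiff.IsSmooth (fun φ => (R' φ).comp (Λ.comp (R φ⁻¹))) := by
  have hq5 : 5 / 2 < q := by linarith
  have hq3 : 3 / 2 < q := by linarith
  have hτ : 1 / 2 < q - 2 * s := by linarith
  have hr : 1 ≤ 2 * s := by linarith
  have hrτ : 2 * s + (q - 2 * s) = q := by ring
  choose R hR using fun φ : SobolevDiff q => φ.exists_isRightTranslation hq5 hq3 le_rfl
  choose R' hR' using fun φ : SobolevDiff q =>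
    φ.exists_isRightTranslation hq5 (σ := q - 2 * s) (by linarith) (by linarith)
  refine ⟨R, R', SobolevCircle.besselMultiplier q hτ, hR, hR', ?_, fun φ₀ => ?_⟩
  · have h := SobolevCircle.isFourierMultiplier_besselMultiplier (q := q) hτ
    rwa [show (q - (q - 2 * s)) / 2 = s by ring] at h
  set ρ : ℝ := 1 / (128 * SobolevCircle.embedConst q 1) with hρdef
  have hρ : 0 < ρ := by
    have := SobolevCircle.embedConst_pos q 1
    positivity
  set T := R φ₀⁻¹ with hTdef
  have hT : ∀ (f : SobolevCircle q) (x : UnitAddCircle), T f (φ₀ x) = f x := fun f x => by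
    rw [hTdef, hR φ₀⁻¹ f (φ₀ x)]
    exact congrArg f (φ₀.toHomeo.symm_apply_apply x)
  have hmaps : ∀ u ∈ Metric.ball (0 : SobolevCircle q) (ρ / (‖T‖ + 1)),
      T u ∈ Metric.ball (0 : SobolevCircle q) ρ := fun u hu => by
    have hT0 := norm_nonneg T
    rw [mem_ball_zero_iff, lt_div_iff₀ (by positivity)] at hu
    rw [mem_ball_zero_iff]
    have := T.le_opNorm u
    nlinarith [norm_nonneg u]
  have hc : ∀ u, ∃ χ : SobolevDiff q, u ∈ Metric.ball (0 : SobolevCircle q) (ρ / (‖T‖ + 1)) →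
      ∀ x, χ x = φ₀ x + ((u x : ℝ) : UnitAddCircle) := fun u => by
    by_cases hu : u ∈ Metric.ball (0 : SobolevCircle q) (ρ / (‖T‖ + 1))
    · obtain ⟨χ, hχ⟩ := φ₀.exists_add_displacement hq5 (hT u)
        (SobolevCircle.weightedSum_one_le_of_mem_ball hq3 (hmaps u hu))
      exact ⟨χ, fun _ => hχ⟩
    · exact ⟨φ₀, fun h => absurd h hu⟩
  choose c hc using hc
  refine ⟨ρ / (‖T‖ + 1), by have := norm_nonneg T; positivity, c, hc, ?_⟩
  -- With S the sum of the Taylor series at the identity and T composition with φ₀⁻¹, the map in the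
  -- chart is u ↦ R_φ₀ ∘ S(T u) ∘ T, smooth because T is linear and bounded.
  have hA := (SobolevCircle.contDiffOn_conjSeries_sum hr hτ hq3 hrτ).comp
    (T.contDiff (n := ∞)).contDiffOn hmaps
  have hB := (contDiffOn_const (c := R' φ₀)).clm_comp
    (hA.clm_comp (contDiffOn_const (c := T)))
  refine hB.congr fun u hu => ?_
  ext f
  refine SobolevCircle.ext_apply fun x => ?_
  have hinv : ∀ y : UnitAddCircle, φ₀ (φ₀⁻¹ y) = y := fun y => φ₀.toHomeo.apply_symm_apply y
  have hcomp : ∀ y : UnitAddCircle, y + ((T u y : ℝ) : UnitAddCircle) = c u (φ₀⁻¹ y) :=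
    fun y => by
      rw [hc u hu, hinv]
      congr 2
      exact hR φ₀⁻¹ u y
  -- Since c u = (id + T u) ∘ φ₀, the function f ∘ (c u)⁻¹ composed with id + T u is f ∘ φ₀⁻¹ = T f.
  -- The identity is read at φ₀ x because R_φ₀ is applied last.
  have h1 := SobolevCircle.conjSeries_sum_apply hr hτ hq3 hrτ (v := T u) (f := T f)
    (h := R (c u)⁻¹ f) (hmaps u hu) (fun y => by
      rw [hcomp, hR (c u)⁻¹ f, hTdef, hR φ₀⁻¹ f]
      exact congrArg f ((c u).toHomeo.symm_apply_apply _)) (φ₀ x)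
  rw [hcomp] at h1
  have h2 : φ₀⁻¹ (φ₀ x) = x := φ₀.toHomeo.symm_apply_apply x
  rw [h2] at h1
  change R' (c u) (SobolevCircle.besselMultiplier q hτ (R (c u)⁻¹ f)) x =
    R' φ₀ ((SobolevCircle.conjSeries hr hτ hq3 hrτ).sum (T u) (T f)) x
  rw [hR' (c u), hR' φ₀, h1]
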